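/- Let $\mathcal X,\mathcal Y_1,\mathcal Y_2,\mathcal Z_1,\mathcal W,\mathcal V_1,\mathcal V_2$ be finite alphabets, let $P_{XY_1Y_2Z_1}$ be a pmf on $\mathcal X\times\mathcal Y_1\times\mathcal Y_2\times\mathcal Z_1$, and let $P_{V_1V_2|W}$ be a discrete memoryless broadcast channel that is degraded, i.e. $P_{V_1V_2|W}(v_1,v_2|w)=P_{V_1|W}(v_1|w)\,P_{V_2|V_1}(v_2|v_1)$ for all $w,v_1,v_2$, for some transition pmf $P_{V_2|V_1}$. All logarithms are to base 2. Testing problem. Under $\mathcal H=0$ the source sequences $(X^n,Y_1^n,Y_2^n,Z_1^n)$ are i.i.d. according to $P_{XY_1Y_2Z_1}$; under $\mathcal H=1$ they are i.i.d. according to $P_{XZ_1}P_{Y_1|Z_1}P_{Y_2}$. A transmitter observes $X^n$ and sends $W^n=\Phi^{(n)}(X^n)$, for a possibly stochastic encoder $\Phi^{(n)}:\mathcal X^n\to\mathcal W^n$, over $n$ uses of the channel. Receiver 1 observes $(V_1^n,Y_1^n,Z_1^n)$, Receiver 2 observes $(V_2^n,Y_2^n)$, and each Receiver $i$ produces a guess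 $\hat{\mathcal H}_i\in\{0,1\}$ as a function of its observations. Let $\alpha_{i,n}=\Pr[\hat{\mathcal H}_i=1\mid\mathcal H=0]$ and $\beta_{i,n}=\Pr[\hat{\mathcal H}_i=0\mid\mathcal H=1]$. For $\epsilon\in(0,1)$ a pair $(\theta_1,\theta_2)$ is $\epsilon$-achievable if there is a sequence (in $n$) of encoders and decision functions such that, for $i\in\{1,2\}$, $\alpha_{i,n}\le\epsilon$ for all sufficiently large $n$ and $-\varlimsup_{n\to\infty}\frac1n\log\beta_{i,n}\ge\theta_i$ (with $\log 0=-\infty$). The exponents region $\mathcal E_{\rm noisy}$ is the closure of the set of nonnegative pairs $(\theta_1,\theta_2)$ that are $\epsilon$-achievable for every $\epsilon\in(0,1)$. Hybrid region. Let $\mathcal E_{\rm noisy}^{\rm hyb}$ be the set of all nonnegative pairs $(\theta_1,\theta_2)$ with $$\theta_1\le I(U_0,U_1;Y_1|Z_1),\qquad \theta_2\le I(U_0;Y_2),$$ for some auxiliary random variables $(U_0,U_1)$ over finite alphabets $\mathcal U_0\times\mathcal U_1$ and some function $f:\mathcal U_0\times\mathcal U_1\times\mathcal X\to\mathcal W$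 such that, with $(X,Y_1,Y_2,Z_1)\sim P_{XY_1Y_2Z_1}$, $W=f(U_0,U_1,X)$ and $(V_1,V_2)$ the output of the channel $P_{V_1V_2|W}$ for the input $W$, the Markov chains $$(U_0,U_1)\to X\to(Z_1,Y_1,Y_2),\qquad (Y_1,Y_2,Z_1)\to(U_0,U_1,X)\to W\to(V_1,V_2)$$ and the inequalities $$I(U_1;X|U_0)\le I(U_1;V_1,Z_1|U_0),\qquad I(U_0;X)\le I(U_0;V_2)$$ hold. Theorem. The region $\mathcal E_{\rm noisy}^{\rm hyb}$ is achievable, i.e. $\mathcal E_{\rm noisy}^{\rm hyb}\subseteq\mathcal E_{\rm noisy}$. -/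

import Mathlib

open Filter Topology

namespace HybridTesting

/-! ### Finite probability

A pmf on a finite set is an element of `stdSimplex ℝ _`.  A finite probability space is a finite
type `Ω` with a pmf `Q` on it, and random variables are functions on `Ω`. -/

section Probability

variable {Ω α β γ δ : Type*} [Fintype Ω]

open Classical in
/-- The pmf of the random variable `A`, i.e. `law Q A a = Pr[A = a]`. -/
noncomputable def law (Q : Ω → ℝ) (A : Ω → α) (a : α) : ℝ :=
  ∑ ω, if A ω = a then Q ω else 0

/-- Mutual information `I(A;B)`, in bits. -/
noncomputable def mutualInfo [Fintype α] [Fintype β]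
    (Q : Ω → ℝ) (A : Ω → α) (B : Ω → β) : ℝ :=
  ∑ a, ∑ b, law Q (fun ω => (A ω, B ω)) (a, b) *
    Real.logb 2 (law Q (fun ω => (A ω, B ω)) (a, b) / (law Q A a * law Q B b))

/-- Conditional mutual information `I(A;B|C)`, in bits. -/
noncomputable def condMutualInfo [Fintype α] [Fintype β] [Fintype γ]
    (Q : Ω → ℝ) (A : Ω → α) (B : Ω → β) (C : Ω → γ) : ℝ :=
  ∑ a, ∑ b, ∑ c, law Q (fun ω => (A ω, B ω, C ω)) (a, b, c) *
    Real.logb 2 ((law Q (fun ω => (A ω, B ω, C ω)) (a, b, c) * law Q C c) /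
      (law Q (fun ω => (A ω, C ω)) (a, c) * law Q (fun ω => (B ω, C ω)) (b, c)))

/-- The Markov chain `A → B → C`: `A` and `C` are conditionally independent given `B`. -/
def IsMarkov (Q : Ω → ℝ) (A : Ω → α) (B : Ω → β) (C : Ω → γ) : Prop :=
  ∀ a b c, law Q (fun ω => (A ω, B ω, C ω)) (a, b, c) * law Q B b =
    law Q (fun ω => (A ω, B ω)) (a, b) * law Q (fun ω => (B ω, C ω)) (b, c)

/-- The Markov chain `A → B → C → D`. -/
def IsMarkov₄ (Q : Ω → ℝ) (A : Ω → α) (B : Ω → β) (C : Ω → γ) (D : Ω → δ) : Prop :=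
  IsMarkov Q A B C ∧ IsMarkov Q (fun ω => (A ω, B ω)) C D

end Probability

section Model

variable {𝒳 𝒴₁ 𝒴₂ 𝒵₁ 𝒲 𝒱₁ 𝒱₂ : Type*}
  [Fintype 𝒳] [Fintype 𝒴₁] [Fintype 𝒴₂] [Fintype 𝒵₁] [Fintype 𝒲] [Fintype 𝒱₁] [Fintype 𝒱₂]

/-- The single-letter pmf `P_{XZ₁} P_{Y₁|Z₁} P_{Y₂}` of `(X, Y₁, Y₂, Z₁)` under the alternative
hypothesis.  (Where `P_{Z₁}` vanishes, so does `P_{XZ₁}`.) -/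
noncomputable def altPmf (P : 𝒳 × 𝒴₁ × 𝒴₂ × 𝒵₁ → ℝ) : 𝒳 × 𝒴₁ × 𝒴₂ × 𝒵₁ → ℝ :=
  fun (x, y₁, y₂, z₁) =>
    (∑ y₁', ∑ y₂', P (x, y₁', y₂', z₁)) *
    ((∑ x', ∑ y₂', P (x', y₁, y₂', z₁)) / (∑ x', ∑ y₁', ∑ y₂', P (x', y₁', y₂', z₁))) *
    (∑ x', ∑ y₁', ∑ z₁', P (x', y₁', y₂, z₁'))

/-- The broadcast channel `Γ`, with `Γ w (v₁, v₂) = P_{V₁V₂|W}(v₁,v₂|w)`, is (physically)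
degraded: `P_{V₁V₂|W}(v₁,v₂|w) = P_{V₁|W}(v₁|w) P_{V₂|V₁}(v₂|v₁)`. -/
def IsDegraded (Γ : 𝒲 → 𝒱₁ × 𝒱₂ → ℝ) : Prop :=
  ∃ D : 𝒱₁ → 𝒱₂ → ℝ, (∀ v₁, D v₁ ∈ stdSimplex ℝ 𝒱₂) ∧
    ∀ w v₁ v₂, Γ w (v₁, v₂) = (∑ v₂', Γ w (v₁, v₂')) * D v₁ v₂

variable (𝒳 𝒴₁ 𝒴₂ 𝒵₁ 𝒲 𝒱₁ 𝒱₂) in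
/-- A blocklength-`n` code: a possibly stochastic encoder, `enc xⁿ wⁿ` being the probability of
the channel input `wⁿ` given the observation `xⁿ`, and two decision functions. -/
structure Code (n : ℕ) where
  enc : (Fin n → 𝒳) → (Fin n → 𝒲) → ℝ
  enc_mem : ∀ x, enc x ∈ stdSimplex ℝ (Fin n → 𝒲)
  dec₁ : (Fin n → 𝒱₁) → (Fin n → 𝒴₁) → (Fin n → 𝒵₁) → Fin 2
  dec₂ : (Fin n → 𝒱₂) → (Fin n → 𝒴₂) → Fin 2

/-- The joint probability of the source sequences, the channel inputs and the channel outputs, if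
the sources are i.i.d. according to `S` and the channel is memoryless with transition pmf `Γ`. -/
noncomputable def blockPmf {n : ℕ} (S : 𝒳 × 𝒴₁ × 𝒴₂ × 𝒵₁ → ℝ) (Γ : 𝒲 → 𝒱₁ × 𝒱₂ → ℝ)
    (c : Code 𝒳 𝒴₁ 𝒴₂ 𝒵₁ 𝒲 𝒱₁ 𝒱₂ n)
    (x : Fin n → 𝒳) (y₁ : Fin n → 𝒴₁) (y₂ : Fin n → 𝒴₂) (z₁ : Fin n → 𝒵₁)
    (w : Fin n → 𝒲) (v₁ : Fin n → 𝒱₁) (v₂ : Fin n → 𝒱₂) : ℝ :=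
  (∏ i, S (x i, y₁ i, y₂ i, z₁ i)) * c.enc x w * ∏ i, Γ (w i) (v₁ i, v₂ i)

open Classical in
/-- The probability that Receiver 1 decides `h` if the sources are i.i.d. according to `S`. -/
noncomputable def decisionProb₁ {n : ℕ} (S : 𝒳 × 𝒴₁ × 𝒴₂ × 𝒵₁ → ℝ) (Γ : 𝒲 → 𝒱₁ × 𝒱₂ → ℝ)
    (c : Code 𝒳 𝒴₁ 𝒴₂ 𝒵₁ 𝒲 𝒱₁ 𝒱₂ n) (h : Fin 2) : ℝ :=
  ∑ x, ∑ y₁, ∑ y₂, ∑ z₁, ∑ w, ∑ v₁, ∑ v₂,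
    if c.dec₁ v₁ y₁ z₁ = h then blockPmf S Γ c x y₁ y₂ z₁ w v₁ v₂ else 0

open Classical in
/-- The probability that Receiver 2 decides `h` if the sources are i.i.d. according to `S`. -/
noncomputable def decisionProb₂ {n : ℕ} (S : 𝒳 × 𝒴₁ × 𝒴₂ × 𝒵₁ → ℝ) (Γ : 𝒲 → 𝒱₁ × 𝒱₂ → ℝ)
    (c : Code 𝒳 𝒴₁ 𝒴₂ 𝒵₁ 𝒲 𝒱₁ 𝒱₂ n) (h : Fin 2) : ℝ :=
  ∑ x, ∑ y₁, ∑ y₂, ∑ z₁, ∑ w, ∑ v₁, ∑ v₂,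
    if c.dec₂ v₂ y₂ = h then blockPmf S Γ c x y₁ y₂ z₁ w v₁ v₂ else 0

open Classical in
/-- Base-2 logarithm of a probability, with `log 0 = -∞`. -/
noncomputable def log₂ (p : ℝ) : EReal := if p = 0 then ⊥ else (Real.logb 2 p : EReal)

/-- The error exponent `-limsup (1/n) log β_n`, in the extended reals. -/
noncomputable def exponent (β : ℕ → ℝ) : EReal :=
  -limsup (fun n : ℕ => ((1 / (n : ℝ) : ℝ) : EReal) * log₂ (β n)) atTop

/-- `ε`-achievability of `(θ₁, θ₂)`: type-I errors are decisions for `1` under the null hypothesis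
(sources i.i.d. `P`), type-II errors are decisions for `0` under the alternative hypothesis
(sources i.i.d. `altPmf P`). -/
def IsAchievable (P : 𝒳 × 𝒴₁ × 𝒴₂ × 𝒵₁ → ℝ) (Γ : 𝒲 → 𝒱₁ × 𝒱₂ → ℝ) (ε θ₁ θ₂ : ℝ) : Prop :=
  ∃ c : ∀ n, Code 𝒳 𝒴₁ 𝒴₂ 𝒵₁ 𝒲 𝒱₁ 𝒱₂ n,
    (∀ᶠ n in atTop, decisionProb₁ P Γ (c n) 1 ≤ ε ∧ decisionProb₂ P Γ (c n) 1 ≤ ε) ∧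
    (θ₁ : EReal) ≤ exponent (fun n => decisionProb₁ (altPmf P) Γ (c n) 0) ∧
    (θ₂ : EReal) ≤ exponent (fun n => decisionProb₂ (altPmf P) Γ (c n) 0)

/-- The exponents region: the closure of the set of nonnegative pairs that are `ε`-achievable for
every `ε ∈ (0, 1)`. -/
def exponentsRegion (P : 𝒳 × 𝒴₁ × 𝒴₂ × 𝒵₁ → ℝ) (Γ : 𝒲 → 𝒱₁ × 𝒱₂ → ℝ) : Set (ℝ × ℝ) :=
  closure {θ | 0 ≤ θ.1 ∧ 0 ≤ θ.2 ∧ ∀ ε ∈ Set.Ioo (0 : ℝ) 1, IsAchievable P Γ ε θ.1 θ.2}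

/-- The hybrid-coding region: all nonnegative `(θ₁, θ₂)` for which there are random variables
`U₀, U₁, X, Y₁, Y₂, Z₁, W, V₁, V₂` on some finite probability space, with finite auxiliary
alphabets `𝒰₀, 𝒰₁`, and a map `f` satisfying the requirements below. -/
def hybridRegion (P : 𝒳 × 𝒴₁ × 𝒴₂ × 𝒵₁ → ℝ) (Γ : 𝒲 → 𝒱₁ × 𝒱₂ → ℝ) : Set (ℝ × ℝ) :=
  {θ | 0 ≤ θ.1 ∧ 0 ≤ θ.2 ∧
    ∃ (Ω 𝒰₀ 𝒰₁ : Type) (_ : Fintype Ω) (_ : Fintype 𝒰₀) (_ : Fintype 𝒰₁) (Q : Ω → ℝ)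
      (U₀ : Ω → 𝒰₀) (U₁ : Ω → 𝒰₁) (X : Ω → 𝒳) (Y₁ : Ω → 𝒴₁) (Y₂ : Ω → 𝒴₂) (Z₁ : Ω → 𝒵₁)
      (W : Ω → 𝒲) (V₁ : Ω → 𝒱₁) (V₂ : Ω → 𝒱₂) (f : 𝒰₀ → 𝒰₁ → 𝒳 → 𝒲),
      Q ∈ stdSimplex ℝ Ω ∧
      -- the sources have joint pmf `P`
      (∀ s, law Q (fun ω => (X ω, Y₁ ω, Y₂ ω, Z₁ ω)) s = P s) ∧
      -- `(V₁, V₂)` is the output of the channel for the input `W`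
      (∀ w v, law Q (fun ω => (W ω, (V₁ ω, V₂ ω))) (w, v) = law Q W w * Γ w v) ∧
      -- Markov chains
      IsMarkov Q (fun ω => (U₀ ω, U₁ ω)) X (fun ω => (Z₁ ω, Y₁ ω, Y₂ ω)) ∧
      IsMarkov₄ Q (fun ω => (Y₁ ω, Y₂ ω, Z₁ ω)) (fun ω => (U₀ ω, U₁ ω, X ω)) W
        (fun ω => (V₁ ω, V₂ ω)) ∧
      -- channel input
      (∀ ω, W ω = f (U₀ ω) (U₁ ω) (X ω)) ∧
      -- decodability constraints
      condMutualInfo Q U₁ X U₀ ≤ condMutualInfo Q U₁ (fun ω => (V₁ ω, Z₁ ω)) U₀ ∧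
      mutualInfo Q U₀ X ≤ mutualInfo Q U₀ V₂ ∧
      -- exponents
      θ.1 ≤ condMutualInfo Q (fun ω => (U₀ ω, U₁ ω)) Y₁ Z₁ ∧
      θ.2 ≤ mutualInfo Q U₀ Y₂}

end Model

end HybridTesting

/-! The two error types are handled by different means. Under the alternative, `Y₁` is generated
from `Z₁` alone and `Y₂` from nothing, whatever the encoder, the channel and the decoders do.
Suppose that Receiver 1 applies to its decoded codeword a likelihood-ratio test of the joint law of
(U, Y₁) given Z₁ against conditional independence, with threshold 2^(n t₁). A change of measure
bounds the type-II error, conditionally on the channel output and on Z₁, by 2^(-n t₁). This holds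
for every codeword, hence for every codebook and every decoding rule. The same is true of Receiver 2
with the cloud centre and Y₂. So decoding is never analysed under the alternative, and there is no
union over codewords there (`sum_altPmf_le`, `sum_condRatioTest_le`, `sum_ratioTest_le`).

What remains is to make the type-I errors vanish for t₁ < I(U₀,U₁;Y₁|Z₁) and t₂ < I(U₀;Y₂). The code
is a random superposition codebook of rates R₀, R₁ with a likelihood encoder: a codeword is chosen
with probability proportional to the likelihood it gives to the observed source block, and `f` is
applied symbolwise. Compare this with an ideal experiment in which the codeword is uniform and X is
drawn from it. Both have the same conditional law of the codeword given X, by Bayes' rule, so they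
differ only in the law of X. That difference vanishes in total variation by soft covering if R₀ >
I(U₀;X) and R₀ + R₁ > I(U₀,U₁;X) (`softCovering`, `likelihood_error_le`). In the ideal experiment
hybrid coding is plain superposition coding over a memoryless channel from (U₀,U₁) to all outputs.
Threshold decoding succeeds if R₀ < I(U₀;V₂), R₁ < I(U₁;V₁,Z₁|U₀) and R₀ + R₁ < I(U₀,U₁;V₁,Z₁)
(`expect_error_satellite`, `expect_error_cloud`), and the tests accept by the weak law of large
numbers. Degradedness gives I(U₀;V₂) ≤ I(U₀;V₁,Z₁), so under strict decodability constraints rates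
slightly above I(U₀;X) and I(U₁;X|U₀) satisfy every requirement (`HybridModel.isAchievable`).

The constraints of the region are not strict. They become strict by time sharing, with a small
weight, with a model whose auxiliary variables are independent of the sources and merely probe the
channel with two inputs (`HybridModel.exists_strict`). The exponents lose an arbitrarily small
amount, which the closure absorbs. The two inputs must be distinguishable at Receiver 1, and at
Receiver 2 too if its exponent is positive; otherwise Receiver 2 always decides for the null
hypothesis. If no two inputs are distinguishable at Receiver 1, the constraints and data processing
force both exponents to be zero. -/

namespace HybridTesting

set_option linter.unusedSectionVars false

/-! ### Expectations on finite probability spaces -/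

section Expectation

variable {Ω α β γ ι κ : Type*} [Fintype Ω]

open Classical in
/-- The indicator of a proposition. -/
noncomputable def ind (p : Prop) : ℝ := if p then 1 else 0

lemma ind_of {p : Prop} (h : p) : ind p = 1 := by simp [ind, h]

lemma ind_of_not {p : Prop} (h : ¬ p) : ind p = 0 := by simp [ind, h]

lemma ind_nonneg (p : Prop) : 0 ≤ ind p := by
  unfold ind; split_ifs <;> norm_num

lemma ind_le_one (p : Prop) : ind p ≤ 1 := by
  unfold ind; split_ifs <;> norm_num

lemma ind_and (p q : Prop) : ind (p ∧ q) = ind p * ind q := by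
  by_cases hp : p <;> by_cases hq : q <;> simp [ind, hp, hq]

lemma ind_congr {p q : Prop} (h : p ↔ q) : ind p = ind q := by rw [propext h]

lemma ind_add_ind_not (p : Prop) : ind p + ind (¬ p) = 1 := by
  by_cases hp : p <;> simp [ind, hp]

lemma ind_mono {p q : Prop} (h : p → q) : ind p ≤ ind q := by
  by_cases hp : p
  · rw [ind_of hp, ind_of (h hp)]
  · rw [ind_of_not hp]; exact ind_nonneg q

open Classical in
lemma sum_ind_eq [Fintype α] (a : α) (g : α → ℝ) : ∑ b, ind (a = b) * g b = g a := by
  simp [ind]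

lemma ind_forall [Fintype ι] (p : ι → Prop) : ind (∀ i, p i) = ∏ i, ind (p i) := by
  by_cases h : ∀ i, p i
  · rw [ind_of h, Finset.prod_eq_one fun i _ => ind_of (h i)]
  · rw [ind_of_not h]
    obtain ⟨i, hi⟩ := not_forall.1 h
    exact (Finset.prod_eq_zero (Finset.mem_univ i) (ind_of_not hi)).symm

/-- The expectation of `g` under the weights `Q`. -/
noncomputable def expect (Q : Ω → ℝ) (g : Ω → ℝ) : ℝ := ∑ ω, Q ω * g ω

lemma expect_add (Q g h : Ω → ℝ) :
    expect Q (fun ω => g ω + h ω) = expect Q g + expect Q h := by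
  simp [expect, mul_add, Finset.sum_add_distrib]

lemma expect_sub (Q g h : Ω → ℝ) :
    expect Q (fun ω => g ω - h ω) = expect Q g - expect Q h := by
  simp [expect, mul_sub, Finset.sum_sub_distrib]

lemma expect_const_mul (Q g : Ω → ℝ) (c : ℝ) :
    expect Q (fun ω => c * g ω) = c * expect Q g := by
  simp only [expect, Finset.mul_sum]
  exact Finset.sum_congr rfl fun _ _ => by ring

lemma expect_sum (s : Finset ι) (Q : Ω → ℝ) (g : ι → Ω → ℝ) :
    expect Q (fun ω => ∑ i ∈ s, g i ω) = ∑ i ∈ s, expect Q (g i) := by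
  simp only [expect, Finset.mul_sum]
  exact Finset.sum_comm

lemma expect_const {Q : Ω → ℝ} (hQ : Q ∈ stdSimplex ℝ Ω) (c : ℝ) :
    expect Q (fun _ => c) = c := by
  rw [expect, ← Finset.sum_mul, hQ.2, one_mul]

/-- Domination is asked for only on the support of `Q`, since log-likelihood ratios are controlled
only there. -/
lemma expect_mono {Q : Ω → ℝ} (hQ : ∀ ω, 0 ≤ Q ω) {g h : Ω → ℝ}
    (hgh : ∀ ω, Q ω ≠ 0 → g ω ≤ h ω) : expect Q g ≤ expect Q h := by
  refine Finset.sum_le_sum fun ω _ => ?_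
  by_cases h0 : Q ω = 0
  · simp [h0]
  · exact mul_le_mul_of_nonneg_left (hgh ω h0) (hQ ω)

lemma expect_congr {Q : Ω → ℝ} {g h : Ω → ℝ} (hgh : ∀ ω, Q ω ≠ 0 → g ω = h ω) :
    expect Q g = expect Q h := by
  refine Finset.sum_congr rfl fun ω _ => ?_
  by_cases h0 : Q ω = 0
  · simp [h0]
  · rw [hgh ω h0]

lemma expect_nonneg {Q : Ω → ℝ} (hQ : ∀ ω, 0 ≤ Q ω) {g : Ω → ℝ} (hg : ∀ ω, 0 ≤ g ω) :
    0 ≤ expect Q g := Finset.sum_nonneg fun ω _ => mul_nonneg (hQ ω) (hg ω)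

/-- The random-coding principle: it turns a bound on the mean over codebooks into one good codebook.
-/
lemma exists_le_expect {Q : Ω → ℝ} (hQ : Q ∈ stdSimplex ℝ Ω) (g : Ω → ℝ) :
    ∃ ω, g ω ≤ expect Q g := by
  by_contra! h
  have h1 : expect Q (fun ω => g ω - expect Q g) = 0 := by
    rw [expect_sub, expect_const hQ, sub_self]
  have h2 := (Finset.sum_eq_zero_iff_of_nonneg fun ω _ =>
    mul_nonneg (hQ.1 ω) (sub_nonneg.2 (h ω).le)).1 h1
  have h3 : ∀ ω, Q ω = 0 := fun ω =>
    (mul_eq_zero.1 (h2 ω (Finset.mem_univ ω))).resolve_right (sub_pos.2 (h ω)).ne'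
  have := hQ.2
  simp [h3] at this

lemma expect_sq_le {Q : Ω → ℝ} (hQ : Q ∈ stdSimplex ℝ Ω) (g : Ω → ℝ) :
    expect Q g ^ 2 ≤ expect Q fun ω => g ω ^ 2 := by
  have h := expect_nonneg hQ.1 (g := fun ω => (g ω - expect Q g) ^ 2) fun ω => sq_nonneg _
  have e : (fun ω => (g ω - expect Q g) ^ 2)
      = fun ω => (g ω ^ 2 - (2 * expect Q g) * g ω) + expect Q g ^ 2 := by
    ext; ring
  rw [e, expect_add, expect_sub, expect_const_mul, expect_const hQ] at h
  nlinarith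

/-- `E |g| ≤ √(E g²)`. -/
lemma expect_abs_le_sqrt {Q : Ω → ℝ} (hQ : Q ∈ stdSimplex ℝ Ω) {g : Ω → ℝ} {c : ℝ}
    (h : expect Q (fun ω => g ω ^ 2) ≤ c) : expect Q (fun ω => |g ω|) ≤ √c := by
  refine Real.le_sqrt_of_sq_le ((expect_sq_le hQ _).trans ?_)
  simpa using h

lemma law_eq_expect (Q : Ω → ℝ) (A : Ω → α) (a : α) :
    law Q A a = expect Q (fun ω => ind (A ω = a)) := by
  refine Finset.sum_congr rfl fun ω _ => ?_
  simp [ind]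

lemma law_nonneg {Q : Ω → ℝ} (hQ : ∀ ω, 0 ≤ Q ω) (A : Ω → α) (a : α) : 0 ≤ law Q A a := by
  rw [law_eq_expect]; exact expect_nonneg hQ fun _ => ind_nonneg _

/-- The law of the unconscious statistician. -/
lemma expect_comp [Fintype α] (Q : Ω → ℝ) (A : Ω → α) (g : α → ℝ) :
    expect Q (fun ω => g (A ω)) = ∑ a, law Q A a * g a := by
  simp only [law_eq_expect, expect, Finset.sum_mul]
  rw [Finset.sum_comm]
  refine Finset.sum_congr rfl fun ω _ => ?_
  simp only [mul_assoc, ← Finset.mul_sum, sum_ind_eq]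

lemma law_congr (Q : Ω → ℝ) {A : Ω → α} {B : Ω → β} {a : α} {b : β}
    (h : ∀ ω, A ω = a ↔ B ω = b) : law Q A a = law Q B b := by
  simp only [law_eq_expect, h]

lemma sum_law [Fintype α] {Q : Ω → ℝ} (hQ : Q ∈ stdSimplex ℝ Ω) (A : Ω → α) :
    ∑ a, law Q A a = 1 := by
  have := expect_comp Q A fun _ => 1
  rw [expect_const hQ] at this
  simpa using this.symm

lemma law_mem [Fintype α] {Q : Ω → ℝ} (hQ : Q ∈ stdSimplex ℝ Ω) (A : Ω → α) :
    law Q A ∈ stdSimplex ℝ α := ⟨law_nonneg hQ.1 A, sum_law hQ A⟩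

/-- Marginalization. -/
lemma sum_law_pair [Fintype β] (Q : Ω → ℝ) (A : Ω → α) (B : Ω → β) (a : α) :
    ∑ b, law Q (fun ω => (A ω, B ω)) (a, b) = law Q A a := by
  simp only [law_eq_expect, ← expect_sum, Prod.mk.injEq, ind_and]
  congr 1; ext ω
  rw [← Finset.mul_sum]
  have := sum_ind_eq (B ω) fun _ => 1
  simp only [mul_one] at this
  rw [this, mul_one]

/-- Values that occur on the support have positive mass; this legitimizes the quotients and
logarithms of laws under an expectation. -/
lemma law_pos {Q : Ω → ℝ} (hQ : ∀ ω, 0 ≤ Q ω) (A : Ω → α) {ω : Ω} (h : Q ω ≠ 0) :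
    0 < law Q A (A ω) := by
  rw [law_eq_expect]
  refine Finset.sum_pos' (fun ω' _ => mul_nonneg (hQ ω') (ind_nonneg _))
    ⟨ω, Finset.mem_univ ω, ?_⟩
  simp only [ind_of, mul_one]
  exact (hQ ω).lt_of_ne' h

lemma law_le_of_imp {Q : Ω → ℝ} (hQ : ∀ ω, 0 ≤ Q ω) {A : Ω → α} {B : Ω → β} {a : α} {b : β}
    (h : ∀ ω, A ω = a → B ω = b) : law Q A a ≤ law Q B b := by
  rw [law_eq_expect, law_eq_expect]
  exact expect_mono hQ fun ω _ => ind_mono (h ω)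

lemma law_eq_zero_of_imp {Q : Ω → ℝ} (hQ : ∀ ω, 0 ≤ Q ω) {A : Ω → α} {B : Ω → β} {a : α} {b : β}
    (h : ∀ ω, A ω = a → B ω = b) (h0 : law Q B b = 0) : law Q A a = 0 :=
  le_antisymm (h0 ▸ law_le_of_imp hQ h) (law_nonneg hQ A a)

lemma law_law [Fintype α] (Q : Ω → ℝ) (A : Ω → α) (B : α → β) (b : β) :
    law (law Q A) B b = law Q (fun ω => B (A ω)) b := by
  rw [law_eq_expect, law_eq_expect, expect_comp Q A fun a => ind (B a = b)]
  rfl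

end Expectation

/-! ### Product distributions -/

section Product

variable {Ω α ι : Type*} [Fintype Ω] [Fintype ι] [DecidableEq ι]

/-- The i.i.d. distribution with marginals `Q`. -/
def prodPmf (Q : Ω → ℝ) (ω : ι → Ω) : ℝ := ∏ i, Q (ω i)

lemma sum_pi_prod (g : ι → Ω → ℝ) : ∑ ω : ι → Ω, ∏ i, g i (ω i) = ∏ i, ∑ a, g i a := by
  rw [Finset.prod_univ_sum, Fintype.piFinset_univ]

lemma expect_prodPmf_prod (Q : Ω → ℝ) (g : ι → Ω → ℝ) :
    expect (prodPmf Q) (fun ω : ι → Ω => ∏ i, g i (ω i)) = ∏ i, expect Q (g i) := by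
  simp only [expect, prodPmf, ← Finset.prod_mul_distrib]
  exact sum_pi_prod fun i a => Q a * g i a

lemma prodPmf_mem {Q : Ω → ℝ} (hQ : Q ∈ stdSimplex ℝ Ω) :
    prodPmf Q ∈ stdSimplex ℝ (ι → Ω) := by
  refine ⟨fun ω => Finset.prod_nonneg fun i _ => hQ.1 _, ?_⟩
  simp only [prodPmf]
  rw [sum_pi_prod fun _ => Q]
  simp [hQ.2]

lemma expect_prodPmf_apply {Q : Ω → ℝ} (hQ : Q ∈ stdSimplex ℝ Ω) (i : ι) (g : Ω → ℝ) :
    expect (prodPmf Q) (fun ω : ι → Ω => g (ω i)) = expect Q g := by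
  have h := expect_prodPmf_prod (ι := ι) Q fun k a => if k = i then g a else 1
  simp only [Finset.prod_ite_eq', Finset.mem_univ, if_true] at h
  rw [h, Finset.prod_eq_single i]
  · simp
  · intro k _ hk
    simp only [hk, if_false]
    exact expect_const hQ 1
  · simp

lemma expect_prodPmf_mul {Q : Ω → ℝ} (hQ : Q ∈ stdSimplex ℝ Ω) {i j : ι} (hij : i ≠ j)
    (g h : Ω → ℝ) :
    expect (prodPmf Q) (fun ω : ι → Ω => g (ω i) * h (ω j)) = expect Q g * expect Q h := by
  have e := expect_prodPmf_prod (ι := ι) Q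
    fun k a => (if k = i then g a else 1) * (if k = j then h a else 1)
  simp only [Finset.prod_mul_distrib, Finset.prod_ite_eq', Finset.mem_univ, if_true] at e
  rw [e, ← Finset.mul_prod_erase _ _ (Finset.mem_univ i),
    ← Finset.mul_prod_erase _ _ (Finset.mem_erase.2 ⟨hij.symm, Finset.mem_univ j⟩),
    Finset.prod_eq_one]
  · simp [hij, hij.symm]
  · intro k hk
    simp only [Finset.mem_erase] at hk
    simp only [hk.1, hk.2.1, if_false, mul_one]
    exact expect_const hQ 1

/-- Expanding in the indicators of the first coordinate reduces to products of functions of one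
coordinate. -/
lemma expect_prodPmf_pair {Q : Ω → ℝ} (hQ : Q ∈ stdSimplex ℝ Ω) {i j : ι} (hij : i ≠ j)
    (g : Ω → Ω → ℝ) :
    expect (prodPmf Q) (fun ω : ι → Ω => g (ω i) (ω j))
      = expect Q (fun a => expect Q (fun b => g a b)) := by
  have e : ∀ ω : ι → Ω, g (ω i) (ω j) = ∑ a, ind (ω i = a) * g a (ω j) := fun ω =>
    (sum_ind_eq (ω i) fun a => g a (ω j)).symm
  simp only [e, expect_sum]
  have e2 : ∀ a, expect (prodPmf Q) (fun ω : ι → Ω => ind (ω i = a) * g a (ω j))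
      = expect Q (fun b => ind (b = a)) * expect Q (g a) := fun a =>
    expect_prodPmf_mul hQ hij (fun b => ind (b = a)) (g a)
  simp only [e2]
  rw [show expect Q (fun a => expect Q (fun b => g a b)) = ∑ a, Q a * expect Q (g a) from rfl]
  refine Finset.sum_congr rfl fun a _ => ?_
  congr 1
  have := sum_ind_eq a Q
  rw [← this]
  refine Finset.sum_congr rfl fun b _ => ?_
  rw [mul_comm, ind_congr eq_comm]

/-- The variance of a sum of i.i.d. centred variables. -/
lemma expect_sq_sum {Q : Ω → ℝ} (hQ : Q ∈ stdSimplex ℝ Ω) (g : Ω → ℝ) (hg : expect Q g = 0) :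
    expect (prodPmf Q) (fun ω : ι → Ω => (∑ i, g (ω i)) ^ 2)
      = Fintype.card ι * expect Q (fun a => g a ^ 2) := by
  simp only [sq, Finset.sum_mul_sum, expect_sum]
  have : ∀ i j : ι, expect (prodPmf Q) (fun ω : ι → Ω => g (ω i) * g (ω j))
      = if i = j then expect Q (fun a => g a * g a) else 0 := by
    intro i j
    split_ifs with h
    · subst h
      exact expect_prodPmf_apply hQ i fun a => g a * g a
    · rw [expect_prodPmf_mul hQ h, hg, zero_mul]
  simp [this]

/-- The variance of an average of i.i.d. variables. -/
lemma expect_sq_average [Nonempty ι] {Q : Ω → ℝ} (hQ : Q ∈ stdSimplex ℝ Ω) (g : Ω → ℝ) :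
    expect (prodPmf Q) (fun ω : ι → Ω =>
        ((Fintype.card ι : ℝ)⁻¹ * ∑ i, g (ω i) - expect Q g) ^ 2)
      ≤ (Fintype.card ι : ℝ)⁻¹ * expect Q (fun a => g a ^ 2) := by
  have hN : (Fintype.card ι : ℝ) ≠ 0 := Nat.cast_ne_zero.2 Fintype.card_ne_zero
  set μ := expect Q g with hμ
  have h0 : expect Q (fun a => g a - μ) = 0 := by rw [expect_sub, expect_const hQ, sub_self]
  have e : ∀ ω : ι → Ω, ((Fintype.card ι : ℝ)⁻¹ * ∑ i, g (ω i) - μ) ^ 2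
      = ((Fintype.card ι : ℝ)⁻¹) ^ 2 * (∑ i, (g (ω i) - μ)) ^ 2 := by
    intro ω
    rw [Finset.sum_sub_distrib, ← mul_pow]
    congr 1
    simp only [Finset.sum_const, Finset.card_univ, nsmul_eq_mul]
    field_simp
  simp only [e]
  rw [expect_const_mul, expect_sq_sum hQ _ h0]
  have e2 : expect Q (fun a => (g a - μ) ^ 2) ≤ expect Q (fun a => g a ^ 2) := by
    have e3 : (fun a => (g a - μ) ^ 2) = fun a => (g a ^ 2 - (2 * μ) * g a) + μ ^ 2 := by
      ext; ring
    rw [e3, expect_add, expect_sub, expect_const_mul, expect_const hQ, ← hμ]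
    nlinarith [sq_nonneg μ]
  calc _ = (Fintype.card ι : ℝ)⁻¹ * expect Q (fun a => (g a - μ) ^ 2) := by field_simp
    _ ≤ _ := mul_le_mul_of_nonneg_left e2 (by positivity)

/-- The second moment of an average of i.i.d. variables. -/
lemma expect_average_sq [Nonempty ι] {Q : Ω → ℝ} (hQ : Q ∈ stdSimplex ℝ Ω) (g : Ω → ℝ) :
    expect (prodPmf Q) (fun ω : ι → Ω => ((Fintype.card ι : ℝ)⁻¹ * ∑ i, g (ω i)) ^ 2)
      ≤ (Fintype.card ι : ℝ)⁻¹ * expect Q (fun a => g a ^ 2) + expect Q g ^ 2 := by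
  have h := expect_sq_average (ι := ι) hQ g
  have hN : (Fintype.card ι : ℝ) ≠ 0 := Nat.cast_ne_zero.2 Fintype.card_ne_zero
  set μ := expect Q g with hμ
  have e : (fun ω : ι → Ω => ((Fintype.card ι : ℝ)⁻¹ * ∑ i, g (ω i) - μ) ^ 2)
      = fun ω => ((((Fintype.card ι : ℝ)⁻¹ * ∑ i, g (ω i)) ^ 2
        - (2 * μ) * ((Fintype.card ι : ℝ)⁻¹ * ∑ i, g (ω i))) + μ ^ 2) := by ext; ring
  rw [e, expect_add, expect_sub, expect_const_mul, expect_const_mul, expect_sum,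
    expect_const (prodPmf_mem hQ)] at h
  simp only [expect_prodPmf_apply hQ, Finset.sum_const, Finset.card_univ, nsmul_eq_mul,
    ← hμ] at h
  rw [inv_mul_cancel_left₀ hN] at h
  nlinarith

/-- Componentwise events are independent. -/
lemma sum_prodPmf_ind (Q : Ω → ℝ) (p : ι → Ω → Prop) :
    expect (prodPmf Q) (fun ω : ι → Ω => ind (∀ i, p i (ω i)))
      = ∏ i, expect Q (fun a => ind (p i a)) := by
  simp only [ind_forall]
  exact expect_prodPmf_prod Q fun i a => ind (p i a)

lemma law_prodPmf (Q : Ω → ℝ) (A : Ω → α) (a : ι → α) :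
    law (prodPmf Q) (fun (ω : ι → Ω) i => A (ω i)) a = ∏ i, law Q A (a i) := by
  simp only [law_eq_expect, funext_iff]
  exact sum_prodPmf_ind Q fun i b => A b = a i

end Product

/-! ### Random superposition codebooks -/

section Codebook

variable {𝒰₀ 𝒰₁ 𝒳 𝒪 ι κ : Type*} [Fintype 𝒰₀] [Fintype 𝒰₁] [Fintype 𝒳] [Fintype 𝒪]
  [Fintype ι] [DecidableEq ι] [Fintype κ] [DecidableEq κ]

variable (𝒰₀ 𝒰₁ ι κ) in
/-- A superposition codebook: cloud centres `(c i).1` with satellites `(c i).2 k`. -/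
abbrev Codebook := ι → 𝒰₀ × (κ → 𝒰₁)

/-- The expectation of `g (U₀, U₁)` if `U₀ ∼ p₀` and `U₁ ∼ p₁ U₀`. -/
noncomputable def expect₂ (p₀ : 𝒰₀ → ℝ) (p₁ : 𝒰₀ → 𝒰₁ → ℝ) (g : 𝒰₀ → 𝒰₁ → ℝ) : ℝ :=
  expect p₀ fun u => expect (p₁ u) (g u)

/-- The distribution of a random cloud: a centre with conditionally i.i.d. satellites. -/
def cloudPmf (p₀ : 𝒰₀ → ℝ) (p₁ : 𝒰₀ → 𝒰₁ → ℝ) (a : 𝒰₀ × (κ → 𝒰₁)) : ℝ :=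
  p₀ a.1 * prodPmf (p₁ a.1) a.2

/-- The distribution of the random codebook: i.i.d. clouds. -/
def codebookPmf (p₀ : 𝒰₀ → ℝ) (p₁ : 𝒰₀ → 𝒰₁ → ℝ) : Codebook 𝒰₀ 𝒰₁ ι κ → ℝ :=
  prodPmf (cloudPmf p₀ p₁)

variable {p₀ : 𝒰₀ → ℝ} {p₁ : 𝒰₀ → 𝒰₁ → ℝ}

lemma expect_cloudPmf (g : 𝒰₀ × (κ → 𝒰₁) → ℝ) :
    expect (cloudPmf p₀ p₁) g
      = expect p₀ fun u => expect (prodPmf (p₁ u)) fun v : κ → 𝒰₁ => g (u, v) := by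
  simp only [expect, cloudPmf, Fintype.sum_prod_type, Finset.mul_sum, mul_assoc]

lemma expect₂_nonneg (h₀ : p₀ ∈ stdSimplex ℝ 𝒰₀) (h₁ : ∀ u, p₁ u ∈ stdSimplex ℝ 𝒰₁)
    {g : 𝒰₀ → 𝒰₁ → ℝ} (hg : ∀ u v, 0 ≤ g u v) : 0 ≤ expect₂ p₀ p₁ g :=
  expect_nonneg h₀.1 fun u => expect_nonneg (h₁ u).1 (hg u)

lemma expect₂_mono (h₀ : p₀ ∈ stdSimplex ℝ 𝒰₀) (h₁ : ∀ u, p₁ u ∈ stdSimplex ℝ 𝒰₁)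
    {g h : 𝒰₀ → 𝒰₁ → ℝ} (hg : ∀ u v, g u v ≤ h u v) : expect₂ p₀ p₁ g ≤ expect₂ p₀ p₁ h :=
  expect_mono h₀.1 fun u _ => expect_mono (h₁ u).1 fun v _ => hg u v

lemma expect₂_sum {α : Type*} (s : Finset α) (g : α → 𝒰₀ → 𝒰₁ → ℝ) :
    expect₂ p₀ p₁ (fun u v => ∑ i ∈ s, g i u v) = ∑ i ∈ s, expect₂ p₀ p₁ (g i) := by
  simp only [expect₂, expect_sum]

lemma expect₂_add (g h : 𝒰₀ → 𝒰₁ → ℝ) :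
    expect₂ p₀ p₁ (fun u v => g u v + h u v) = expect₂ p₀ p₁ g + expect₂ p₀ p₁ h := by
  simp only [expect₂, expect_add]

lemma expect₂_const_mul (c : ℝ) (g : 𝒰₀ → 𝒰₁ → ℝ) :
    expect₂ p₀ p₁ (fun u v => c * g u v) = c * expect₂ p₀ p₁ g := by
  simp only [expect₂, expect_const_mul]

lemma cloudPmf_mem (h₀ : p₀ ∈ stdSimplex ℝ 𝒰₀) (h₁ : ∀ u, p₁ u ∈ stdSimplex ℝ 𝒰₁) :
    cloudPmf p₀ p₁ ∈ stdSimplex ℝ (𝒰₀ × (κ → 𝒰₁)) := by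
  refine ⟨fun a => mul_nonneg (h₀.1 _) ((prodPmf_mem (h₁ a.1)).1 _), ?_⟩
  have := expect_cloudPmf (p₀ := p₀) (p₁ := p₁) (κ := κ) fun _ => 1
  simp only [expect_const (prodPmf_mem (h₁ _)), expect_const h₀] at this
  simpa [expect] using this

lemma codebookPmf_mem (h₀ : p₀ ∈ stdSimplex ℝ 𝒰₀) (h₁ : ∀ u, p₁ u ∈ stdSimplex ℝ 𝒰₁) :
    codebookPmf p₀ p₁ ∈ stdSimplex ℝ (Codebook 𝒰₀ 𝒰₁ ι κ) :=
  prodPmf_mem (cloudPmf_mem h₀ h₁)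

lemma expect_codebook (h₀ : p₀ ∈ stdSimplex ℝ 𝒰₀) (h₁ : ∀ u, p₁ u ∈ stdSimplex ℝ 𝒰₁)
    (i : ι) (k : κ) (g : 𝒰₀ → 𝒰₁ → ℝ) :
    expect (codebookPmf p₀ p₁) (fun c : Codebook 𝒰₀ 𝒰₁ ι κ => g (c i).1 ((c i).2 k))
      = expect₂ p₀ p₁ g := by
  rw [codebookPmf, expect_prodPmf_apply (cloudPmf_mem h₀ h₁) i fun a => g a.1 (a.2 k),
    expect_cloudPmf]
  simp only [expect_prodPmf_apply (h₁ _), expect₂]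

/-- Satellites of one cloud share their centre and are independent only given it. So a competitor in
the true cloud is redrawn from `p₁` at the true centre, whereas one in another cloud
(`expect_codebook_clouds`) is drawn entirely afresh. -/
lemma expect_codebook_satellites (h₀ : p₀ ∈ stdSimplex ℝ 𝒰₀)
    (h₁ : ∀ u, p₁ u ∈ stdSimplex ℝ 𝒰₁) (i : ι) {k k' : κ} (hk : k ≠ k')
    (g : 𝒰₀ → 𝒰₁ → 𝒰₁ → ℝ) :
    expect (codebookPmf p₀ p₁)
        (fun c : Codebook 𝒰₀ 𝒰₁ ι κ => g (c i).1 ((c i).2 k) ((c i).2 k'))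
      = expect₂ p₀ p₁ fun u a => expect (p₁ u) fun b => g u a b := by
  rw [codebookPmf,
    expect_prodPmf_apply (cloudPmf_mem h₀ h₁) i fun a => g a.1 (a.2 k) (a.2 k'), expect_cloudPmf]
  simp only [expect_prodPmf_pair (h₁ _) hk, expect₂]

lemma expect_codebook_clouds (h₀ : p₀ ∈ stdSimplex ℝ 𝒰₀) (h₁ : ∀ u, p₁ u ∈ stdSimplex ℝ 𝒰₁)
    {i i' : ι} (hi : i ≠ i') (k k' : κ) (g : 𝒰₀ → 𝒰₁ → 𝒰₀ → 𝒰₁ → ℝ) :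
    expect (codebookPmf p₀ p₁)
        (fun c : Codebook 𝒰₀ 𝒰₁ ι κ => g (c i).1 ((c i).2 k) (c i').1 ((c i').2 k'))
      = expect₂ p₀ p₁ fun u a => expect₂ p₀ p₁ fun u' a' => g u a u' a' := by
  rw [codebookPmf, expect_prodPmf_pair (cloudPmf_mem h₀ h₁) hi
    fun a b => g a.1 (a.2 k) b.1 (b.2 k'), expect_cloudPmf]
  simp only [expect_cloudPmf, expect_prodPmf_apply (h₁ _), expect₂]
  congr 1; ext u
  exact expect_prodPmf_apply (h₁ u) k fun a =>
    expect p₀ fun u' => expect (p₁ u') fun a' => g u a u' a'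

variable [Nonempty ι] [Nonempty κ]

/-- The average of `g` over the codewords of the codebook `c`. -/
noncomputable def average (c : Codebook 𝒰₀ 𝒰₁ ι κ) (g : 𝒰₀ → 𝒰₁ → ℝ) : ℝ :=
  (Fintype.card ι : ℝ)⁻¹ * ∑ i, (Fintype.card κ : ℝ)⁻¹ * ∑ k, g (c i).1 ((c i).2 k)

omit [DecidableEq ι] [DecidableEq κ] [Fintype 𝒰₀] [Fintype 𝒰₁] [Nonempty ι] [Nonempty κ] in
lemma average_nonneg (c : Codebook 𝒰₀ 𝒰₁ ι κ) {g : 𝒰₀ → 𝒰₁ → ℝ} (hg : ∀ u v, 0 ≤ g u v) :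
    0 ≤ average c g :=
  mul_nonneg (by positivity) (Finset.sum_nonneg fun i _ => mul_nonneg (by positivity)
    (Finset.sum_nonneg fun k _ => hg _ _))

omit [DecidableEq ι] [DecidableEq κ] [Fintype 𝒰₀] [Fintype 𝒰₁] [Nonempty ι] [Nonempty κ] in
lemma average_add (c : Codebook 𝒰₀ 𝒰₁ ι κ) (g h : 𝒰₀ → 𝒰₁ → ℝ) :
    average c (fun u v => g u v + h u v) = average c g + average c h := by
  simp only [average, Finset.sum_add_distrib, mul_add]

/-- A codebook-dependent quantity whose expectation is at most `B` for every codeword has an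
average over the codewords with expectation at most `B`. -/
lemma expect_average_le (p₀ : 𝒰₀ → ℝ) (p₁ : 𝒰₀ → 𝒰₁ → ℝ)
    (F : Codebook 𝒰₀ 𝒰₁ ι κ → ι → κ → ℝ) (B : ℝ)
    (h : ∀ i k, expect (codebookPmf p₀ p₁) (fun c => F c i k) ≤ B) :
    expect (codebookPmf p₀ p₁) (fun c =>
      (Fintype.card ι : ℝ)⁻¹ * ∑ i, (Fintype.card κ : ℝ)⁻¹ * ∑ k, F c i k) ≤ B := by
  have hN : (Fintype.card ι : ℝ) ≠ 0 := Nat.cast_ne_zero.2 Fintype.card_ne_zero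
  have hK : (Fintype.card κ : ℝ) ≠ 0 := Nat.cast_ne_zero.2 Fintype.card_ne_zero
  simp only [expect_const_mul, expect_sum]
  calc _ ≤ (Fintype.card ι : ℝ)⁻¹ * ∑ _i : ι, (Fintype.card κ : ℝ)⁻¹ * ∑ _k : κ, B := by
        gcongr with i _ k _
        exact h i k
    _ = B := by
        simp only [Finset.sum_const, Finset.card_univ, nsmul_eq_mul]
        field_simp

lemma expect_average (h₀ : p₀ ∈ stdSimplex ℝ 𝒰₀) (h₁ : ∀ u, p₁ u ∈ stdSimplex ℝ 𝒰₁)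
    (g : 𝒰₀ → 𝒰₁ → ℝ) :
    expect (codebookPmf p₀ p₁) (fun c : Codebook 𝒰₀ 𝒰₁ ι κ => average c g)
      = expect₂ p₀ p₁ g := by
  have hN : (Fintype.card ι : ℝ) ≠ 0 := Nat.cast_ne_zero.2 Fintype.card_ne_zero
  have hK : (Fintype.card κ : ℝ) ≠ 0 := Nat.cast_ne_zero.2 Fintype.card_ne_zero
  simp only [average, expect_const_mul, expect_sum, expect_codebook h₀ h₁,
    Finset.sum_const, Finset.card_univ, nsmul_eq_mul]
  field_simp

/-- Second-moment bound for the average of a function over a random superposition codebook. -/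
lemma expect_average_sub_sq (h₀ : p₀ ∈ stdSimplex ℝ 𝒰₀) (h₁ : ∀ u, p₁ u ∈ stdSimplex ℝ 𝒰₁)
    (g : 𝒰₀ → 𝒰₁ → ℝ) :
    expect (codebookPmf p₀ p₁)
        (fun c : Codebook 𝒰₀ 𝒰₁ ι κ => (average c g - expect₂ p₀ p₁ g) ^ 2)
      ≤ (Fintype.card ι : ℝ)⁻¹ * ((Fintype.card κ : ℝ)⁻¹ * expect₂ p₀ p₁ (fun u v => g u v ^ 2)
        + expect p₀ fun u => expect (p₁ u) (g u) ^ 2) := by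
  have hK : (Fintype.card κ : ℝ) ≠ 0 := Nat.cast_ne_zero.2 Fintype.card_ne_zero
  -- Codewords within a cloud are dependent, so the variance is computed in two layers: first over
  -- the i.i.d. cloud averages `F`, then over the satellites given the centre.
  set F : 𝒰₀ × (κ → 𝒰₁) → ℝ := fun a => (Fintype.card κ : ℝ)⁻¹ * ∑ k, g a.1 (a.2 k) with hF
  have hEF : expect (cloudPmf p₀ p₁) F = expect₂ p₀ p₁ g := by
    rw [expect_cloudPmf]
    simp only [hF, expect_const_mul, expect_sum, expect_prodPmf_apply (h₁ _), Finset.sum_const,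
      Finset.card_univ, nsmul_eq_mul, expect₂]
    field_simp
  have h := expect_sq_average (ι := ι) (cloudPmf_mem (κ := κ) h₀ h₁) F
  rw [hEF] at h
  refine h.trans (mul_le_mul_of_nonneg_left ?_ (by positivity))
  rw [expect_cloudPmf, expect₂, ← expect_const_mul, ← expect_add]
  exact expect_mono h₀.1 fun u _ => expect_average_sq (h₁ u) (g u)

/-- The soft-covering lemma for superposition codebooks. -/
lemma softCovering (h₀ : p₀ ∈ stdSimplex ℝ 𝒰₀) (h₁ : ∀ u, p₁ u ∈ stdSimplex ℝ 𝒰₁)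
    {px : 𝒰₀ → 𝒰₁ → 𝒳 → ℝ} (hpx : ∀ u v x, 0 ≤ px u v x) {pX : 𝒳 → ℝ}
    (hpX : ∀ x, expect₂ p₀ p₁ (fun u v => px u v x) = pX x) (hsum : ∑ x, pX x = 1)
    {A B : ℝ} (hA : 0 ≤ A) (hB : 0 ≤ B) (G : 𝒰₀ → 𝒰₁ → 𝒳 → Prop)
    (hG : ∀ u v x, G u v x → px u v x ≤ A * pX x ∧
      expect (p₁ u) (fun v => px u v x) ≤ B * pX x) :
    expect (codebookPmf p₀ p₁)
        (fun c : Codebook 𝒰₀ 𝒰₁ ι κ => ∑ x, |pX x - average c fun u v => px u v x|)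
      ≤ √((Fintype.card ι : ℝ)⁻¹ * ((Fintype.card κ : ℝ)⁻¹ * A + B))
        + 2 * ∑ x, expect₂ p₀ p₁ (fun u v => px u v x * ind (¬ G u v x)) := by
  have hpX0 : ∀ x, 0 ≤ pX x := fun x => hpX x ▸ expect₂_nonneg h₀ h₁ fun u v => hpx u v x
  have key : ∀ x, expect (codebookPmf p₀ p₁)
        (fun c : Codebook 𝒰₀ 𝒰₁ ι κ => |pX x - average c fun u v => px u v x|)
      ≤ √((Fintype.card ι : ℝ)⁻¹ * ((Fintype.card κ : ℝ)⁻¹ * A + B)) * pX x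
        + 2 * expect₂ p₀ p₁ (fun u v => px u v x * ind (¬ G u v x)) := by
    intro x
    -- Truncation. On `G` the likelihoods are bounded, so `g` has a small second moment. The rest
    -- `h` is controlled by its mean alone, which enters twice: through the codebook average and
    -- through its expectation.
    set g : 𝒰₀ → 𝒰₁ → ℝ := fun u v => px u v x * ind (G u v x) with hg
    set h : 𝒰₀ → 𝒰₁ → ℝ := fun u v => px u v x * ind (¬ G u v x) with hh
    have hg0 : ∀ u v, 0 ≤ g u v := fun u v => mul_nonneg (hpx _ _ _) (ind_nonneg _)
    have hh0 : ∀ u v, 0 ≤ h u v := fun u v => mul_nonneg (hpx _ _ _) (ind_nonneg _)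
    have hgpx : ∀ u v, g u v ≤ px u v x := fun u v =>
      mul_le_of_le_one_right (hpx _ _ _) (ind_le_one _)
    have hsplit : (fun u v => px u v x) = fun u v => g u v + h u v := by
      ext u v; rw [hg, hh]; simp only; rw [← mul_add, ind_add_ind_not, mul_one]
    have hEg : expect₂ p₀ p₁ g ≤ pX x := hpX x ▸ expect₂_mono h₀ h₁ hgpx
    have hAg : ∀ u v, g u v ^ 2 ≤ A * pX x * g u v := by
      intro u v
      by_cases hGx : G u v x
      · rw [sq]
        exact mul_le_mul_of_nonneg_right ((hgpx u v).trans (hG u v x hGx).1) (hg0 u v)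
      · simp [hg, ind_of_not hGx]
    have hBg : ∀ u, expect (p₁ u) (g u) ≤ B * pX x := by
      intro u
      -- The cloud-level bound does not involve the satellite: one good `v` provides it, and without
      -- any the truncated function vanishes at `u`.
      by_cases hex : ∃ v, G u v x
      · obtain ⟨v, hv⟩ := hex
        exact (expect_mono (h₁ u).1 fun v _ => hgpx u v).trans (hG u v x hv).2
      · have : ∀ v, g u v = 0 := fun v => by
          simp [hg, ind_of_not (not_exists.1 hex v)]
        have e : g u = fun _ => 0 := funext this
        rw [e, expect_const (h₁ u)]
        exact mul_nonneg hB (hpX0 x)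
    have hvar := expect_average_sub_sq (ι := ι) (κ := κ) h₀ h₁ g
    have hb1 : expect₂ p₀ p₁ (fun u v => g u v ^ 2) ≤ A * pX x ^ 2 := by
      refine (expect₂_mono h₀ h₁ hAg).trans ?_
      rw [expect₂_const_mul]
      nlinarith [mul_le_mul_of_nonneg_left hEg (mul_nonneg hA (hpX0 x))]
    have hb2 : expect p₀ (fun u => expect (p₁ u) (g u) ^ 2) ≤ B * pX x ^ 2 := by
      have : ∀ u, expect (p₁ u) (g u) ^ 2 ≤ B * pX x * expect (p₁ u) (g u) := fun u => by
        rw [sq]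
        exact mul_le_mul_of_nonneg_right (hBg u) (expect_nonneg (h₁ u).1 (hg0 u))
      refine (expect_mono h₀.1 fun u _ => this u).trans ?_
      rw [expect_const_mul]
      change B * pX x * expect₂ p₀ p₁ g ≤ _
      nlinarith [mul_le_mul_of_nonneg_left hEg (mul_nonneg hB (hpX0 x))]
    have hsq : expect (codebookPmf p₀ p₁)
        (fun c : Codebook 𝒰₀ 𝒰₁ ι κ => (average c g - expect₂ p₀ p₁ g) ^ 2)
        ≤ ((Fintype.card ι : ℝ)⁻¹ * ((Fintype.card κ : ℝ)⁻¹ * A + B)) * pX x ^ 2 := by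
      refine hvar.trans ?_
      rw [mul_assoc, add_mul, mul_assoc]
      gcongr
    have habs := expect_abs_le_sqrt (codebookPmf_mem h₀ h₁) hsq
    -- The bound is proportional to `pX x`, so the sum over `x` costs nothing, however large the
    -- alphabet of source blocks.
    rw [Real.sqrt_mul (by positivity), Real.sqrt_sq (hpX0 x)] at habs
    have hpt : ∀ c : Codebook 𝒰₀ 𝒰₁ ι κ, |pX x - average c fun u v => px u v x|
        ≤ |average c g - expect₂ p₀ p₁ g| + (average c h + expect₂ p₀ p₁ h) := by
      intro c
      rw [← hpX x, hsplit, average_add, expect₂_add]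
      have a1 := average_nonneg c hh0
      have a2 := expect₂_nonneg h₀ h₁ hh0
      rw [abs_le]
      constructor <;>
        linarith [le_abs_self (average c g - expect₂ p₀ p₁ g),
          neg_abs_le (average c g - expect₂ p₀ p₁ g)]
    refine (expect_mono (codebookPmf_mem h₀ h₁).1 fun c _ => hpt c).trans ?_
    rw [expect_add, expect_add, expect_average h₀ h₁, expect_const (codebookPmf_mem h₀ h₁)]
    linarith
  rw [expect_sum]
  refine (Finset.sum_le_sum fun x _ => key x).trans (le_of_eq ?_)
  rw [Finset.sum_add_distrib, ← Finset.mul_sum, ← Finset.mul_sum, hsum, mul_one]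

end Codebook

/-! ### Threshold decoding of superposition codes -/

section Decoding

variable {Ω 𝒰₀ 𝒰₁ 𝒳 𝒪 ℬ ι κ : Type*} [Fintype Ω] [Fintype 𝒰₀] [Fintype 𝒰₁] [Fintype 𝒳]
  [Fintype 𝒪] [Fintype ℬ] [Fintype ι] [DecidableEq ι] [Fintype κ] [DecidableEq κ]
  [Nonempty ι] [Nonempty κ]

open Classical in
/-- An index satisfying `g`, if there is one. -/
noncomputable def decode {I : Type*} [Nonempty I] (g : I → Prop) : I :=
  if h : ∃ i, g i then h.choose else Classical.arbitrary I

/-- Decoding to an index that fails the test `t` requires the true index `i` to be rejected by `g`,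
another index to be accepted by `g`, or the true index to fail `t`. -/
lemma ind_decode_le {I : Type*} [Nonempty I] [Fintype I] [DecidableEq I] (g t : I → Prop) (i : I) :
    ind (¬ t (decode g)) ≤ ind (¬ g i) + ind (¬ t i) + ∑ j ∈ Finset.univ.erase i, ind (g j) := by
  have hs : 0 ≤ ∑ j ∈ Finset.univ.erase i, ind (g j) := Finset.sum_nonneg fun _ _ => ind_nonneg _
  by_cases hg : g i
  · have hex : ∃ i, g i := ⟨i, hg⟩
    have hd : g (decode g) := by
      rw [decode, dif_pos hex]; exact hex.choose_spec
    by_cases hi : decode g = i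
    · rw [hi]
      linarith [ind_nonneg (¬ g i)]
    · have h1 : ind (g (decode g)) ≤ ∑ j ∈ Finset.univ.erase i, ind (g j) :=
        Finset.single_le_sum (f := fun j => ind (g j)) (fun _ _ => ind_nonneg _)
          (Finset.mem_erase.2 ⟨hi, Finset.mem_univ _⟩)
      rw [ind_of hd] at h1
      linarith [ind_nonneg (¬ g i), ind_nonneg (¬ t i), ind_le_one (¬ t (decode g))]
  · rw [ind_of hg]
    linarith [ind_nonneg (¬ t i), ind_le_one (¬ t (decode g))]

variable {p₀ : 𝒰₀ → ℝ} {p₁ : 𝒰₀ → 𝒰₁ → ℝ}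

/-- The kernels enter only through the product `p₀ * p₁ * W`, so their values at symbols of mass
zero are immaterial. -/
lemma sum_expect₂_mul {Q : Ω → ℝ} {U₀ : Ω → 𝒰₀} {U₁ : Ω → 𝒰₁} {O : Ω → 𝒪}
    {W : 𝒰₀ → 𝒰₁ → 𝒪 → ℝ}
    (hW : ∀ u v o, p₀ u * p₁ u v * W u v o = law Q (fun ω => (U₀ ω, U₁ ω, O ω)) (u, v, o))
    (h : 𝒰₀ → 𝒰₁ → 𝒪 → ℝ) :
    ∑ o, expect₂ p₀ p₁ (fun u v => W u v o * h u v o)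
      = expect Q fun ω => h (U₀ ω) (U₁ ω) (O ω) := by
  rw [expect_comp Q (fun ω => (U₀ ω, U₁ ω, O ω)) fun a => h a.1 a.2.1 a.2.2,
    ← expect₂_sum]
  simp only [Fintype.sum_prod_type, ← hW, expect₂, expect, Finset.mul_sum, mul_assoc]

/-- The decoder of a receiver that looks for a whole codeword. -/
noncomputable def decodeSatellite (c : Codebook 𝒰₀ 𝒰₁ ι κ) (G : 𝒰₀ → 𝒰₁ → 𝒪 → Prop) (o : 𝒪) :
    𝒰₀ × 𝒰₁ :=
  let m : ι × κ := decode fun m => G (c m.1).1 ((c m.1).2 m.2) o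
  ((c m.1).1, (c m.1).2 m.2)

/-- The decoder of a receiver that looks for a cloud centre. -/
noncomputable def decodeCloud (c : Codebook 𝒰₀ 𝒰₁ ι κ) (G : 𝒰₀ → 𝒪 → Prop) (o : 𝒪) : 𝒰₀ :=
  (c (decode fun i => G (c i).1 o)).1

/-- A union bound for a fixed true codeword. The true codeword has the joint law of the model with
the output, which gives the first two terms. A competitor in the true cloud depends on the output
only through the centre, and one in another cloud is independent of it; these give the last two
terms. -/
lemma expect_error_satellite (h₀ : p₀ ∈ stdSimplex ℝ 𝒰₀) (h₁ : ∀ u, p₁ u ∈ stdSimplex ℝ 𝒰₁)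
    {Q : Ω → ℝ} {U₀ : Ω → 𝒰₀} {U₁ : Ω → 𝒰₁} {O : Ω → 𝒪} {W : 𝒰₀ → 𝒰₁ → 𝒪 → ℝ}
    (hQ : ∀ ω, 0 ≤ Q ω) (hW0 : ∀ u v o, 0 ≤ W u v o)
    (hW : ∀ u v o, p₀ u * p₁ u v * W u v o = law Q (fun ω => (U₀ ω, U₁ ω, O ω)) (u, v, o))
    (G T : 𝒰₀ → 𝒰₁ → 𝒪 → Prop) :
    expect (codebookPmf p₀ p₁) (fun c : Codebook 𝒰₀ 𝒰₁ ι κ => average c fun u v =>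
        ∑ o, W u v o * ind (¬ T (decodeSatellite c G o).1 (decodeSatellite c G o).2 o))
      ≤ expect Q (fun ω => ind (¬ G (U₀ ω) (U₁ ω) (O ω)))
        + expect Q (fun ω => ind (¬ T (U₀ ω) (U₁ ω) (O ω)))
        + Fintype.card κ * expect Q (fun ω => expect (p₁ (U₀ ω)) fun v => ind (G (U₀ ω) v (O ω)))
        + Fintype.card ι * Fintype.card κ *
          expect Q (fun ω => expect₂ p₀ p₁ fun u v => ind (G u v (O ω))) := by
  refine expect_average_le p₀ p₁ _ _ fun i k => ?_
  have hμ := codebookPmf_mem (ι := ι) (κ := κ) h₀ h₁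
  set a := expect Q (fun ω => expect (p₁ (U₀ ω)) fun v => ind (G (U₀ ω) v (O ω))) with ha
  set b := expect Q (fun ω => expect₂ p₀ p₁ fun u v => ind (G u v (O ω))) with hb
  have ha0 : 0 ≤ a := expect_nonneg hQ fun ω => expect_nonneg (h₁ _).1 fun _ => ind_nonneg _
  have hb0 : 0 ≤ b := expect_nonneg hQ fun ω => expect₂_nonneg h₀ h₁ fun _ _ => ind_nonneg _
  have hpt : ∀ c : Codebook 𝒰₀ 𝒰₁ ι κ, ∑ o, W (c i).1 ((c i).2 k) o *
      ind (¬ T (decodeSatellite c G o).1 (decodeSatellite c G o).2 o)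
      ≤ ∑ o, W (c i).1 ((c i).2 k) o * ind (¬ G (c i).1 ((c i).2 k) o)
        + ∑ o, W (c i).1 ((c i).2 k) o * ind (¬ T (c i).1 ((c i).2 k) o)
        + ∑ m ∈ Finset.univ.erase (i, k),
          ∑ o, W (c i).1 ((c i).2 k) o * ind (G (c m.1).1 ((c m.1).2 m.2) o) := by
    intro c
    rw [Finset.sum_comm, ← Finset.sum_add_distrib, ← Finset.sum_add_distrib]
    refine Finset.sum_le_sum fun o _ => ?_
    rw [← Finset.mul_sum, ← mul_add, ← mul_add]
    exact mul_le_mul_of_nonneg_left (ind_decode_le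
      (fun m : ι × κ => G (c m.1).1 ((c m.1).2 m.2) o)
      (fun m => T (c m.1).1 ((c m.1).2 m.2) o) (i, k)) (hW0 _ _ _)
  refine (expect_mono hμ.1 fun c _ => hpt c).trans ?_
  rw [expect_add, expect_add, expect_sum (Finset.univ.erase (i, k))]
  have e1 : ∀ H : 𝒰₀ → 𝒰₁ → 𝒪 → Prop, expect (codebookPmf p₀ p₁)
      (fun c : Codebook 𝒰₀ 𝒰₁ ι κ =>
        ∑ o, W (c i).1 ((c i).2 k) o * ind (H (c i).1 ((c i).2 k) o))
      = expect Q (fun ω => ind (H (U₀ ω) (U₁ ω) (O ω))) := by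
    intro H
    rw [expect_codebook h₀ h₁ i k fun u v => ∑ o, W u v o * ind (H u v o), expect₂_sum,
      sum_expect₂_mul hW fun u v o => ind (H u v o)]
  rw [e1 fun u v o => ¬ G u v o, e1 fun u v o => ¬ T u v o, add_assoc, add_assoc, add_assoc]
  gcongr
  have e2 : ∀ m ∈ Finset.univ.erase (i, k), expect (codebookPmf p₀ p₁)
      (fun c : Codebook 𝒰₀ 𝒰₁ ι κ =>
        ∑ o, W (c i).1 ((c i).2 k) o * ind (G (c m.1).1 ((c m.1).2 m.2) o))
      ≤ (if i = m.1 then a else 0) + b := by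
    rintro ⟨i', k'⟩ hm
    rw [expect_sum]
    by_cases hi : i = i'
    · subst hi
      have hk : k ≠ k' := by
        rintro rfl
        simp at hm
      rw [if_pos rfl]
      rw [Finset.sum_congr rfl fun o _ => expect_codebook_satellites h₀ h₁ i hk
        fun u v v' => W u v o * ind (G u v' o)]
      simp only [expect_const_mul]
      rw [sum_expect₂_mul hW fun u _ o => expect (p₁ u) fun v => ind (G u v o)]
      linarith
    · simp only [hi, if_false, zero_add]
      rw [Finset.sum_congr rfl fun o _ => expect_codebook_clouds h₀ h₁ hi k k'
        fun u v u' v' => W u v o * ind (G u' v' o)]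
      simp only [expect₂_const_mul]
      rw [sum_expect₂_mul hW fun _ _ o => expect₂ p₀ p₁ fun u v => ind (G u v o)]
  refine (Finset.sum_le_sum e2).trans ?_
  -- Restoring the true index only enlarges the sum, and leaves round counts of competitors.
  refine (Finset.sum_le_sum_of_subset_of_nonneg (Finset.erase_subset _ _) fun m _ _ => ?_).trans ?_
  · split_ifs <;> linarith
  · rw [Finset.sum_add_distrib, Fintype.sum_prod_type]
    rw [Finset.sum_comm]
    simp

/-- As for whole codewords, except that only other cloud centres compete, so the number of
satellites does not enter. -/
lemma expect_error_cloud (h₀ : p₀ ∈ stdSimplex ℝ 𝒰₀) (h₁ : ∀ u, p₁ u ∈ stdSimplex ℝ 𝒰₁)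
    {Q : Ω → ℝ} {U₀ : Ω → 𝒰₀} {U₁ : Ω → 𝒰₁} {O : Ω → 𝒪} {W : 𝒰₀ → 𝒰₁ → 𝒪 → ℝ}
    (hQ : ∀ ω, 0 ≤ Q ω) (hW0 : ∀ u v o, 0 ≤ W u v o)
    (hW : ∀ u v o, p₀ u * p₁ u v * W u v o = law Q (fun ω => (U₀ ω, U₁ ω, O ω)) (u, v, o))
    (G T : 𝒰₀ → 𝒪 → Prop) :
    expect (codebookPmf p₀ p₁) (fun c : Codebook 𝒰₀ 𝒰₁ ι κ => average c fun u v =>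
        ∑ o, W u v o * ind (¬ T (decodeCloud c G o) o))
      ≤ expect Q (fun ω => ind (¬ G (U₀ ω) (O ω)))
        + expect Q (fun ω => ind (¬ T (U₀ ω) (O ω)))
        + Fintype.card ι * expect Q (fun ω => expect p₀ fun u => ind (G u (O ω))) := by
  refine expect_average_le p₀ p₁ _ _ fun i k => ?_
  have hμ := codebookPmf_mem (ι := ι) (κ := κ) h₀ h₁
  set b := expect Q (fun ω => expect p₀ fun u => ind (G u (O ω))) with hb
  have hb0 : 0 ≤ b := expect_nonneg hQ fun ω => expect_nonneg h₀.1 fun _ => ind_nonneg _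
  have hpt : ∀ c : Codebook 𝒰₀ 𝒰₁ ι κ, ∑ o, W (c i).1 ((c i).2 k) o *
      ind (¬ T (decodeCloud c G o) o)
      ≤ ∑ o, W (c i).1 ((c i).2 k) o * ind (¬ G (c i).1 o)
        + ∑ o, W (c i).1 ((c i).2 k) o * ind (¬ T (c i).1 o)
        + ∑ m ∈ Finset.univ.erase i, ∑ o, W (c i).1 ((c i).2 k) o * ind (G (c m).1 o) := by
    intro c
    rw [Finset.sum_comm, ← Finset.sum_add_distrib, ← Finset.sum_add_distrib]
    refine Finset.sum_le_sum fun o _ => ?_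
    rw [← Finset.mul_sum, ← mul_add, ← mul_add]
    exact mul_le_mul_of_nonneg_left (ind_decode_le (fun m : ι => G (c m).1 o)
      (fun m => T (c m).1 o) i) (hW0 _ _ _)
  refine (expect_mono hμ.1 fun c _ => hpt c).trans ?_
  rw [expect_add, expect_add, expect_sum (Finset.univ.erase i)]
  have e1 : ∀ H : 𝒰₀ → 𝒪 → Prop, expect (codebookPmf p₀ p₁)
      (fun c : Codebook 𝒰₀ 𝒰₁ ι κ => ∑ o, W (c i).1 ((c i).2 k) o * ind (H (c i).1 o))
      = expect Q (fun ω => ind (H (U₀ ω) (O ω))) := by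
    intro H
    rw [expect_codebook h₀ h₁ i k fun u v => ∑ o, W u v o * ind (H u o), expect₂_sum,
      sum_expect₂_mul hW fun u _ o => ind (H u o)]
  rw [e1 fun u o => ¬ G u o, e1 fun u o => ¬ T u o]
  gcongr
  have e2 : ∀ m ∈ Finset.univ.erase i, expect (codebookPmf p₀ p₁)
      (fun c : Codebook 𝒰₀ 𝒰₁ ι κ => ∑ o, W (c i).1 ((c i).2 k) o * ind (G (c m).1 o)) ≤ b := by
    intro m hm
    rw [expect_sum]
    rw [Finset.sum_congr rfl fun o _ => expect_codebook_clouds h₀ h₁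
      (Finset.ne_of_mem_erase hm).symm k k fun u v u' _ => W u v o * ind (G u' o)]
    simp only [expect₂_const_mul]
    rw [sum_expect₂_mul hW fun _ _ o => expect₂ p₀ p₁ fun u _ => ind (G u o)]
    simp only [expect₂, expect_const (h₁ _)]
    exact le_rfl
  refine (Finset.sum_le_sum e2).trans ?_
  refine (Finset.sum_le_sum_of_subset_of_nonneg (Finset.erase_subset _ _)
    fun m _ _ => hb0).trans ?_
  simp

/-! Change-of-measure bounds for the probability that a wrong codeword is accepted. -/

lemma expect_accept_satellite_le {Q : Ω → ℝ} (hQ : Q ∈ stdSimplex ℝ Ω) {U₀ : Ω → 𝒰₀}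
    {U₁ : Ω → 𝒰₁} {B : Ω → ℬ}
    (hp₁ : ∀ u v, law Q U₀ u * p₁ u v = law Q (fun ω => (U₀ ω, U₁ ω)) (u, v))
    {r : ℝ} (hr : 0 < r) (G : 𝒰₀ → 𝒰₁ → ℬ → Prop)
    (hG : ∀ u v b, G u v b → r * (law Q (fun ω => (U₀ ω, U₁ ω)) (u, v) *
        law Q (fun ω => (U₀ ω, B ω)) (u, b))
      ≤ law Q (fun ω => (U₀ ω, U₁ ω, B ω)) (u, v, b) * law Q U₀ u) :
    expect Q (fun ω => expect (p₁ (U₀ ω)) fun v => ind (G (U₀ ω) v (B ω))) ≤ r⁻¹ := by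
  rw [expect_comp Q (fun ω => (U₀ ω, B ω)) fun a => expect (p₁ a.1) fun v => ind (G a.1 v a.2)]
  have key : ∀ u b v, law Q (fun ω => (U₀ ω, B ω)) (u, b) * (p₁ u v * ind (G u v b))
      ≤ r⁻¹ * law Q (fun ω => (U₀ ω, U₁ ω, B ω)) (u, v, b) := by
    intro u b v
    have hl := law_nonneg hQ.1 (fun ω => (U₀ ω, U₁ ω, B ω)) (u, v, b)
    by_cases hg : G u v b
    · rw [ind_of hg, mul_one]
      rcases (law_nonneg hQ.1 U₀ u).eq_or_lt' with h0 | h0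
      · rw [law_eq_zero_of_imp hQ.1 (A := fun ω => (U₀ ω, B ω)) (a := (u, b)) (B := U₀)
          (fun ω h => (Prod.mk.inj h).1) h0, zero_mul]
        positivity
      · have := hG u v b hg
        rw [← hp₁ u v] at this
        rw [← div_eq_inv_mul, le_div_iff₀ hr]
        refine le_of_mul_le_mul_right ?_ h0
        linarith
    · rw [ind_of_not hg]
      simp only [mul_zero]
      positivity
  have hs := sum_law hQ (fun ω => (U₀ ω, U₁ ω, B ω))
  simp only [Fintype.sum_prod_type] at hs ⊢
  calc _ = ∑ u, ∑ b, ∑ v, law Q (fun ω => (U₀ ω, B ω)) (u, b) * (p₁ u v * ind (G u v b)) := by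
        simp only [expect, Finset.mul_sum]
    _ ≤ ∑ u, ∑ b, ∑ v, r⁻¹ * law Q (fun ω => (U₀ ω, U₁ ω, B ω)) (u, v, b) := by
        exact Finset.sum_le_sum fun u _ => Finset.sum_le_sum fun b _ =>
          Finset.sum_le_sum fun v _ => key u b v
    _ = r⁻¹ * ∑ u, ∑ v, ∑ b, law Q (fun ω => (U₀ ω, U₁ ω, B ω)) (u, v, b) := by
        simp only [Finset.mul_sum]
        exact Finset.sum_congr rfl fun u _ => Finset.sum_comm
    _ = r⁻¹ := by rw [hs, mul_one]

lemma expect_accept_le {Q : Ω → ℝ} (hQ : Q ∈ stdSimplex ℝ Ω) {A : Ω → 𝒰₀} {B : Ω → ℬ}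
    {r : ℝ} (hr : 0 < r) (G : 𝒰₀ → ℬ → Prop)
    (hG : ∀ u b, G u b → r * (law Q A u * law Q B b) ≤ law Q (fun ω => (A ω, B ω)) (u, b)) :
    expect Q (fun ω => expect (law Q A) fun u => ind (G u (B ω))) ≤ r⁻¹ := by
  rw [expect_comp Q B fun b => expect (law Q A) fun u => ind (G u b)]
  have key : ∀ b u, law Q B b * (law Q A u * ind (G u b))
      ≤ r⁻¹ * law Q (fun ω => (A ω, B ω)) (u, b) := by
    intro b u
    have hl := law_nonneg hQ.1 (fun ω => (A ω, B ω)) (u, b)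
    by_cases hg : G u b
    · rw [ind_of hg, mul_one, ← div_eq_inv_mul, le_div_iff₀ hr]
      linarith [hG u b hg]
    · rw [ind_of_not hg]
      simp only [mul_zero]
      positivity
  have hs := sum_law hQ (fun ω => (A ω, B ω))
  simp only [Fintype.sum_prod_type] at hs
  calc _ = ∑ b, ∑ u, law Q B b * (law Q A u * ind (G u b)) := by
        simp only [expect, Finset.mul_sum]
    _ ≤ ∑ b, ∑ u, r⁻¹ * law Q (fun ω => (A ω, B ω)) (u, b) := by
        exact Finset.sum_le_sum fun b _ => Finset.sum_le_sum fun u _ => key b u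
    _ = r⁻¹ * ∑ u, ∑ b, law Q (fun ω => (A ω, B ω)) (u, b) := by
        rw [Finset.sum_comm]
        simp only [Finset.mul_sum]
    _ = r⁻¹ := by rw [hs, mul_one]

/-! ### The likelihood encoder -/

/-- The likelihood encoder: given `x`, codeword `m` is chosen with probability proportional to its
likelihood `px (c m) x`. -/
noncomputable def likelihood (px : 𝒰₀ → 𝒰₁ → 𝒳 → ℝ) (c : Codebook 𝒰₀ 𝒰₁ ι κ) (x : 𝒳)
    (m : ι × κ) : ℝ :=
  let s := ∑ m' : ι × κ, px (c m'.1).1 ((c m'.1).2 m'.2) x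
  if s = 0 then (Fintype.card (ι × κ) : ℝ)⁻¹ else px (c m.1).1 ((c m.1).2 m.2) x / s

omit [Fintype 𝒰₀] [Fintype 𝒰₁] [Fintype 𝒳] [DecidableEq ι] [DecidableEq κ] in
lemma likelihood_mem {px : 𝒰₀ → 𝒰₁ → 𝒳 → ℝ} (hpx : ∀ u v x, 0 ≤ px u v x)
    (c : Codebook 𝒰₀ 𝒰₁ ι κ) (x : 𝒳) : likelihood px c x ∈ stdSimplex ℝ (ι × κ) := by
  have hK : (Fintype.card (ι × κ) : ℝ) ≠ 0 := Nat.cast_ne_zero.2 Fintype.card_ne_zero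
  constructor
  · intro m
    unfold likelihood
    dsimp only
    split_ifs
    · positivity
    · exact div_nonneg (hpx _ _ _) (Finset.sum_nonneg fun _ _ => hpx _ _ _)
  · unfold likelihood
    dsimp only
    split_ifs with h
    · rw [Finset.sum_const, Finset.card_univ, nsmul_eq_mul, mul_inv_cancel₀ hK]
    · rw [← Finset.sum_div, div_self h]

omit [Fintype 𝒰₀] [Fintype 𝒰₁] [Fintype 𝒳] [DecidableEq ι] [DecidableEq κ] [Nonempty ι]
  [Nonempty κ] in
lemma average_eq_sum (c : Codebook 𝒰₀ 𝒰₁ ι κ) (g : 𝒰₀ → 𝒰₁ → ℝ) :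
    average c g = (Fintype.card (ι × κ) : ℝ)⁻¹ *
      ∑ m : ι × κ, g (c m.1).1 ((c m.1).2 m.2) := by
  rw [average, Fintype.sum_prod_type, ← Finset.mul_sum, Fintype.card_prod]
  push_cast
  rw [mul_inv, mul_assoc]

omit [Fintype 𝒰₀] [Fintype 𝒰₁] [Fintype 𝒳] [DecidableEq ι] [DecidableEq κ] in
-- Bayes' rule: the likelihood encoder is the posterior of a uniform codeword observed through `px`.
-- Where no codeword explains `x`, both sides vanish.
lemma average_mul_likelihood {px : 𝒰₀ → 𝒰₁ → 𝒳 → ℝ} (hpx : ∀ u v x, 0 ≤ px u v x)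
    (c : Codebook 𝒰₀ 𝒰₁ ι κ) (x : 𝒳) (m : ι × κ) :
    (average c fun u v => px u v x) * likelihood px c x m
      = (Fintype.card (ι × κ) : ℝ)⁻¹ * px (c m.1).1 ((c m.1).2 m.2) x := by
  rw [average_eq_sum, likelihood]
  split_ifs with h
  · rw [h, mul_zero, zero_mul, (Finset.sum_eq_zero_iff_of_nonneg fun m _ => hpx _ _ _).1 h m
      (Finset.mem_univ m), mul_zero]
  · field_simp

omit [Fintype 𝒰₀] [Fintype 𝒰₁] [DecidableEq ι] [DecidableEq κ] in
/-- With the likelihood encoder, the probability of an event differs from its probability for a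
uniformly distributed codeword by at most the soft-covering distance. -/
lemma likelihood_error_le {px : 𝒰₀ → 𝒰₁ → 𝒳 → ℝ} (hpx : ∀ u v x, 0 ≤ px u v x) {pX : 𝒳 → ℝ}
    (c : Codebook 𝒰₀ 𝒰₁ ι κ) {e : 𝒰₀ → 𝒰₁ → 𝒳 → ℝ} (he : ∀ u v x, 0 ≤ e u v x)
    (he1 : ∀ u v x, e u v x ≤ 1) :
    ∑ x, pX x * ∑ m, likelihood px c x m * e (c m.1).1 ((c m.1).2 m.2) x
      ≤ ∑ x, |pX x - average c fun u v => px u v x|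
        + average c fun u v => ∑ x, px u v x * e u v x := by
  have key : ∀ x, pX x * ∑ m, likelihood px c x m * e (c m.1).1 ((c m.1).2 m.2) x
      ≤ |pX x - average c fun u v => px u v x|
        + average c fun u v => px u v x * e u v x := by
    intro x
    have hL := likelihood_mem hpx c x
    have h1 : (average c fun u v => px u v x) *
        ∑ m, likelihood px c x m * e (c m.1).1 ((c m.1).2 m.2) x
        = average c fun u v => px u v x * e u v x := by
      rw [average_eq_sum c fun u v => px u v x * e u v x, Finset.mul_sum, Finset.mul_sum]
      refine Finset.sum_congr rfl fun m _ => ?_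
      rw [← mul_assoc, average_mul_likelihood hpx, mul_assoc]
    have h2 : 0 ≤ ∑ m, likelihood px c x m * e (c m.1).1 ((c m.1).2 m.2) x :=
      Finset.sum_nonneg fun m _ => mul_nonneg (hL.1 m) (he _ _ _)
    have h3 : ∑ m, likelihood px c x m * e (c m.1).1 ((c m.1).2 m.2) x ≤ 1 := by
      rw [← hL.2]
      exact Finset.sum_le_sum fun m _ => mul_le_of_le_one_right (hL.1 m) (he1 _ _ _)
    rw [← h1]
    set s := ∑ m, likelihood px c x m * e (c m.1).1 ((c m.1).2 m.2) x
    set q := average c fun u v => px u v x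
    -- The conditional probability `s` of the event is common to both experiments and lies in [0,
    -- 1], so only the difference of the laws of `x` is paid for.
    have h4 : (pX x - q) * s ≤ |pX x - q| :=
      (mul_le_mul_of_nonneg_right (le_abs_self _) h2).trans
        (mul_le_of_le_one_right (abs_nonneg _) h3)
    linarith
  refine (Finset.sum_le_sum fun x _ => key x).trans (le_of_eq ?_)
  rw [Finset.sum_add_distrib]
  congr 1
  simp only [average_eq_sum]
  rw [← Finset.mul_sum, Finset.sum_comm]

end Decoding

/-! ### The weak law of large numbers for log-likelihood ratios -/

section WeakLaw

variable {Ω : Type*} [Fintype Ω]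

omit [Fintype Ω] in
lemma prodPmf_ne_zero {ι : Type*} [Fintype ι] {Q : Ω → ℝ} {ω : ι → Ω} (h : prodPmf Q ω ≠ 0)
    (i : ι) : Q (ω i) ≠ 0 := fun h0 => h (Finset.prod_eq_zero (Finset.mem_univ i) h0)

lemma two_rpow_sum_logb {ι : Type*} [Fintype ι] {r : ι → ℝ} (hr : ∀ i, 0 < r i) :
    (2 : ℝ) ^ (∑ i, Real.logb 2 (r i)) = ∏ i, r i := by
  rw [Real.rpow_sum_of_pos (by norm_num)]
  exact Finset.prod_congr rfl fun i _ => Real.rpow_logb (by norm_num) (by norm_num) (hr i)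

/-- Chebyshev's inequality for the i.i.d. sum of the log ratios, whose mean lies below `R`. -/
lemma tendsto_likelihood_le {Q : Ω → ℝ} (hQ : Q ∈ stdSimplex ℝ Ω) {a b : Ω → ℝ}
    (ha : ∀ ω, Q ω ≠ 0 → 0 < a ω) (hb : ∀ ω, Q ω ≠ 0 → 0 < b ω) {R : ℝ}
    (hR : expect Q (fun ω => Real.logb 2 (a ω / b ω)) < R) :
    Tendsto (fun n : ℕ => expect (prodPmf Q) fun ω : Fin n → Ω =>
      ind (¬ ∏ i, a (ω i) ≤ (2 : ℝ) ^ (n * R) * ∏ i, b (ω i))) atTop (𝓝 0) := by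
  set g : Ω → ℝ := fun ω => Real.logb 2 (a ω / b ω) with hg
  set μ := expect Q g with hμ
  set V := expect Q (fun ω => (g ω - μ) ^ 2)
  have hbound : ∀ n : ℕ, 0 < n → expect (prodPmf Q) (fun ω : Fin n → Ω =>
      ind (¬ ∏ i, a (ω i) ≤ (2 : ℝ) ^ (n * R) * ∏ i, b (ω i)))
      ≤ V / (R - μ) ^ 2 * (1 / (n : ℝ)) := by
    intro n hn
    have hn' : (0 : ℝ) < n := Nat.cast_pos.2 hn
    have hRμ : 0 < R - μ := sub_pos.2 hR
    have hpt : ∀ ω : Fin n → Ω, prodPmf Q ω ≠ 0 →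
        ind (¬ ∏ i, a (ω i) ≤ (2 : ℝ) ^ (n * R) * ∏ i, b (ω i))
        ≤ (1 / (n * (R - μ)) ^ 2) * (∑ i, (g (ω i) - μ)) ^ 2 := by
      intro ω hω
      by_cases h : ∏ i, a (ω i) ≤ (2 : ℝ) ^ (n * R) * ∏ i, b (ω i)
      · rw [ind_of_not (not_not.2 h)]; positivity
      rw [ind_of h]
      have hbp : 0 < ∏ i, b (ω i) := Finset.prod_pos fun i _ => hb _ (prodPmf_ne_zero hω i)
      rw [← div_le_iff₀ hbp, ← Finset.prod_div_distrib,
        ← two_rpow_sum_logb fun i => div_pos (ha _ (prodPmf_ne_zero hω i))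
          (hb _ (prodPmf_ne_zero hω i)),
        Real.rpow_le_rpow_left_iff (by norm_num), not_le] at h
      have h2 : n * (R - μ) ≤ ∑ i, (g (ω i) - μ) := by
        rw [Finset.sum_sub_distrib]
        simp only [Finset.sum_const, Finset.card_univ, Fintype.card_fin, nsmul_eq_mul]
        linarith
      have h3 : 0 < n * (R - μ) := by positivity
      rw [one_div, ← div_eq_inv_mul, le_div_iff₀ (by positivity), one_mul]
      exact pow_le_pow_left₀ h3.le h2 2
    refine (expect_mono (prodPmf_mem hQ).1 hpt).trans (le_of_eq ?_)
    rw [expect_const_mul, expect_sq_sum hQ (fun ω => g ω - μ)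
      (by rw [expect_sub, expect_const hQ, sub_self]), Fintype.card_fin]
    field_simp
    rfl
  refine tendsto_of_tendsto_of_tendsto_of_le_of_le' tendsto_const_nhds
    (h := fun n : ℕ => V / (R - μ) ^ 2 * (1 / (n : ℝ))) ?_
    (Eventually.of_forall fun n => expect_nonneg (prodPmf_mem hQ).1 fun _ => ind_nonneg _)
    ((eventually_gt_atTop 0).mono hbound)
  simpa using tendsto_one_div_atTop_nhds_zero_nat.const_mul (V / (R - μ) ^ 2)

/-- The previous bound for the reciprocal ratio, whose mean logarithm is the negative. -/
lemma tendsto_le_likelihood {Q : Ω → ℝ} (hQ : Q ∈ stdSimplex ℝ Ω) {a b : Ω → ℝ}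
    (ha : ∀ ω, Q ω ≠ 0 → 0 < a ω) (hb : ∀ ω, Q ω ≠ 0 → 0 < b ω) {R : ℝ}
    (hR : R < expect Q (fun ω => Real.logb 2 (a ω / b ω))) :
    Tendsto (fun n : ℕ => expect (prodPmf Q) fun ω : Fin n → Ω =>
      ind (¬ (2 : ℝ) ^ (n * R) * ∏ i, b (ω i) ≤ ∏ i, a (ω i))) atTop (𝓝 0) := by
  have e : expect Q (fun ω => Real.logb 2 (b ω / a ω))
      = -expect Q (fun ω => Real.logb 2 (a ω / b ω)) := by
    rw [← neg_one_mul, ← expect_const_mul]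
    exact expect_congr fun ω _ => by rw [← inv_div, Real.logb_inv, neg_one_mul]
  have h := tendsto_likelihood_le hQ hb ha (R := -R) (by rw [e]; linarith)
  refine h.congr fun n => ?_
  congr 1; ext ω
  refine ind_congr (not_congr ?_)
  rw [mul_neg, Real.rpow_neg (by norm_num), ← div_eq_inv_mul, le_div_iff₀ (by positivity),
    mul_comm]

end WeakLaw

/-! ### Information inequalities -/

section Information

variable {Ω α β γ δ : Type*} [Fintype Ω] [Fintype α] [Fintype β] [Fintype γ] [Fintype δ]
  {Q : Ω → ℝ}

omit [Fintype γ] [Fintype δ] in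
lemma mutualInfo_eq_expect (Q : Ω → ℝ) (A : Ω → α) (B : Ω → β) :
    mutualInfo Q A B = expect Q fun ω => Real.logb 2
      (law Q (fun ω => (A ω, B ω)) (A ω, B ω) / (law Q A (A ω) * law Q B (B ω))) := by
  rw [expect_comp Q (fun ω => (A ω, B ω)) fun p => Real.logb 2
    (law Q (fun ω => (A ω, B ω)) p / (law Q A p.1 * law Q B p.2)), Fintype.sum_prod_type]
  rfl

omit [Fintype δ] in
lemma condMutualInfo_eq_expect (Q : Ω → ℝ) (A : Ω → α) (B : Ω → β) (C : Ω → γ) :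
    condMutualInfo Q A B C = expect Q fun ω => Real.logb 2
      ((law Q (fun ω => (A ω, B ω, C ω)) (A ω, B ω, C ω) * law Q C (C ω)) /
        (law Q (fun ω => (A ω, C ω)) (A ω, C ω) * law Q (fun ω => (B ω, C ω)) (B ω, C ω))) := by
  rw [expect_comp Q (fun ω => (A ω, B ω, C ω)) fun p => Real.logb 2
    ((law Q (fun ω => (A ω, B ω, C ω)) p * law Q C p.2.2) /
        (law Q (fun ω => (A ω, C ω)) (p.1, p.2.2) * law Q (fun ω => (B ω, C ω)) p.2))]
  simp only [Fintype.sum_prod_type]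
  rfl

omit [Fintype β] [Fintype γ] [Fintype δ] in
/-- Gibbs' inequality. -/
lemma gibbs (hQ : Q ∈ stdSimplex ℝ Ω) (A : Ω → α) {r : α → ℝ} (hr : ∀ a, 0 ≤ r a)
    (hsum : ∑ a, r a ≤ 1) (hpos : ∀ ω, Q ω ≠ 0 → 0 < r (A ω)) :
    0 ≤ expect Q (fun ω => Real.logb 2 (law Q A (A ω) / r (A ω))) ∧
    (expect Q (fun ω => Real.logb 2 (law Q A (A ω) / r (A ω))) = 0 → law Q A = r) := by
  classical
  have hl2 : 0 < Real.log 2 := Real.log_pos (by norm_num)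
  have hL := law_mem hQ A
  have hrpos : ∀ a, law Q A a ≠ 0 → 0 < r a := by
    intro a ha
    rw [law_eq_expect] at ha
    obtain ⟨ω, -, hω⟩ := Finset.exists_ne_zero_of_sum_ne_zero ha
    by_cases h : A ω = a
    · exact h ▸ hpos ω (left_ne_zero_of_mul hω)
    · simp [ind_of_not h] at hω
  rw [expect_comp Q A fun a => Real.logb 2 (law Q A a / r a)]
  set p := law Q A
  have hterm : ∀ a, (p a - r a) / Real.log 2 ≤ p a * Real.logb 2 (p a / r a) := by
    intro a
    rw [Real.logb, mul_div_assoc', div_le_div_iff_of_pos_right hl2]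
    rcases (hL.1 a).eq_or_lt' with h0 | h0
    · rw [show p a = 0 from h0]; simpa using hr a
    · have hra := hrpos a h0.ne'
      have h1 := Real.log_le_sub_one_of_pos (div_pos hra h0)
      have h2 : Real.log (p a / r a) = - Real.log (r a / p a) := by
        rw [← Real.log_inv, inv_div]
      rw [h2]
      have h3 : p a * (r a / p a - 1) = r a - p a := by field_simp
      nlinarith [mul_le_mul_of_nonneg_left h1 h0.le]
  have hs : 0 ≤ ∑ a, (p a - r a) / Real.log 2 := by
    rw [← Finset.sum_div, Finset.sum_sub_distrib, hL.2]
    exact div_nonneg (sub_nonneg.2 hsum) hl2.le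
  have hle := Finset.sum_le_sum fun a (_ : a ∈ Finset.univ) => hterm a
  refine ⟨hs.trans hle, fun h0 => ?_⟩
  -- Equality of the sums forces equality term by term, and `log t ≤ t - 1` is strict unless `t =
  -- 1`.
  have heq : ∀ a, (p a - r a) / Real.log 2 = p a * Real.logb 2 (p a / r a) := by
    have hh : ∑ a, (p a - r a) / Real.log 2 = ∑ a, p a * Real.logb 2 (p a / r a) :=
      le_antisymm hle (h0 ▸ hs)
    exact fun a => (Finset.sum_eq_sum_iff_of_le fun a _ => hterm a).1 hh a (Finset.mem_univ a)
  funext a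
  have ha := heq a
  rw [Real.logb, mul_div_assoc', div_left_inj' hl2.ne'] at ha
  rcases (hL.1 a).eq_or_lt' with hp0 | hp0
  · rw [show p a = 0 from hp0] at ha ⊢
    exact (by simpa using ha : r a = 0).symm
  · by_contra hne
    have hra := hrpos a hp0.ne'
    have h1 := Real.log_lt_sub_one_of_pos (div_pos hra hp0)
      (by rw [Ne, div_eq_one_iff_eq hp0.ne']; exact fun h => hne h.symm)
    have h2 : Real.log (p a / r a) = - Real.log (r a / p a) := by
      rw [← Real.log_inv, inv_div]
    rw [h2] at ha
    have h3 : p a * (r a / p a - 1) = r a - p a := by field_simp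
    nlinarith [mul_lt_mul_of_pos_left h1 hp0]

omit [Fintype γ] [Fintype δ] in
-- Gibbs' inequality for the joint law against the product law. The equality case serves to show
-- that probing inputs carry strictly positive information.
lemma mutualInfo_nonneg (hQ : Q ∈ stdSimplex ℝ Ω) (A : Ω → α) (B : Ω → β) :
    0 ≤ mutualInfo Q A B ∧ (mutualInfo Q A B = 0 →
      ∀ a b, law Q (fun ω => (A ω, B ω)) (a, b) = law Q A a * law Q B b) := by
  rw [mutualInfo_eq_expect]
  have h := gibbs hQ (fun ω => (A ω, B ω)) (r := fun p => law Q A p.1 * law Q B p.2)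
    (fun p => mul_nonneg (law_nonneg hQ.1 _ _) (law_nonneg hQ.1 _ _))
    (by rw [Fintype.sum_prod_type]
        simp only [← Finset.mul_sum, sum_law hQ, mul_one, le_refl])
    (fun ω h => mul_pos (law_pos hQ.1 A h) (law_pos hQ.1 B h))
  exact ⟨h.1, fun h0 a b => congrFun (h.2 h0) (a, b)⟩

omit [Fintype δ] in
lemma condMutualInfo_nonneg (hQ : Q ∈ stdSimplex ℝ Ω) (A : Ω → α) (B : Ω → β) (C : Ω → γ) :
    0 ≤ condMutualInfo Q A B C ∧ (condMutualInfo Q A B C = 0 →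
      ∀ a b c, law Q (fun ω => (A ω, B ω, C ω)) (a, b, c) * law Q C c =
        law Q (fun ω => (A ω, C ω)) (a, c) * law Q (fun ω => (B ω, C ω)) (b, c)) := by
  rw [condMutualInfo_eq_expect]
  -- The comparison law has the same marginals with `C` but makes `A` and `B` conditionally
  -- independent; it is zero where `C` has no mass.
  set r : α × β × γ → ℝ := fun p => law Q (fun ω => (A ω, C ω)) (p.1, p.2.2) *
    law Q (fun ω => (B ω, C ω)) p.2 / law Q C p.2.2 with hr
  have hBC : ∀ c, ∑ b, law Q (fun ω => (B ω, C ω)) (b, c) = law Q C c := fun c => by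
    rw [← sum_law_pair Q C B c]
    exact Finset.sum_congr rfl fun b _ => law_congr Q fun ω => by
      simp only [Prod.mk.injEq, and_comm]
  have hAC : ∀ c, ∑ a, law Q (fun ω => (A ω, C ω)) (a, c) = law Q C c := fun c => by
    rw [← sum_law_pair Q C A c]
    exact Finset.sum_congr rfl fun b _ => law_congr Q fun ω => by
      simp only [Prod.mk.injEq, and_comm]
  have hrsum : ∑ p, r p ≤ 1 := by
    simp only [hr, Fintype.sum_prod_type]
    rw [← sum_law hQ C]
    calc _ = ∑ a, ∑ c, ∑ b, law Q (fun ω => (A ω, C ω)) (a, c) *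
          law Q (fun ω => (B ω, C ω)) (b, c) / law Q C c :=
          Finset.sum_congr rfl fun a _ => Finset.sum_comm
      _ = ∑ c, ∑ a, ∑ b, law Q (fun ω => (A ω, C ω)) (a, c) *
          law Q (fun ω => (B ω, C ω)) (b, c) / law Q C c := Finset.sum_comm
      _ = ∑ c, law Q C c * law Q C c / law Q C c := by
          refine Finset.sum_congr rfl fun c _ => ?_
          simp only [← Finset.sum_div, ← Finset.mul_sum, hBC, ← Finset.sum_mul, hAC]
      _ ≤ ∑ c, law Q C c := Finset.sum_le_sum fun c _ => le_of_eq (mul_self_div_self _)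
  have h := gibbs hQ (fun ω => (A ω, B ω, C ω)) (r := r)
    (fun p => div_nonneg (mul_nonneg (law_nonneg hQ.1 _ _) (law_nonneg hQ.1 _ _))
      (law_nonneg hQ.1 _ _)) hrsum
    (fun ω h => div_pos (mul_pos (law_pos hQ.1 (fun ω => (A ω, C ω)) h)
      (law_pos hQ.1 (fun ω => (B ω, C ω)) h)) (law_pos hQ.1 C h))
  simp only [hr, div_div_eq_mul_div] at h
  refine ⟨h.1, fun h0 a b c => ?_⟩
  have h1 : law Q (fun ω => (A ω, B ω, C ω)) (a, b, c) =
      law Q (fun ω => (A ω, C ω)) (a, c) * law Q (fun ω => (B ω, C ω)) (b, c) / law Q C c :=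
    congrFun (h.2 h0) (a, b, c)
  by_cases hc : law Q C c = 0
  · rw [hc, law_eq_zero_of_imp hQ.1 (A := fun ω => (B ω, C ω)) (a := (b, c)) (B := C)
      (fun ω h => (Prod.mk.inj h).2) hc, mul_zero, mul_zero]
  · rw [h1, div_mul_cancel₀ _ hc]

omit [Fintype δ] in
lemma mutualInfo_comm (Q : Ω → ℝ) (A : Ω → α) (B : Ω → β) :
    mutualInfo Q A B = mutualInfo Q B A := by
  rw [mutualInfo_eq_expect, mutualInfo_eq_expect]
  congr 1; ext ω
  rw [mul_comm (law Q A _), law_congr Q (A := fun ω => (A ω, B ω)) (B := fun ω => (B ω, A ω))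
    (b := (B ω, A ω)) fun ω' => by simp only [Prod.mk.injEq, and_comm]]

omit [Fintype δ] in
/-- The chain rule `I(A,C;B) = I(C;B) + I(A;B|C)`. -/
lemma mutualInfo_chain (hQ : Q ∈ stdSimplex ℝ Ω) (A : Ω → α) (B : Ω → β) (C : Ω → γ) :
    mutualInfo Q (fun ω => (A ω, C ω)) B = mutualInfo Q C B + condMutualInfo Q A B C := by
  rw [mutualInfo_eq_expect, mutualInfo_eq_expect, condMutualInfo_eq_expect, ← expect_add]
  refine expect_congr fun ω h => ?_
  have p1 := law_pos hQ.1 (fun ω => ((A ω, C ω), B ω)) h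
  have p2 := law_pos hQ.1 (fun ω => (A ω, C ω)) h
  have p3 := law_pos hQ.1 B h
  have p4 := law_pos hQ.1 (fun ω => (C ω, B ω)) h
  have p5 := law_pos hQ.1 C h
  rw [law_congr Q (A := fun ω => (A ω, B ω, C ω)) (a := (A ω, B ω, C ω))
      (B := fun ω => ((A ω, C ω), B ω)) (b := ((A ω, C ω), B ω))
      fun ω' => by simp only [Prod.mk.injEq]; tauto,
    law_congr Q (A := fun ω => (B ω, C ω)) (a := (B ω, C ω))
      (B := fun ω => (C ω, B ω)) (b := (C ω, B ω))
      fun ω' => by simp only [Prod.mk.injEq]; tauto,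
    ← Real.logb_mul (by positivity) (by positivity)]
  congr 1
  field_simp

omit [Fintype δ] in
lemma condMutualInfo_eq_zero (Q : Ω → ℝ) (A : Ω → α) (B : Ω → β) (C : Ω → γ)
    (h : ∀ a b c, law Q (fun ω => (A ω, B ω, C ω)) (a, b, c) * law Q C c =
        law Q (fun ω => (A ω, C ω)) (a, c) * law Q (fun ω => (B ω, C ω)) (b, c)) :
    condMutualInfo Q A B C = 0 := by
  simp only [condMutualInfo]
  refine Finset.sum_eq_zero fun a _ => Finset.sum_eq_zero fun b _ =>
    Finset.sum_eq_zero fun c _ => ?_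
  rw [h, Real.logb_eq_zero.2, mul_zero]
  by_cases h0 : law Q (fun ω => (A ω, C ω)) (a, c) * law Q (fun ω => (B ω, C ω)) (b, c) = 0
  · simp [h0]
  · simp [h0]

omit [Fintype γ] [Fintype δ] in
lemma mutualInfo_eq_zero (Q : Ω → ℝ) (A : Ω → α) (B : Ω → β)
    (h : ∀ a b, law Q (fun ω => (A ω, B ω)) (a, b) = law Q A a * law Q B b) :
    mutualInfo Q A B = 0 := by
  simp only [mutualInfo]
  refine Finset.sum_eq_zero fun a _ => Finset.sum_eq_zero fun b _ => ?_
  rw [h, Real.logb_eq_zero.2, mul_zero]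
  by_cases h0 : law Q A a * law Q B b = 0 <;> simp [h0]

omit [Fintype δ] in
/-- The data processing inequality. -/
lemma mutualInfo_le_of_markov (hQ : Q ∈ stdSimplex ℝ Ω) {A : Ω → α} {B : Ω → β} {C : Ω → γ}
    (h : IsMarkov Q A B C) : mutualInfo Q A C ≤ mutualInfo Q A B := by
  -- Expand I(B,C;A) in both orders: the Markov property kills I(C;A|B), while I(B;A|C) is
  -- nonnegative.
  have h1 := mutualInfo_chain hQ C A B
  have h2 := mutualInfo_chain hQ B A C
  have h3 : condMutualInfo Q C A B = 0 := by
    refine condMutualInfo_eq_zero Q _ _ _ fun c a b => ?_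
    have := h a b c
    rw [law_congr Q (A := fun ω => (C ω, A ω, B ω)) (B := fun ω => (A ω, B ω, C ω))
        (b := (a, b, c)) fun ω' => by simp only [Prod.mk.injEq]; tauto,
      law_congr Q (A := fun ω => (C ω, B ω)) (B := fun ω => (B ω, C ω))
        (b := (b, c)) fun ω' => by simp only [Prod.mk.injEq]; tauto, this, mul_comm]
  have h4 := (condMutualInfo_nonneg hQ B A C).1
  have h5 : mutualInfo Q (fun ω => (C ω, B ω)) A = mutualInfo Q (fun ω => (B ω, C ω)) A := by
    rw [mutualInfo_eq_expect, mutualInfo_eq_expect]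
    congr 1; ext ω
    rw [law_congr Q (A := fun ω => ((C ω, B ω), A ω)) (a := ((C ω, B ω), A ω))
        (B := fun ω => ((B ω, C ω), A ω)) (b := ((B ω, C ω), A ω))
        fun ω' => by simp only [Prod.mk.injEq]; tauto,
      law_congr Q (A := fun ω => (C ω, B ω)) (a := (C ω, B ω))
        (B := fun ω => (B ω, C ω)) (b := (B ω, C ω))
        fun ω' => by simp only [Prod.mk.injEq]; tauto]
  rw [mutualInfo_comm Q A C, mutualInfo_comm Q A B]
  linarith

end Information

/-! ### Joint distributions of the hybrid-coding type -/

section Kernels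

variable {Ω β τ 𝒱 : Type*} [Fintype Ω] [Fintype τ] {Q : Ω → ℝ}

/-- If `V` is drawn from `T` by the kernel `k`, then so is it for a coarser variable on which `k`
depends. -/
lemma law_comp_of_kernel {T : Ω → τ} {V : Ω → 𝒱} {k : τ → 𝒱 → ℝ}
    (hk : ∀ t v, law Q (fun ω => (T ω, V ω)) (t, v) = law Q T t * k t v)
    (g : τ → β) (b : β) (v : 𝒱) :
    law Q (fun ω => (g (T ω), V ω)) (b, v) = expect Q fun ω => ind (g (T ω) = b) * k (T ω) v := by
  rw [expect_comp Q T fun t => ind (g t = b) * k t v]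
  have h1 : ∀ t, law Q T t * (ind (g t = b) * k t v)
      = expect Q fun ω => ind (g t = b) * ind (T ω = t) * ind (V ω = v) := by
    intro t
    have := hk t v
    simp only [law_eq_expect Q fun ω => (T ω, V ω), Prod.mk.injEq, ind_and] at this
    simp only [mul_assoc, expect_const_mul, this]
    ring
  rw [Finset.sum_congr rfl fun t _ => h1 t, ← expect_sum, law_eq_expect]
  refine expect_congr fun ω _ => ?_
  rw [← Finset.sum_mul, Prod.mk.injEq, ind_and]
  congr 1
  rw [← sum_ind_eq (T ω) fun t => ind (g t = b)]
  exact Finset.sum_congr rfl fun t _ => mul_comm _ _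

/-- A kernel that sees `T` only through `g` remains the conditional law after `T` is coarsened to `g
T`. The Markov chains of a model are obtained by applying this to two coarsenings of the same `T`.
-/
lemma law_comp_of_kernel' {T : Ω → τ} {V : Ω → 𝒱} {k : β → 𝒱 → ℝ} (g : τ → β)
    (hk : ∀ t v, law Q (fun ω => (T ω, V ω)) (t, v) = law Q T t * k (g t) v)
    (b : β) (v : 𝒱) :
    law Q (fun ω => (g (T ω), V ω)) (b, v) = law Q (fun ω => g (T ω)) b * k b v := by
  rw [law_comp_of_kernel hk g, law_eq_expect, mul_comm, ← expect_const_mul]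
  refine expect_congr fun ω _ => ?_
  by_cases h : g (T ω) = b
  · rw [ind_of h, h]; ring
  · rw [ind_of_not h]; ring

lemma law_comp_right {σ γ : Type*} [Fintype σ] (Q : Ω → ℝ) (C : Ω → γ) (S : Ω → σ) (h : σ → β)
    (c : γ) (b : β) :
    law Q (fun ω => (C ω, h (S ω))) (c, b)
      = ∑ s, law Q (fun ω => (C ω, S ω)) (c, s) * ind (h s = b) := by
  have h1 : ∀ s, law Q (fun ω => (C ω, S ω)) (c, s) * ind (h s = b)
      = expect Q fun ω => ind (C ω = c) * (ind (S ω = s) * ind (h s = b)) := by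
    intro s
    rw [law_eq_expect, mul_comm, ← expect_const_mul]
    refine expect_congr fun ω _ => ?_
    rw [Prod.mk.injEq, ind_and]; ring
  rw [Finset.sum_congr rfl fun s _ => h1 s, ← expect_sum, law_eq_expect]
  refine expect_congr fun ω _ => ?_
  rw [← Finset.mul_sum, sum_ind_eq (S ω) fun s => ind (h s = b), Prod.mk.injEq, ind_and]

end Kernels

section Model

variable {𝒳 𝒮 𝒲 𝒱 : Type*} [Fintype 𝒳] [Fintype 𝒮] [Fintype 𝒱]

/-- Random variables `U₀, U₁, X, S, V` with `(X, S) ∼ P`, with `(U₀, U₁) → X → S`, and with `V` the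
output of the channel `Γ` for the input `f U₀ U₁ X`. -/
structure HybridModel (P : 𝒳 × 𝒮 → ℝ) (Γ : 𝒲 → 𝒱 → ℝ) (Ω 𝒰₀ 𝒰₁ : Type*) [Fintype Ω] where
  Q : Ω → ℝ
  U₀ : Ω → 𝒰₀
  U₁ : Ω → 𝒰₁
  X : Ω → 𝒳
  S : Ω → 𝒮
  V : Ω → 𝒱
  f : 𝒰₀ → 𝒰₁ → 𝒳 → 𝒲
  mem : Q ∈ stdSimplex ℝ Ω
  source : ∀ x s, law Q (fun ω => (X ω, S ω)) (x, s) = P (x, s)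
  -- One factorization stands in for all Markov chains, because it passes directly to mixtures and
  -- to blocks. The quotient is zero where `X` has no mass, and there the first factor vanishes too.
  factor : ∀ u₀ u₁ x s v, law Q (fun ω => ((U₀ ω, U₁ ω, X ω, S ω), V ω)) ((u₀, u₁, x, s), v)
    = law Q (fun ω => (U₀ ω, U₁ ω, X ω)) (u₀, u₁, x) * (P (x, s) / ∑ s', P (x, s')) *
      Γ (f u₀ u₁ x) v

namespace HybridModel

variable {P : 𝒳 × 𝒮 → ℝ} {Γ : 𝒲 → 𝒱 → ℝ} {Ω 𝒰₀ 𝒰₁ : Type*} [Fintype Ω]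

omit [Fintype 𝒳] [Fintype 𝒱] in
lemma law_X (M : HybridModel P Γ Ω 𝒰₀ 𝒰₁) (x : 𝒳) : law M.Q M.X x = ∑ s, P (x, s) := by
  rw [← sum_law_pair M.Q M.X M.S]
  exact Finset.sum_congr rfl fun s _ => M.source x s

omit [Fintype 𝒳] in
lemma law_source (M : HybridModel P Γ Ω 𝒰₀ 𝒰₁) (hΓ : ∀ w, Γ w ∈ stdSimplex ℝ 𝒱)
    (u₀ : 𝒰₀) (u₁ : 𝒰₁) (x : 𝒳) (s : 𝒮) :
    law M.Q (fun ω => (M.U₀ ω, M.U₁ ω, M.X ω, M.S ω)) (u₀, u₁, x, s)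
      = law M.Q (fun ω => (M.U₀ ω, M.U₁ ω, M.X ω)) (u₀, u₁, x) *
        (P (x, s) / ∑ s', P (x, s')) := by
  rw [← sum_law_pair M.Q _ M.V]
  simp only [M.factor, ← Finset.mul_sum, (hΓ _).2, mul_one]

omit [Fintype 𝒳] in
lemma law_channel (M : HybridModel P Γ Ω 𝒰₀ 𝒰₁) (hΓ : ∀ w, Γ w ∈ stdSimplex ℝ 𝒱)
    (t : 𝒰₀ × 𝒰₁ × 𝒳 × 𝒮) (v : 𝒱) :
    law M.Q (fun ω => ((M.U₀ ω, M.U₁ ω, M.X ω, M.S ω), M.V ω)) (t, v)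
      = law M.Q (fun ω => (M.U₀ ω, M.U₁ ω, M.X ω, M.S ω)) t * Γ (M.f t.1 t.2.1 t.2.2.1) v := by
  obtain ⟨u₀, u₁, x, s⟩ := t
  rw [M.factor, M.law_source hΓ]

/-- `A → X → B` for `A` a function of `(U₀, U₁)` and `B` a function of `S`. -/
lemma isMarkov_source [Fintype 𝒰₀] [Fintype 𝒰₁] (M : HybridModel P Γ Ω 𝒰₀ 𝒰₁)
    (hΓ : ∀ w, Γ w ∈ stdSimplex ℝ 𝒱) {α β : Type*} (g : 𝒰₀ × 𝒰₁ → α) (h : 𝒮 → β) :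
    IsMarkov M.Q (fun ω => g (M.U₀ ω, M.U₁ ω)) M.X (fun ω => h (M.S ω)) := by
  intro a x b
  set k : 𝒳 → 𝒮 → ℝ := fun x s => P (x, s) / ∑ s', P (x, s') with hk
  have h1 : ∀ t s, law M.Q (fun ω => ((M.U₀ ω, M.U₁ ω, M.X ω), M.S ω)) (t, s)
      = law M.Q (fun ω => (M.U₀ ω, M.U₁ ω, M.X ω)) t * k t.2.2 s := by
    rintro ⟨u₀, u₁, x⟩ s
    rw [hk]
    simp only
    rw [← M.law_source hΓ]
    exact law_congr _ fun ω => by simp only [Prod.mk.injEq, and_assoc]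
  have h2 := law_comp_of_kernel' (Q := M.Q) (T := fun ω => (M.U₀ ω, M.U₁ ω, M.X ω)) (V := M.S)
    (k := fun (b : α × 𝒳) s => k b.2 s) (fun t => (g (t.1, t.2.1), t.2.2)) h1
  have h3 := law_comp_of_kernel' (Q := M.Q) (T := fun ω => (M.U₀ ω, M.U₁ ω, M.X ω)) (V := M.S)
    (k := k) (fun t => t.2.2) h1
  have e1 : law M.Q (fun ω => (g (M.U₀ ω, M.U₁ ω), M.X ω, h (M.S ω))) (a, x, b)
      = law M.Q (fun ω => ((g (M.U₀ ω, M.U₁ ω), M.X ω), h (M.S ω))) ((a, x), b) :=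
    law_congr _ fun ω => by simp only [Prod.mk.injEq, and_assoc]
  rw [e1, law_comp_right _ _ M.S h, law_comp_right _ M.X M.S h]
  simp only [h2, h3, Finset.sum_mul, Finset.mul_sum]
  exact Finset.sum_congr rfl fun s _ => by ring

end HybridModel

end Model

/-! ### Consequences of degradedness, and channels that ignore their input -/

section Degraded

variable {𝒳 𝒴₁ 𝒴₂ 𝒵₁ 𝒲 𝒱₁ 𝒱₂ Ω 𝒰₀ 𝒰₁ : Type*} [Fintype 𝒳] [Fintype 𝒴₁] [Fintype 𝒴₂]
  [Fintype 𝒵₁] [Fintype 𝒱₁] [Fintype 𝒱₂] [Fintype Ω] [Fintype 𝒰₀] [Fintype 𝒰₁]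
  {P : 𝒳 × 𝒴₁ × 𝒴₂ × 𝒵₁ → ℝ} {Γ : 𝒲 → 𝒱₁ × 𝒱₂ → ℝ}

namespace HybridModel

variable (M : HybridModel P Γ Ω 𝒰₀ 𝒰₁)

/-- The pair of auxiliary variables. -/
def U (ω : Ω) : 𝒰₀ × 𝒰₁ := (M.U₀ ω, M.U₁ ω)

/-- The first source observation of Receiver 1. -/
def Y₁ (ω : Ω) : 𝒴₁ := (M.S ω).1

/-- The source observation of Receiver 2. -/
def Y₂ (ω : Ω) : 𝒴₂ := (M.S ω).2.1

/-- The second source observation of Receiver 1. -/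
def Z₁ (ω : Ω) : 𝒵₁ := (M.S ω).2.2

/-- The channel output at Receiver 2. -/
def V₂ (ω : Ω) : 𝒱₂ := (M.V ω).2

/-- The observations that Receiver 1 uses for decoding. -/
def B₁ (ω : Ω) : 𝒱₁ × 𝒵₁ := ((M.V ω).1, (M.S ω).2.2)

/-- Given sources, auxiliary variables and `V₁`, the output `V₂` is drawn by the degrading kernel
from `V₁` alone. By data processing, `B₁` then tells at least as much about `U₀` as `V₂` does, so
Receiver 1 can also decode the cloud centre. -/
lemma isMarkov_degraded (hΓ : ∀ w, Γ w ∈ stdSimplex ℝ (𝒱₁ × 𝒱₂)) (hdeg : IsDegraded Γ) :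
    IsMarkov M.Q M.U₀ M.B₁ M.V₂ := by
  obtain ⟨D, hD, hΓD⟩ := hdeg
  have h1 : ∀ (t : (𝒰₀ × 𝒰₁ × 𝒳 × 𝒴₁ × 𝒴₂ × 𝒵₁) × 𝒱₁) (v : 𝒱₂),
      law M.Q (fun ω => (((M.U₀ ω, M.U₁ ω, M.X ω, M.S ω), (M.V ω).1), M.V₂ ω)) (t, v)
      = law M.Q (fun ω => ((M.U₀ ω, M.U₁ ω, M.X ω, M.S ω), (M.V ω).1)) t * D t.2 v := by
    rintro ⟨t, v₁⟩ v
    have e : ∀ v₂, law M.Q (fun ω => (((M.U₀ ω, M.U₁ ω, M.X ω, M.S ω), (M.V ω).1), M.V₂ ω))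
        ((t, v₁), v₂) = law M.Q (fun ω => (M.U₀ ω, M.U₁ ω, M.X ω, M.S ω)) t *
          (∑ v₂', Γ (M.f t.1 t.2.1 t.2.2.1) (v₁, v₂')) * D v₁ v₂ := by
      intro v₂
      rw [mul_assoc, ← hΓD, ← M.law_channel hΓ]
      exact law_congr _ fun ω => by
        simp only [and_assoc, Prod.ext_iff, V₂]
    rw [e v, ← sum_law_pair M.Q (fun ω => ((M.U₀ ω, M.U₁ ω, M.X ω, M.S ω), (M.V ω).1)) M.V₂]
    simp only [e, ← Finset.mul_sum, (hD v₁).2, mul_one]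
  have h2 := law_comp_of_kernel' (Q := M.Q)
    (T := fun ω => ((M.U₀ ω, M.U₁ ω, M.X ω, M.S ω), (M.V ω).1)) (V := M.V₂)
    (k := fun (b : 𝒰₀ × 𝒱₁ × 𝒵₁) v => D b.2.1 v)
    (fun t => (t.1.1, t.2, t.1.2.2.2.2.2)) h1
  have h3 := law_comp_of_kernel' (Q := M.Q)
    (T := fun ω => ((M.U₀ ω, M.U₁ ω, M.X ω, M.S ω), (M.V ω).1)) (V := M.V₂)
    (k := fun (b : 𝒱₁ × 𝒵₁) v => D b.1 v)
    (fun t => (t.2, t.1.2.2.2.2.2)) h1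
  intro u b v
  have e1 : law M.Q (fun ω => (M.U₀ ω, M.B₁ ω, M.V₂ ω)) (u, b, v)
      = law M.Q (fun ω => ((M.U₀ ω, M.B₁ ω), M.V₂ ω)) ((u, b), v) :=
    law_congr _ fun ω => by simp only [Prod.mk.injEq, and_assoc]
  have h2' : law M.Q (fun ω => ((M.U₀ ω, M.B₁ ω), M.V₂ ω)) ((u, b), v)
      = law M.Q (fun ω => (M.U₀ ω, M.B₁ ω)) (u, b) * D b.1 v := h2 (u, b) v
  have h3' : law M.Q (fun ω => (M.B₁ ω, M.V₂ ω)) (b, v) = law M.Q M.B₁ b * D b.1 v := h3 b v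
  rw [e1, h2', h3']
  ring

/-- If the channel output of Receiver 2 does not depend on the input, it is useless. -/
lemma mutualInfo_V₂_eq_zero (hΓ : ∀ w, Γ w ∈ stdSimplex ℝ (𝒱₁ × 𝒱₂))
    (h : ∀ w w' v₂, ∑ v₁, Γ w (v₁, v₂) = ∑ v₁, Γ w' (v₁, v₂)) :
    mutualInfo M.Q M.U₀ M.V₂ = 0 := by
  rcases isEmpty_or_nonempty 𝒲 with hW | ⟨⟨w⟩⟩
  · exact mutualInfo_eq_zero _ _ _ fun u v => by
      have : IsEmpty Ω := ⟨fun ω => hW.false (M.f (M.U₀ ω) (M.U₁ ω) (M.X ω))⟩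
      simp [law]
  have h1 : ∀ (t : 𝒰₀ × 𝒰₁ × 𝒳 × 𝒴₁ × 𝒴₂ × 𝒵₁) (v : 𝒱₂),
      law M.Q (fun ω => ((M.U₀ ω, M.U₁ ω, M.X ω, M.S ω), M.V₂ ω)) (t, v)
      = law M.Q (fun ω => (M.U₀ ω, M.U₁ ω, M.X ω, M.S ω)) t * ∑ v₁, Γ w (v₁, v) := by
    intro t v
    rw [← h (M.f t.1 t.2.1 t.2.2.1), Finset.mul_sum, ← sum_law_pair M.Q _ fun ω => (M.V ω).1]
    refine Finset.sum_congr rfl fun v₁ _ => ?_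
    rw [← M.law_channel hΓ]
    exact law_congr _ fun ω => by simp only [Prod.ext_iff, V₂]; tauto
  have h2 := law_comp_of_kernel' (Q := M.Q)
    (T := fun ω => (M.U₀ ω, M.U₁ ω, M.X ω, M.S ω)) (V := M.V₂)
    (k := fun (_ : 𝒰₀) v => ∑ v₁, Γ w (v₁, v)) (fun t => t.1) h1
  have h3 := law_comp_of_kernel' (Q := M.Q)
    (T := fun ω => (M.U₀ ω, M.U₁ ω, M.X ω, M.S ω)) (V := M.V₂)
    (k := fun (_ : Unit) v => ∑ v₁, Γ w (v₁, v)) (fun _ => ()) h1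
  have h4 : law M.Q (fun _ => ()) () = 1 := by
    rw [law_eq_expect, ← expect_const M.mem 1]
    exact expect_congr fun _ _ => ind_of rfl
  refine mutualInfo_eq_zero _ _ _ fun u v => ?_
  have h5 : law M.Q M.V₂ v = ∑ v₁, Γ w (v₁, v) := by
    have := h3 () v
    rw [h4, one_mul] at this
    rw [← this]
    exact law_congr _ fun ω => by simp
  rw [h5]
  exact h2 u v

/-- If the channel output of Receiver 1 does not depend on the input, it is useless. -/
lemma mutualInfo_B₁_eq (hΓ : ∀ w, Γ w ∈ stdSimplex ℝ (𝒱₁ × 𝒱₂))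
    (h : ∀ w w' v₁, ∑ v₂, Γ w (v₁, v₂) = ∑ v₂, Γ w' (v₁, v₂)) :
    mutualInfo M.Q M.U M.B₁ ≤ mutualInfo M.Q M.U M.Z₁ := by
  have hne : Nonempty Ω := by
    by_contra hΩ
    rw [not_nonempty_iff] at hΩ
    simpa using M.mem.2
  obtain ⟨ω₀⟩ := hne
  set w := M.f (M.U₀ ω₀) (M.U₁ ω₀) (M.X ω₀)
  have h1 : ∀ (t : 𝒰₀ × 𝒰₁ × 𝒳 × 𝒴₁ × 𝒴₂ × 𝒵₁) (v : 𝒱₁),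
      law M.Q (fun ω => ((M.U₀ ω, M.U₁ ω, M.X ω, M.S ω), (M.V ω).1)) (t, v)
      = law M.Q (fun ω => (M.U₀ ω, M.U₁ ω, M.X ω, M.S ω)) t * ∑ v₂, Γ w (v, v₂) := by
    intro t v
    rw [← h (M.f t.1 t.2.1 t.2.2.1), Finset.mul_sum, ← sum_law_pair M.Q _ fun ω => (M.V ω).2]
    refine Finset.sum_congr rfl fun v₁ _ => ?_
    rw [← M.law_channel hΓ]
    exact law_congr _ fun ω => by simp only [Prod.ext_iff]; tauto
  have h2 := law_comp_of_kernel' (Q := M.Q)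
    (T := fun ω => (M.U₀ ω, M.U₁ ω, M.X ω, M.S ω)) (V := fun ω => (M.V ω).1)
    (k := fun (_ : (𝒰₀ × 𝒰₁) × 𝒵₁) v => ∑ v₂, Γ w (v, v₂))
    (fun t => ((t.1, t.2.1), t.2.2.2.2.2)) h1
  have h3 := law_comp_of_kernel' (Q := M.Q)
    (T := fun ω => (M.U₀ ω, M.U₁ ω, M.X ω, M.S ω)) (V := fun ω => (M.V ω).1)
    (k := fun (_ : 𝒵₁) v => ∑ v₂, Γ w (v, v₂)) (fun t => t.2.2.2.2.2) h1
  -- Data processing along U → Z₁ → (V₁, Z₁). Since `Z₁` recurs inside `B₁`, both laws carry an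
  -- indicator that its two copies agree.
  refine mutualInfo_le_of_markov M.mem fun u z b => ?_
  have e1 : law M.Q (fun ω => (M.U ω, M.Z₁ ω, M.B₁ ω)) (u, z, b)
      = ind (b.2 = z) * (law M.Q (fun ω => (M.U ω, M.Z₁ ω)) (u, z) * ∑ v₂, Γ w (b.1, v₂)) := by
    by_cases hb : b.2 = z
    · rw [ind_of hb, one_mul]
      refine Eq.trans (law_congr _ fun ω => ?_) (h2 (u, z) b.1)
      subst hb
      simp only [Prod.ext_iff, U, Z₁, B₁]
      tauto
    · rw [ind_of_not hb, zero_mul, law_eq_expect, ← expect_const M.mem 0]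
      refine expect_congr fun ω _ => ind_of_not fun h' => hb ?_
      simp only [Prod.ext_iff, Z₁, B₁] at h'
      rw [← h'.2.1, ← h'.2.2.2]
  have e2 : law M.Q (fun ω => (M.Z₁ ω, M.B₁ ω)) (z, b)
      = ind (b.2 = z) * (law M.Q M.Z₁ z * ∑ v₂, Γ w (b.1, v₂)) := by
    by_cases hb : b.2 = z
    · rw [ind_of hb, one_mul]
      refine Eq.trans (law_congr _ fun ω => ?_) (h3 z b.1)
      subst hb
      simp only [Prod.ext_iff, Z₁, B₁]
      tauto
    · rw [ind_of_not hb, zero_mul, law_eq_expect, ← expect_const M.mem 0]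
      refine expect_congr fun ω _ => ind_of_not fun h' => hb ?_
      simp only [Prod.ext_iff, Z₁, B₁] at h'
      rw [← h'.1, ← h'.2.2]
  rw [e1, e2]
  ring

end HybridModel

end Degraded

/-! ### Mixtures -/

section Mixture

variable {Ω Ω' α β γ : Type*} [Fintype Ω] [Fintype Ω'] {Q : Ω → ℝ} {Q' : Ω' → ℝ} {l : ℝ}

/-- The mixture of two probability spaces with weights `l` and `1 - l`. -/
def mixPmf (l : ℝ) (Q : Ω → ℝ) (Q' : Ω' → ℝ) : Ω ⊕ Ω' → ℝ :=
  Sum.elim (fun ω => l * Q ω) fun ω => (1 - l) * Q' ω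

lemma expect_mixPmf (l : ℝ) (Q : Ω → ℝ) (Q' : Ω' → ℝ) (g : Ω ⊕ Ω' → ℝ) :
    expect (mixPmf l Q Q') g
      = l * expect Q (fun ω => g (.inl ω)) + (1 - l) * expect Q' (fun ω => g (.inr ω)) := by
  simp [expect, mixPmf, Finset.mul_sum, mul_assoc]

lemma law_mixPmf (l : ℝ) (Q : Ω → ℝ) (Q' : Ω' → ℝ) (A : Ω ⊕ Ω' → α) (a : α) :
    law (mixPmf l Q Q') A a
      = l * law Q (fun ω => A (.inl ω)) a + (1 - l) * law Q' (fun ω => A (.inr ω)) a := by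
  simp only [law_eq_expect, expect_mixPmf]

lemma mixPmf_mem (hQ : Q ∈ stdSimplex ℝ Ω) (hQ' : Q' ∈ stdSimplex ℝ Ω') (h0 : 0 ≤ l)
    (h1 : l ≤ 1) : mixPmf l Q Q' ∈ stdSimplex ℝ (Ω ⊕ Ω') := by
  constructor
  · rintro (ω | ω)
    · exact mul_nonneg h0 (hQ.1 ω)
    · exact mul_nonneg (sub_nonneg.2 h1) (hQ'.1 ω)
  · have := expect_mixPmf l Q Q' fun _ => 1
    rw [expect_const hQ, expect_const hQ'] at this
    simp only [expect, mul_one] at this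
    rw [this]; ring

lemma law_eq_zero_of_ne {A : Ω → α} {a : α} (h : ∀ ω, A ω ≠ a) : law Q A a = 0 := by
  simp [law, h]

/-- If `A` reveals which component is active, its values on one component have no mass on the other.
-/
lemma law_mixPmf_inl (A : Ω ⊕ Ω' → α) (h : ∀ ω ω', A (.inl ω) ≠ A (.inr ω')) (ω : Ω) :
    law (mixPmf l Q Q') A (A (.inl ω)) = l * law Q (fun ω => A (.inl ω)) (A (.inl ω)) := by
  rw [law_mixPmf, law_eq_zero_of_ne (Q := Q') fun ω' => (h ω ω').symm]
  ring

lemma law_mixPmf_inr (A : Ω ⊕ Ω' → α) (h : ∀ ω ω', A (.inl ω) ≠ A (.inr ω')) (ω : Ω') :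
    law (mixPmf l Q Q') A (A (.inr ω))
      = (1 - l) * law Q' (fun ω => A (.inr ω)) (A (.inr ω)) := by
  rw [law_mixPmf, law_eq_zero_of_ne (Q := Q) fun ω' => h ω' ω]
  ring

variable [Fintype α] [Fintype β] [Fintype γ]

omit [Fintype γ] in
/-- Mutual information relative to a mismatched output distribution `r`. -/
lemma expect_logb_mismatched (hQ : Q ∈ stdSimplex ℝ Ω) (A : Ω → α) (B : Ω → β) (hl : 0 < l)
    (r : β → ℝ) (hr : ∀ ω, Q ω ≠ 0 → 0 < r (B ω)) :
    expect Q (fun ω => Real.logb 2 (l * law Q (fun ω => (A ω, B ω)) (A ω, B ω) /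
        (l * law Q A (A ω) * r (B ω))))
      = mutualInfo Q A B + expect Q (fun ω => Real.logb 2 (law Q B (B ω) / r (B ω))) := by
  rw [mutualInfo_eq_expect, ← expect_add]
  refine expect_congr fun ω h => ?_
  have p1 := law_pos hQ.1 (fun ω => (A ω, B ω)) h
  have p2 := law_pos hQ.1 A h
  have p3 := law_pos hQ.1 B h
  have p4 := hr ω h
  rw [← Real.logb_mul (by positivity) (by positivity)]
  congr 1
  field_simp

omit [Fintype γ] in
-- `A` determines the component, so the laws of `A` and of the pair split, whereas the law of `B`
-- stays mixed. The extra terms are the divergences of the component laws of `B` from the mixed one.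
lemma mutualInfo_mixPmf (hQ : Q ∈ stdSimplex ℝ Ω) (hQ' : Q' ∈ stdSimplex ℝ Ω') (h0 : 0 < l)
    (h1 : l < 1) (A : Ω ⊕ Ω' → α) (B : Ω ⊕ Ω' → β)
    (hA : ∀ ω ω', A (.inl ω) ≠ A (.inr ω')) :
    mutualInfo (mixPmf l Q Q') A B
      = l * (mutualInfo Q (fun ω => A (.inl ω)) (fun ω => B (.inl ω)) +
          expect Q fun ω => Real.logb 2 (law Q (fun ω => B (.inl ω)) (B (.inl ω)) /
            law (mixPmf l Q Q') B (B (.inl ω))))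
        + (1 - l) * (mutualInfo Q' (fun ω => A (.inr ω)) (fun ω => B (.inr ω)) +
          expect Q' fun ω => Real.logb 2 (law Q' (fun ω => B (.inr ω)) (B (.inr ω)) /
            law (mixPmf l Q Q') B (B (.inr ω)))) := by
  have hl := sub_pos.2 h1
  have hm := mixPmf_mem hQ hQ' h0.le h1.le
  have r1 : ∀ ω, Q ω ≠ 0 → 0 < law (mixPmf l Q Q') B (B (.inl ω)) := fun ω h =>
    law_pos hm.1 B (ω := .inl ω) (mul_ne_zero h0.ne' h)
  have r2 : ∀ ω, Q' ω ≠ 0 → 0 < law (mixPmf l Q Q') B (B (.inr ω)) := fun ω h =>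
    law_pos hm.1 B (ω := .inr ω) (mul_ne_zero hl.ne' h)
  rw [mutualInfo_eq_expect, expect_mixPmf,
    ← expect_logb_mismatched hQ (fun ω => A (.inl ω)) (fun ω => B (.inl ω)) h0 _ r1,
    ← expect_logb_mismatched hQ' (fun ω => A (.inr ω)) (fun ω => B (.inr ω)) hl _ r2]
  have hAB : ∀ ω ω', (A (.inl ω), B (.inl ω)) ≠ (A (.inr ω'), B (.inr ω')) :=
    fun ω ω' h => hA ω ω' (Prod.mk.inj h).1
  simp only [law_mixPmf_inl A hA, law_mixPmf_inr A hA,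
    law_mixPmf_inl (fun ω => (A ω, B ω)) hAB, law_mixPmf_inr (fun ω => (A ω, B ω)) hAB]

omit [Fintype γ] in
-- The divergences are nonnegative: knowing the component can only help. This serves for the channel
-- output, whose law may differ between the components.
lemma le_mutualInfo_mixPmf (hQ : Q ∈ stdSimplex ℝ Ω) (hQ' : Q' ∈ stdSimplex ℝ Ω') (h0 : 0 < l)
    (h1 : l < 1) (A : Ω ⊕ Ω' → α) (B : Ω ⊕ Ω' → β)
    (hA : ∀ ω ω', A (.inl ω) ≠ A (.inr ω')) :
    l * mutualInfo Q (fun ω => A (.inl ω)) (fun ω => B (.inl ω))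
      + (1 - l) * mutualInfo Q' (fun ω => A (.inr ω)) (fun ω => B (.inr ω))
      ≤ mutualInfo (mixPmf l Q Q') A B := by
  have hl := sub_pos.2 h1
  have hm := mixPmf_mem hQ hQ' h0.le h1.le
  have hr : ∀ b, 0 ≤ law (mixPmf l Q Q') B b := law_nonneg hm.1 B
  have g1 := (gibbs hQ (fun ω => B (.inl ω)) hr (sum_law hm B).le fun ω h =>
    law_pos hm.1 B (ω := .inl ω) (mul_ne_zero h0.ne' h)).1
  have g2 := (gibbs hQ' (fun ω => B (.inr ω)) hr (sum_law hm B).le fun ω h =>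
    law_pos hm.1 B (ω := .inr ω) (mul_ne_zero hl.ne' h)).1
  rw [mutualInfo_mixPmf hQ hQ' h0 h1 A B hA]
  gcongr <;> linarith

omit [Fintype γ] in
-- The divergences vanish. This serves for source variables, whose law is the same in every model.
lemma mutualInfo_mixPmf_of_law_eq (hQ : Q ∈ stdSimplex ℝ Ω) (hQ' : Q' ∈ stdSimplex ℝ Ω')
    (h0 : 0 < l) (h1 : l < 1) (A : Ω ⊕ Ω' → α) (B : Ω ⊕ Ω' → β)
    (hA : ∀ ω ω', A (.inl ω) ≠ A (.inr ω'))
    (hB : ∀ b, law Q (fun ω => B (.inl ω)) b = law Q' (fun ω => B (.inr ω)) b) :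
    mutualInfo (mixPmf l Q Q') A B
      = l * mutualInfo Q (fun ω => A (.inl ω)) (fun ω => B (.inl ω))
        + (1 - l) * mutualInfo Q' (fun ω => A (.inr ω)) (fun ω => B (.inr ω)) := by
  have e1 : ∀ b, law (mixPmf l Q Q') B b = law Q (fun ω => B (.inl ω)) b := fun b => by
    rw [law_mixPmf, ← hB]; ring
  have e2 : ∀ b, law (mixPmf l Q Q') B b = law Q' (fun ω => B (.inr ω)) b := fun b => by
    rw [e1, hB]
  have z1 : expect Q (fun ω => Real.logb 2 (law Q (fun ω => B (.inl ω)) (B (.inl ω)) /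
      law (mixPmf l Q Q') B (B (.inl ω)))) = 0 := by
    rw [← expect_const hQ 0]
    refine expect_congr fun ω h => ?_
    rw [e1, div_self (law_pos hQ.1 (fun ω => B (.inl ω)) h).ne', Real.logb_one]
  have z2 : expect Q' (fun ω => Real.logb 2 (law Q' (fun ω => B (.inr ω)) (B (.inr ω)) /
      law (mixPmf l Q Q') B (B (.inr ω)))) = 0 := by
    rw [← expect_const hQ' 0]
    refine expect_congr fun ω h => ?_
    rw [e2, div_self (law_pos hQ'.1 (fun ω => B (.inr ω)) h).ne', Real.logb_one]
  rw [mutualInfo_mixPmf hQ hQ' h0 h1 A B hA, z1, z2, add_zero, add_zero]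

/-- All four laws involve `C`, which determines the component, so the component weights cancel in
the ratio. -/
lemma condMutualInfo_mixPmf (h0 : 0 < l) (h1 : l < 1) (A : Ω ⊕ Ω' → α) (B : Ω ⊕ Ω' → β)
    (C : Ω ⊕ Ω' → γ) (hC : ∀ ω ω', C (.inl ω) ≠ C (.inr ω')) :
    condMutualInfo (mixPmf l Q Q') A B C
      = l * condMutualInfo Q (fun ω => A (.inl ω)) (fun ω => B (.inl ω)) (fun ω => C (.inl ω))
        + (1 - l) * condMutualInfo Q' (fun ω => A (.inr ω)) (fun ω => B (.inr ω))
            (fun ω => C (.inr ω)) := by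
  have hl := sub_pos.2 h1
  have hABC : ∀ ω ω', (A (.inl ω), B (.inl ω), C (.inl ω)) ≠ (A (.inr ω'), B (.inr ω'), C (.inr ω')) :=
    fun ω ω' h => hC ω ω' (by simp only [Prod.mk.injEq] at h; exact h.2.2)
  have hAC : ∀ ω ω', (A (.inl ω), C (.inl ω)) ≠ (A (.inr ω'), C (.inr ω')) :=
    fun ω ω' h => hC ω ω' (Prod.mk.inj h).2
  have hBC : ∀ ω ω', (B (.inl ω), C (.inl ω)) ≠ (B (.inr ω'), C (.inr ω')) :=
    fun ω ω' h => hC ω ω' (Prod.mk.inj h).2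
  simp only [condMutualInfo_eq_expect]
  rw [expect_mixPmf]
  simp only [law_mixPmf_inl C hC, law_mixPmf_inr C hC,
    law_mixPmf_inl (fun ω => (A ω, B ω, C ω)) hABC, law_mixPmf_inr (fun ω => (A ω, B ω, C ω)) hABC,
    law_mixPmf_inl (fun ω => (A ω, C ω)) hAC, law_mixPmf_inr (fun ω => (A ω, C ω)) hAC,
    law_mixPmf_inl (fun ω => (B ω, C ω)) hBC, law_mixPmf_inr (fun ω => (B ω, C ω)) hBC,
    mul_mul_mul_comm _ _ l, mul_mul_mul_comm _ _ (1 - l),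
    mul_div_mul_left _ _ (mul_pos h0 h0).ne', mul_div_mul_left _ _ (mul_pos hl hl).ne']

/-- The chain rule `I(A;B,C) = I(A;C) + I(A;B|C)`. -/
lemma mutualInfo_chain_right (hQ : Q ∈ stdSimplex ℝ Ω) (A : Ω → α) (B : Ω → β) (C : Ω → γ) :
    mutualInfo Q A (fun ω => (B ω, C ω)) = mutualInfo Q A C + condMutualInfo Q A B C := by
  rw [mutualInfo_eq_expect, mutualInfo_eq_expect, condMutualInfo_eq_expect, ← expect_add]
  refine expect_congr fun ω h => ?_
  have p1 := law_pos hQ.1 (fun ω => (A ω, B ω, C ω)) h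
  have p2 := law_pos hQ.1 (fun ω => (A ω, C ω)) h
  have p3 := law_pos hQ.1 A h
  have p4 := law_pos hQ.1 (fun ω => (B ω, C ω)) h
  have p5 := law_pos hQ.1 C h
  rw [← Real.logb_mul (by positivity) (by positivity)]
  congr 1
  field_simp

/-- Here `A`, not the conditioning variable, reveals the component. Hence the detour through
I(A;B,C) - I(A;C), both of which are linear in the mixture; the nonnegative contribution of the
second component is dropped. -/
lemma le_condMutualInfo_mixPmf (hQ : Q ∈ stdSimplex ℝ Ω) (hQ' : Q' ∈ stdSimplex ℝ Ω')
    (h0 : 0 < l) (h1 : l < 1) (A : Ω ⊕ Ω' → α) (B : Ω ⊕ Ω' → β) (C : Ω ⊕ Ω' → γ)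
    (hA : ∀ ω ω', A (.inl ω) ≠ A (.inr ω'))
    (hBC : ∀ p, law Q (fun ω => (B (.inl ω), C (.inl ω))) p
      = law Q' (fun ω => (B (.inr ω), C (.inr ω))) p)
    (hC : ∀ c, law Q (fun ω => C (.inl ω)) c = law Q' (fun ω => C (.inr ω)) c) :
    l * condMutualInfo Q (fun ω => A (.inl ω)) (fun ω => B (.inl ω)) (fun ω => C (.inl ω))
      ≤ condMutualInfo (mixPmf l Q Q') A B C := by
  have e := mutualInfo_mixPmf_of_law_eq hQ hQ' h0 h1 A (fun ω => (B ω, C ω)) hA hBC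
  have e' := mutualInfo_mixPmf_of_law_eq hQ hQ' h0 h1 A C hA hC
  rw [mutualInfo_chain_right (mixPmf_mem hQ hQ' h0.le h1.le) A B C, e',
    mutualInfo_chain_right hQ, mutualInfo_chain_right hQ'] at e
  have c := (condMutualInfo_nonneg hQ' (fun ω => A (.inr ω)) (fun ω => B (.inr ω))
    fun ω => C (.inr ω)).1
  nlinarith [mul_nonneg (sub_pos.2 h1).le c]

end Mixture

namespace HybridModel

/-! ### Time sharing between models -/

section Mix

variable {𝒳 𝒮 𝒲 𝒱 : Type*} [Fintype 𝒮] {P : 𝒳 × 𝒮 → ℝ} {Γ : 𝒲 → 𝒱 → ℝ}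
  {Ω 𝒰₀ 𝒰₁ Ω' 𝒰₀' 𝒰₁' : Type*} [Fintype Ω] [Fintype Ω']

/-- Time sharing between two models, known to everybody. -/
noncomputable def mix (M : HybridModel P Γ Ω 𝒰₀ 𝒰₁) (M' : HybridModel P Γ Ω' 𝒰₀' 𝒰₁') (w : 𝒲)
    (l : ℝ) (h0 : 0 ≤ l) (h1 : l ≤ 1) :
    HybridModel P Γ (Ω ⊕ Ω') (𝒰₀ ⊕ 𝒰₀') (𝒰₁ ⊕ 𝒰₁') where
  Q := mixPmf l M.Q M'.Q
  U₀ := Sum.map M.U₀ M'.U₀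
  U₁ := Sum.map M.U₁ M'.U₁
  X := Sum.elim M.X M'.X
  S := Sum.elim M.S M'.S
  V := Sum.elim M.V M'.V
  f u₀ u₁ x := match u₀, u₁ with
    | .inl u₀, .inl u₁ => M.f u₀ u₁ x
    | .inr u₀, .inr u₁ => M'.f u₀ u₁ x
    | _, _ => w
  mem := mixPmf_mem M.mem M'.mem h0 h1
  source x s := by
    rw [law_mixPmf]
    simp only [Sum.elim_inl, Sum.elim_inr, M.source, M'.source]
    ring
  factor := by
    intro u₀ u₁ x s v
    rw [law_mixPmf, law_mixPmf]
    simp only [Sum.elim_inl, Sum.elim_inr, Sum.map_inl, Sum.map_inr]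
    rcases u₀ with u₀ | u₀ <;> rcases u₁ with u₁ | u₁
    · rw [law_eq_zero_of_ne (Q := M'.Q) (fun ω => by simp),
        law_eq_zero_of_ne (Q := M'.Q) (fun ω => by simp),
        law_congr M.Q (B := fun ω => ((M.U₀ ω, M.U₁ ω, M.X ω, M.S ω), M.V ω))
          (b := ((u₀, u₁, x, s), v)) (fun ω => by simp), M.factor,
        law_congr M.Q (A := fun ω => (Sum.inl (M.U₀ ω), Sum.inl (M.U₁ ω), M.X ω))
          (B := fun ω => (M.U₀ ω, M.U₁ ω, M.X ω))
          (b := (u₀, u₁, x)) (fun ω => by simp)]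
      ring
    · rw [law_eq_zero_of_ne (Q := M'.Q) (fun ω => by simp),
        law_eq_zero_of_ne (Q := M'.Q) (fun ω => by simp),
        law_eq_zero_of_ne (Q := M.Q) (fun ω => by simp),
        law_eq_zero_of_ne (Q := M.Q) (fun ω => by simp)]
      ring
    · rw [law_eq_zero_of_ne (Q := M'.Q) (fun ω => by simp),
        law_eq_zero_of_ne (Q := M'.Q) (fun ω => by simp),
        law_eq_zero_of_ne (Q := M.Q) (fun ω => by simp),
        law_eq_zero_of_ne (Q := M.Q) (fun ω => by simp)]
      ring
    · rw [law_eq_zero_of_ne (Q := M.Q) (fun ω => by simp),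
        law_eq_zero_of_ne (Q := M.Q) (fun ω => by simp),
        law_congr M'.Q (B := fun ω => ((M'.U₀ ω, M'.U₁ ω, M'.X ω, M'.S ω), M'.V ω))
          (b := ((u₀, u₁, x, s), v)) (fun ω => by simp), M'.factor,
        law_congr M'.Q (A := fun ω => (Sum.inr (M'.U₀ ω), Sum.inr (M'.U₁ ω), M'.X ω))
          (B := fun ω => (M'.U₀ ω, M'.U₁ ω, M'.X ω))
          (b := (u₀, u₁, x)) (fun ω => by simp)]
      ring

end Mix

/-! ### A model that only probes the channel -/

section Probe

variable {𝒳 𝒮 𝒲 𝒱 : Type*} [Fintype 𝒳] [Fintype 𝒮] [Fintype 𝒱]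
  {P : 𝒳 × 𝒮 → ℝ} {Γ : 𝒲 → 𝒱 → ℝ}

/-- The joint pmf of two fair bits, the independent sources, and the output of the channel for the
input `w₁` if both bits are set and `w₀` otherwise. -/
noncomputable def probePmf (P : 𝒳 × 𝒮 → ℝ) (Γ : 𝒲 → 𝒱 → ℝ) (w₀ w₁ : 𝒲)
    (ω : Bool × Bool × (𝒳 × 𝒮) × 𝒱) : ℝ :=
  4⁻¹ * P ω.2.2.1 * Γ (bif ω.1 && ω.2.1 then w₁ else w₀) ω.2.2.2

lemma expect_probePmf (w₀ w₁ : 𝒲) (g : Bool → Bool → ℝ) (h : 𝒳 × 𝒮 → ℝ) (k : 𝒱 → ℝ) :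
    expect (probePmf P Γ w₀ w₁) (fun ω => g ω.1 ω.2.1 * (h ω.2.2.1 * k ω.2.2.2))
      = 4⁻¹ * (∑ s, P s * h s) * (g true true * ∑ v, Γ w₁ v * k v +
        (g true false + g false true + g false false) * ∑ v, Γ w₀ v * k v) := by
  have e : ∀ (c : ℝ) (w : 𝒲), ∑ s : 𝒳 × 𝒮, ∑ v, 4⁻¹ * P s * Γ w v * (c * (h s * k v))
      = 4⁻¹ * (∑ s, P s * h s) * (c * ∑ v, Γ w v * k v) := by
    intro c w
    rw [mul_assoc, Finset.mul_sum, Finset.sum_mul, Finset.mul_sum]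
    refine Finset.sum_congr rfl fun s _ => ?_
    rw [Finset.mul_sum, Finset.mul_sum]
    refine Finset.sum_congr rfl fun v _ => ?_
    ring
  have e2 : expect (probePmf P Γ w₀ w₁) (fun ω => g ω.1 ω.2.1 * (h ω.2.2.1 * k ω.2.2.2))
      = ∑ a, ∑ b, ∑ s : 𝒳 × 𝒮, ∑ v, 4⁻¹ * P s * Γ (bif a && b then w₁ else w₀) v *
        (g a b * (h s * k v)) := by
    simp only [expect, probePmf, Fintype.sum_prod_type]
  rw [e2]
  simp only [e, Fintype.sum_bool, Bool.and_true, Bool.and_false, cond_true,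
    cond_false]
  ring

/-- The model in which the auxiliary variables are independent of the sources and probe the
channel. -/
noncomputable def probe (hP : P ∈ stdSimplex ℝ (𝒳 × 𝒮)) (hΓ : ∀ w, Γ w ∈ stdSimplex ℝ 𝒱)
    (w₀ w₁ : 𝒲) : HybridModel P Γ (Bool × Bool × (𝒳 × 𝒮) × 𝒱) Bool Bool where
  Q := probePmf P Γ w₀ w₁
  U₀ ω := ω.1
  U₁ ω := ω.2.1
  X ω := ω.2.2.1.1
  S ω := ω.2.2.1.2
  V ω := ω.2.2.2
  -- A conjunction lets each bit be felt: with the first bit unset the input is fixed, and with it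
  -- set the second bit selects the input. The parity of the bits would make the output independent
  -- of the first one.
  f u₀ u₁ _ := bif u₀ && u₁ then w₁ else w₀
  mem := by
    refine ⟨fun ω => mul_nonneg (mul_nonneg (by norm_num) (hP.1 _)) ((hΓ _).1 _), ?_⟩
    have := expect_probePmf (P := P) (Γ := Γ) w₀ w₁ (fun _ _ => 1) (fun _ => 1) fun _ => 1
    simp only [expect, mul_one, (hΓ _).2, hP.2] at this
    rw [this]; norm_num
  source x s := by
    have := expect_probePmf (P := P) (Γ := Γ) w₀ w₁ (fun _ _ => 1)
      (fun p => ind (p = (x, s))) fun _ => 1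
    simp only [mul_one, one_mul, (hΓ _).2] at this
    rw [law_eq_expect]
    simp only [Prod.mk.eta]
    rw [this]
    simp only [mul_comm (P _), ind_congr (eq_comm (b := (x, s)))]
    rw [sum_ind_eq (x, s) P]
    ring
  factor := by
    intro u₀ u₁ x s v
    have h1 := expect_probePmf (P := P) (Γ := Γ) w₀ w₁
      (fun a b => ind (a = u₀) * ind (b = u₁)) (fun p => ind ((x, s) = p)) fun v' => ind (v = v')
    have h2 := expect_probePmf (P := P) (Γ := Γ) w₀ w₁
      (fun a b => ind (a = u₀) * ind (b = u₁)) (fun p => ind (p.1 = x)) fun _ => 1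
    have e1 : law (probePmf P Γ w₀ w₁)
        (fun ω => ((ω.1, ω.2.1, ω.2.2.1.1, ω.2.2.1.2), ω.2.2.2)) ((u₀, u₁, x, s), v)
        = 4⁻¹ * P (x, s) * Γ (bif u₀ && u₁ then w₁ else w₀) v := by
      rw [law_eq_expect]
      refine (expect_congr fun ω _ => ?_).trans (h1.trans ?_)
      · rw [← ind_and, ← ind_and, ← ind_and]
        exact ind_congr (by simp only [Prod.ext_iff]; tauto)
      · simp only [mul_comm (P _), mul_comm (Γ _ _), sum_ind_eq]
        cases u₀ <;> cases u₁ <;> simp [ind]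
    have e2 : law (probePmf P Γ w₀ w₁) (fun ω => (ω.1, ω.2.1, ω.2.2.1.1)) (u₀, u₁, x)
        = 4⁻¹ * ∑ s', P (x, s') := by
      rw [law_eq_expect]
      refine (expect_congr fun ω _ => ?_).trans (h2.trans ?_)
      · rw [mul_one, ← ind_and, ← ind_and]
        exact ind_congr (by simp only [Prod.mk.injEq]; tauto)
      · have e3 : ∑ p : 𝒳 × 𝒮, P p * ind (p.1 = x) = ∑ s', P (x, s') := by
          rw [Fintype.sum_prod_type, ← sum_ind_eq x fun x' => ∑ s', P (x', s')]
          refine Finset.sum_congr rfl fun x' _ => ?_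
          rw [Finset.mul_sum]
          refine Finset.sum_congr rfl fun s' _ => ?_
          rw [mul_comm, ind_congr (eq_comm (a := x'))]
        rw [e3]
        simp only [mul_one, (hΓ _).2]
        cases u₀ <;> cases u₁ <;> simp [ind]
    rw [e1, e2]
    by_cases h0 : ∑ s', P (x, s') = 0
    · have : P (x, s) = 0 := (Finset.sum_eq_zero_iff_of_nonneg fun s' _ => hP.1 (x, s')).1 h0 s
        (Finset.mem_univ s)
      rw [this]; simp
    · field_simp

end Probe

end HybridModel

/-! ### Invariance of information under relabelling -/

section Injective

variable {Ω α α' β γ γ' : Type*} [Fintype Ω] [Fintype α] [Fintype α'] [Fintype β] [Fintype γ]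
  [Fintype γ'] {Q : Ω → ℝ}

omit [Fintype γ] [Fintype γ'] in
lemma mutualInfo_comp_left (Q : Ω → ℝ) (A : Ω → α) (B : Ω → β) {φ : α → α'}
    (hφ : Function.Injective φ) : mutualInfo Q (fun ω => φ (A ω)) B = mutualInfo Q A B := by
  rw [mutualInfo_eq_expect, mutualInfo_eq_expect]
  congr 1; ext ω
  rw [law_congr Q (A := fun ω => (φ (A ω), B ω)) (B := fun ω => (A ω, B ω)) (b := (A ω, B ω))
      fun ω' => by simp only [Prod.mk.injEq, hφ.eq_iff],
    law_congr Q (A := fun ω => φ (A ω)) (B := A) (b := A ω) fun ω' => hφ.eq_iff]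

lemma condMutualInfo_comp (Q : Ω → ℝ) (A : Ω → α) (B : Ω → β) (C : Ω → γ) {φ : α → α'}
    {ψ : γ → γ'} (hφ : Function.Injective φ) (hψ : Function.Injective ψ) :
    condMutualInfo Q (fun ω => φ (A ω)) B (fun ω => ψ (C ω)) = condMutualInfo Q A B C := by
  rw [condMutualInfo_eq_expect, condMutualInfo_eq_expect]
  congr 1; ext ω
  rw [law_congr Q (A := fun ω => (φ (A ω), B ω, ψ (C ω))) (B := fun ω => (A ω, B ω, C ω))
      (b := (A ω, B ω, C ω)) fun ω' => by simp only [Prod.mk.injEq, hφ.eq_iff, hψ.eq_iff],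
    law_congr Q (A := fun ω => ψ (C ω)) (B := C) (b := C ω) fun ω' => hψ.eq_iff,
    law_congr Q (A := fun ω => (φ (A ω), ψ (C ω))) (B := fun ω => (A ω, C ω))
      (b := (A ω, C ω)) fun ω' => by simp only [Prod.mk.injEq, hφ.eq_iff, hψ.eq_iff],
    law_congr Q (A := fun ω => (B ω, ψ (C ω))) (B := fun ω => (B ω, C ω))
      (b := (B ω, C ω)) fun ω' => by simp only [Prod.mk.injEq, hψ.eq_iff]]

end Injective

namespace HybridModel

/-! ### Laws and source informations of the probing model -/

section ProbeInfo

variable {𝒳 𝒮 𝒲 𝒱 : Type*} [Fintype 𝒳] [Fintype 𝒮] [Fintype 𝒱]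
  {P : 𝒳 × 𝒮 → ℝ} {Γ : 𝒲 → 𝒱 → ℝ}

/-- A master formula: the marginals needed below follow by making some of `A`, `B`, `C` trivial. Of
the four equally likely pairs of bits, one selects `w₁` and three select `w₀`. -/
lemma law_probe {Δ α β γ : Type*} (hP : P ∈ stdSimplex ℝ (𝒳 × 𝒮))
    (hΓ : ∀ w, Γ w ∈ stdSimplex ℝ 𝒱) (w₀ w₁ : 𝒲) (A : Bool → Bool → α) (B : 𝒳 × 𝒮 → β)
    (C : 𝒱 → γ) (a : α) (b : β) (c : γ) (D : Bool × Bool × (𝒳 × 𝒮) × 𝒱 → Δ) (d : Δ)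
    (h : ∀ ω, D ω = d ↔ A ω.1 ω.2.1 = a ∧ B ω.2.2.1 = b ∧ C ω.2.2.2 = c) :
    law (probe hP hΓ w₀ w₁).Q D d = 4⁻¹ * (∑ s, P s * ind (B s = b)) *
      (ind (A true true = a) * ∑ v, Γ w₁ v * ind (C v = c) +
        (ind (A true false = a) + ind (A false true = a) + ind (A false false = a)) *
          ∑ v, Γ w₀ v * ind (C v = c)) := by
  rw [← expect_probePmf w₀ w₁ (fun x y => ind (A x y = a)) (fun s => ind (B s = b))
    fun v => ind (C v = c), law_eq_expect]
  refine expect_congr fun ω _ => ?_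
  rw [← ind_and, ← ind_and]
  exact ind_congr (h ω)

lemma law_probe_bits {Δ α : Type*} (hP : P ∈ stdSimplex ℝ (𝒳 × 𝒮))
    (hΓ : ∀ w, Γ w ∈ stdSimplex ℝ 𝒱) (w₀ w₁ : 𝒲) (A : Bool → Bool → α) (a : α)
    (D : Bool × Bool × (𝒳 × 𝒮) × 𝒱 → Δ) (d : Δ) (h : ∀ ω, D ω = d ↔ A ω.1 ω.2.1 = a) :
    law (probe hP hΓ w₀ w₁).Q D d = 4⁻¹ * (ind (A true true = a) +
        (ind (A true false = a) + ind (A false true = a) + ind (A false false = a))) := by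
  rw [law_probe hP hΓ w₀ w₁ A (fun _ => ()) (fun _ => ()) a () () D d (by simpa using h)]
  simp [ind_of, (hΓ _).2, hP.2]

lemma law_probe_source {Δ α β : Type*} (hP : P ∈ stdSimplex ℝ (𝒳 × 𝒮))
    (hΓ : ∀ w, Γ w ∈ stdSimplex ℝ 𝒱) (w₀ w₁ : 𝒲) (A : Bool → Bool → α) (B : 𝒳 × 𝒮 → β)
    (a : α) (b : β) (D : Bool × Bool × (𝒳 × 𝒮) × 𝒱 → Δ) (d : Δ)
    (h : ∀ ω, D ω = d ↔ A ω.1 ω.2.1 = a ∧ B ω.2.2.1 = b) :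
    law (probe hP hΓ w₀ w₁).Q D d = 4⁻¹ * (∑ s, P s * ind (B s = b)) * (ind (A true true = a) +
        (ind (A true false = a) + ind (A false true = a) + ind (A false false = a))) := by
  rw [law_probe hP hΓ w₀ w₁ A B (fun _ => ()) a b () D d (by simpa using h)]
  simp [ind_of, (hΓ _).2]

/-- The bits are independent of the sources, so probing uses up no covering rate. -/
lemma probe_mutualInfo_X (hP : P ∈ stdSimplex ℝ (𝒳 × 𝒮)) (hΓ : ∀ w, Γ w ∈ stdSimplex ℝ 𝒱)
    (w₀ w₁ : 𝒲) :
    mutualInfo (probe hP hΓ w₀ w₁).Q (probe hP hΓ w₀ w₁).U₀ (probe hP hΓ w₀ w₁).X = 0 := by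
  refine mutualInfo_eq_zero _ _ _ fun a x => ?_
  rw [law_probe_source hP hΓ w₀ w₁ (fun a' _ => a') (fun s => s.1) a x _ _ fun ω => by
      simp only [Prod.mk.injEq, probe],
    law_probe_bits hP hΓ w₀ w₁ (fun a' _ => a') a _ _ fun ω => by simp only [probe],
    law_probe_source hP hΓ w₀ w₁ (fun _ _ => ()) (fun s => s.1) () x _ _ fun ω => by
      simp only [probe, true_and]]
  cases a <;> simp [ind] <;> ring

lemma probe_condMutualInfo_X (hP : P ∈ stdSimplex ℝ (𝒳 × 𝒮))
    (hΓ : ∀ w, Γ w ∈ stdSimplex ℝ 𝒱) (w₀ w₁ : 𝒲) :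
    condMutualInfo (probe hP hΓ w₀ w₁).Q (probe hP hΓ w₀ w₁).U₁ (probe hP hΓ w₀ w₁).X
      (probe hP hΓ w₀ w₁).U₀ = 0 := by
  refine condMutualInfo_eq_zero _ _ _ _ fun b x a => ?_
  rw [law_probe_source hP hΓ w₀ w₁ (fun a' b' => (a', b')) (fun s => s.1) (a, b) x _ _ fun ω => by
      simp only [Prod.mk.injEq, probe]; tauto,
    law_probe_bits hP hΓ w₀ w₁ (fun a' _ => a') a _ _ fun ω => by simp only [probe],
    law_probe_bits hP hΓ w₀ w₁ (fun a' b' => (a', b')) (a, b) _ _ fun ω => by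
      simp only [Prod.mk.injEq, probe]; tauto,
    law_probe_source hP hΓ w₀ w₁ (fun a' _ => a') (fun s => s.1) a x _ _ fun ω => by
      simp only [Prod.mk.injEq, probe]; tauto]
  cases a <;> cases b <;> simp [ind] <;> ring

end ProbeInfo

/-! ### Making the decodability constraints strict -/

section Strict

variable {𝒳 𝒴₁ 𝒴₂ 𝒵₁ 𝒲 𝒱₁ 𝒱₂ Ω 𝒰₀ 𝒰₁ : Type*} [Fintype 𝒳] [Fintype 𝒴₁] [Fintype 𝒴₂]
  [Fintype 𝒵₁] [Fintype 𝒱₁] [Fintype 𝒱₂] [Fintype Ω] [Fintype 𝒰₀] [Fintype 𝒰₁]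
  {P : 𝒳 × 𝒴₁ × 𝒴₂ × 𝒵₁ → ℝ} {Γ : 𝒲 → 𝒱₁ × 𝒱₂ → ℝ}

/-- Given the first bit, V₂ comes from `w₀` or from the even mixture of `w₀` and `w₁`. Independence
would equate these laws at `v₂`, hence the two output probabilities there. -/
lemma probe_mutualInfo_V₂ (hP : P ∈ stdSimplex ℝ (𝒳 × 𝒴₁ × 𝒴₂ × 𝒵₁))
    (hΓ : ∀ w, Γ w ∈ stdSimplex ℝ (𝒱₁ × 𝒱₂)) {w₀ w₁ : 𝒲} {v₂ : 𝒱₂}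
    (h : ∑ v₁, Γ w₀ (v₁, v₂) ≠ ∑ v₁, Γ w₁ (v₁, v₂)) :
    0 < mutualInfo (probe hP hΓ w₀ w₁).Q (probe hP hΓ w₀ w₁).U₀ (probe hP hΓ w₀ w₁).V₂ := by
  have h0 := mutualInfo_nonneg (probe hP hΓ w₀ w₁).mem (probe hP hΓ w₀ w₁).U₀
    (probe hP hΓ w₀ w₁).V₂
  refine h0.1.lt_of_ne' fun hz => h ?_
  have e : ∀ w, ∑ v, Γ w v * ind (v.2 = v₂) = ∑ v₁, Γ w (v₁, v₂) := fun w => by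
    rw [Fintype.sum_prod_type]
    refine Finset.sum_congr rfl fun v₁ _ => ?_
    simp only [mul_comm (Γ _ _), ind_congr (eq_comm (b := v₂))]
    exact sum_ind_eq v₂ fun v => Γ w (v₁, v)
  have h1 := h0.2 hz true v₂
  have h2 := h0.2 hz false v₂
  have hl : ∀ a, law (probe hP hΓ w₀ w₁).Q (fun ω => ((probe hP hΓ w₀ w₁).U₀ ω,
      (probe hP hΓ w₀ w₁).V₂ ω)) (a, v₂) = _ := fun a =>
    law_probe hP hΓ w₀ w₁ (fun a' _ => a') (fun _ => ()) (fun v => v.2) a () v₂ _ _ fun ω => by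
      simp only [Prod.mk.injEq, probe, V₂, true_and]
  have hu : ∀ a, law (probe hP hΓ w₀ w₁).Q (probe hP hΓ w₀ w₁).U₀ a = _ := fun a =>
    law_probe_bits hP hΓ w₀ w₁ (fun a' _ => a') a _ _ fun ω => by simp only [probe]
  rw [hl, hu] at h1 h2
  simp only [e] at h1 h2
  simp [ind, hP.2] at h1 h2
  linarith

/-- Once the first bit is set, the second selects the input. Zero information would equate the
output probabilities at `v₁`, as is seen by evaluating at some `z` of positive probability. -/
lemma probe_condMutualInfo_B₁ (hP : P ∈ stdSimplex ℝ (𝒳 × 𝒴₁ × 𝒴₂ × 𝒵₁))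
    (hΓ : ∀ w, Γ w ∈ stdSimplex ℝ (𝒱₁ × 𝒱₂)) {w₀ w₁ : 𝒲} {v₁ : 𝒱₁}
    (h : ∑ v₂, Γ w₀ (v₁, v₂) ≠ ∑ v₂, Γ w₁ (v₁, v₂)) :
    0 < condMutualInfo (probe hP hΓ w₀ w₁).Q (probe hP hΓ w₀ w₁).U₁ (probe hP hΓ w₀ w₁).B₁
      (probe hP hΓ w₀ w₁).U₀ := by
  have h0 := condMutualInfo_nonneg (probe hP hΓ w₀ w₁).mem (probe hP hΓ w₀ w₁).U₁
    (probe hP hΓ w₀ w₁).B₁ (probe hP hΓ w₀ w₁).U₀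
  refine h0.1.lt_of_ne' fun hz => h ?_
  have e : ∀ w, ∑ v, Γ w v * ind (v.1 = v₁) = ∑ v₂, Γ w (v₁, v₂) := fun w => by
    rw [Fintype.sum_prod_type, Finset.sum_comm]
    refine Finset.sum_congr rfl fun v₂ _ => ?_
    simp only [mul_comm (Γ _ _), ind_congr (eq_comm (b := v₁))]
    exact sum_ind_eq v₁ fun v => Γ w (v, v₂)
  obtain ⟨s, hs⟩ : ∃ s, P s ≠ 0 := by
    by_contra! hall
    simpa [hall] using hP.2
  set z := s.2.2.2 with hzdef
  have hpos : 0 < ∑ s', P s' * ind (s'.2.2.2 = z) := by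
    refine Finset.sum_pos' (fun s' _ => mul_nonneg (hP.1 s') (ind_nonneg _))
      ⟨s, Finset.mem_univ s, ?_⟩
    rw [ind_of hzdef.symm, mul_one]
    exact (hP.1 s).lt_of_ne' hs
  have h1 := h0.2 hz true (v₁, z) true
  rw [law_probe hP hΓ w₀ w₁ (fun a' b' => (a', b')) (fun s => s.2.2.2) (fun v => v.1) (true, true)
      z v₁ _ _ fun ω => by simp only [Prod.mk.injEq, probe, B₁]; tauto,
    law_probe_bits hP hΓ w₀ w₁ (fun a' _ => a') true _ _ fun ω => by simp only [probe],
    law_probe_bits hP hΓ w₀ w₁ (fun a' b' => (a', b')) (true, true) _ _ fun ω => by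
      simp only [Prod.mk.injEq, probe]; tauto,
    law_probe hP hΓ w₀ w₁ (fun a' _ => a') (fun s => s.2.2.2) (fun v => v.1) true
      z v₁ _ _ fun ω => by simp only [Prod.mk.injEq, probe, B₁]; tauto] at h1
  simp only [e] at h1
  simp only [ind_of, ind_of_not, Prod.mk.injEq, and_true, and_false, reduceCtorEq,
    not_false_eq_true] at h1
  have h2 : (∑ s', P s' * ind (s'.2.2.2 = z)) * (∑ v₂, Γ w₁ (v₁, v₂) - ∑ v₂, Γ w₀ (v₁, v₂)) = 0 := by
    linarith
  have h3 := (mul_eq_zero.1 h2).resolve_left hpos.ne'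
  linarith

omit [Fintype 𝒳] [Fintype 𝒱₁] [Fintype 𝒱₂] in
/-- Chain rule for the pair of auxiliary variables. -/
lemma mutualInfo_U (M : HybridModel P Γ Ω 𝒰₀ 𝒰₁) {β : Type*} [Fintype β] (B : Ω → β) :
    mutualInfo M.Q M.U B = mutualInfo M.Q M.U₀ B + condMutualInfo M.Q M.U₁ B M.U₀ := by
  rw [← mutualInfo_chain M.mem]
  exact (mutualInfo_comp_left M.Q M.U B (φ := Prod.swap) Prod.swap_injective).symm

lemma mutualInfo_U₀_X_le (M : HybridModel P Γ Ω 𝒰₀ 𝒰₁) (hΓ : ∀ w, Γ w ∈ stdSimplex ℝ (𝒱₁ × 𝒱₂)) :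
    mutualInfo M.Q M.U₀ M.Y₂ ≤ mutualInfo M.Q M.U₀ M.X :=
  mutualInfo_le_of_markov M.mem (M.isMarkov_source hΓ (fun u => u.1) fun s => s.2.1)

/-- The chain rule gives I(U;Y₁|Z₁) = I(U;Y₁,Z₁) - I(U;Z₁), and data processing along U → X →
(Y₁,Z₁) bounds the first term. -/
lemma condMutualInfo_Y₁_le (M : HybridModel P Γ Ω 𝒰₀ 𝒰₁)
    (hΓ : ∀ w, Γ w ∈ stdSimplex ℝ (𝒱₁ × 𝒱₂)) :
    condMutualInfo M.Q M.U M.Y₁ M.Z₁ ≤ mutualInfo M.Q M.U M.X - mutualInfo M.Q M.U M.Z₁ := by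
  have h1 := mutualInfo_le_of_markov M.mem (M.isMarkov_source hΓ (fun u => u)
    fun s => (s.1, s.2.2))
  have h2 := mutualInfo_chain_right M.mem M.U M.Y₁ M.Z₁
  have h3 : mutualInfo M.Q M.U (fun ω => (M.Y₁ ω, M.Z₁ ω)) ≤ mutualInfo M.Q M.U M.X := h1
  linarith

omit [Fintype 𝒱₁] [Fintype 𝒱₂] [Fintype 𝒰₀] [Fintype 𝒰₁] in
lemma law_source_eq {Ω' 𝒰₀' 𝒰₁' β : Type*} [Fintype Ω'] (M : HybridModel P Γ Ω 𝒰₀ 𝒰₁)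
    (N : HybridModel P Γ Ω' 𝒰₀' 𝒰₁') (g : 𝒳 × 𝒴₁ × 𝒴₂ × 𝒵₁ → β) (b : β) :
    law M.Q (fun ω => g (M.X ω, M.S ω)) b = law N.Q (fun ω => g (N.X ω, N.S ω)) b := by
  rw [← law_law M.Q (fun ω => (M.X ω, M.S ω)) g, ← law_law N.Q (fun ω => (N.X ω, N.S ω)) g]
  congr 1
  ext ⟨x, s⟩
  rw [M.source, N.source]

set_option maxHeartbeats 800000 in
-- Mix `M` and the probing model with weights 1 - η and η. The source sides of the constraints
-- shrink exactly by the factor 1 - η, the probe contributing zero. The channel sides retain at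
-- least that fraction and gain η times the probe's information. The exponents lose at most the
-- fraction η.
lemma exists_strict (M : HybridModel P Γ Ω 𝒰₀ 𝒰₁) (hP : P ∈ stdSimplex ℝ (𝒳 × 𝒴₁ × 𝒴₂ × 𝒵₁))
    (hΓ : ∀ w, Γ w ∈ stdSimplex ℝ (𝒱₁ × 𝒱₂)) (w₀ w₁ : 𝒲)
    (hc₁ : condMutualInfo M.Q M.U₁ M.X M.U₀ ≤ condMutualInfo M.Q M.U₁ M.B₁ M.U₀)
    (hc₀ : mutualInfo M.Q M.U₀ M.X ≤ mutualInfo M.Q M.U₀ M.V₂)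
    {v₁ : 𝒱₁} (h₁ : ∑ v₂, Γ w₀ (v₁, v₂) ≠ ∑ v₂, Γ w₁ (v₁, v₂)) {δ : ℝ} (hδ : 0 < δ) :
    ∃ M' : HybridModel P Γ (Ω ⊕ (Bool × Bool × (𝒳 × 𝒴₁ × 𝒴₂ × 𝒵₁) × 𝒱₁ × 𝒱₂)) (𝒰₀ ⊕ Bool)
        (𝒰₁ ⊕ Bool),
      condMutualInfo M'.Q M'.U₁ M'.X M'.U₀ < condMutualInfo M'.Q M'.U₁ M'.B₁ M'.U₀ ∧
      mutualInfo M'.Q M'.U₀ M'.X ≤ mutualInfo M'.Q M'.U₀ M'.V₂ ∧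
      ((∃ v₂, ∑ v₁, Γ w₀ (v₁, v₂) ≠ ∑ v₁, Γ w₁ (v₁, v₂)) →
        mutualInfo M'.Q M'.U₀ M'.X < mutualInfo M'.Q M'.U₀ M'.V₂) ∧
      condMutualInfo M.Q M.U M.Y₁ M.Z₁ - δ < condMutualInfo M'.Q M'.U M'.Y₁ M'.Z₁ ∧
      mutualInfo M.Q M.U₀ M.Y₂ - δ < mutualInfo M'.Q M'.U₀ M'.Y₂ := by
  have i₁ := (condMutualInfo_nonneg M.mem M.U M.Y₁ M.Z₁).1
  have i₂ := (mutualInfo_nonneg M.mem M.U₀ M.Y₂).1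
  set I₁ := condMutualInfo M.Q M.U M.Y₁ M.Z₁ with hI₁
  set I₂ := mutualInfo M.Q M.U₀ M.Y₂ with hI₂
  -- Chosen so that 0 < η < 1 and η (I₁ + I₂) < δ.
  set η := δ / (δ + I₁ + I₂ + 1) with hη
  have hden : 0 < δ + I₁ + I₂ + 1 := by linarith
  have hη0 : 0 < η := by positivity
  have hη1 : η < 1 := by rw [hη, div_lt_one hden]; linarith
  have hηI : η * (I₁ + I₂) < δ := by
    rw [hη, div_mul_eq_mul_div, div_lt_iff₀ hden]
    nlinarith
  set N := probe hP hΓ w₀ w₁ with hN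
  have l0 : (0 : ℝ) < 1 - η := by linarith
  have l1 : 1 - η < 1 := by linarith
  set M' := M.mix N w₀ (1 - η) l0.le l1.le with hM'
  have hU₀ : ∀ ω ω', M'.U₀ (.inl ω) ≠ M'.U₀ (.inr ω') := fun ω ω' h => by
    cases h
  have hU : ∀ ω ω', M'.U (.inl ω) ≠ M'.U (.inr ω') := fun ω ω' h => hU₀ ω ω' (Prod.mk.inj h).1
  have a1 : condMutualInfo M'.Q M'.U₁ M'.X M'.U₀
      = (1 - η) * condMutualInfo M.Q M.U₁ M.X M.U₀ := by
    refine (condMutualInfo_mixPmf l0 l1 M'.U₁ M'.X M'.U₀ hU₀).trans ?_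
    have e1 := condMutualInfo_comp M.Q M.U₁ M.X M.U₀ (Sum.inl_injective (β := Bool))
      (Sum.inl_injective (β := Bool))
    have e2 := condMutualInfo_comp N.Q N.U₁ N.X N.U₀ (Sum.inr_injective (α := 𝒰₁))
      (Sum.inr_injective (α := 𝒰₀))
    have e3 : condMutualInfo N.Q N.U₁ N.X N.U₀ = 0 := probe_condMutualInfo_X hP hΓ w₀ w₁
    rw [e3] at e2
    refine (congrArg₂ (fun x y => (1 - η) * x + (1 - (1 - η)) * y) e1 e2).trans ?_
    ring
  have a2 : condMutualInfo M'.Q M'.U₁ M'.B₁ M'.U₀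
      = (1 - η) * condMutualInfo M.Q M.U₁ M.B₁ M.U₀
        + (1 - (1 - η)) * condMutualInfo N.Q N.U₁ N.B₁ N.U₀ := by
    refine (condMutualInfo_mixPmf l0 l1 M'.U₁ M'.B₁ M'.U₀ hU₀).trans ?_
    have e1 := condMutualInfo_comp M.Q M.U₁ M.B₁ M.U₀ (Sum.inl_injective (β := Bool))
      (Sum.inl_injective (β := Bool))
    have e2 := condMutualInfo_comp N.Q N.U₁ N.B₁ N.U₀ (Sum.inr_injective (α := 𝒰₁))
      (Sum.inr_injective (α := 𝒰₀))
    exact congrArg₂ (fun x y => (1 - η) * x + (1 - (1 - η)) * y) e1 e2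
  have a3 : mutualInfo M'.Q M'.U₀ M'.X = (1 - η) * mutualInfo M.Q M.U₀ M.X := by
    refine (mutualInfo_mixPmf_of_law_eq M.mem N.mem l0 l1 M'.U₀ M'.X hU₀
      (law_source_eq M N fun p => p.1)).trans ?_
    have e1 := mutualInfo_comp_left M.Q M.U₀ M.X (Sum.inl_injective (β := Bool))
    have e2 := mutualInfo_comp_left N.Q N.U₀ N.X (Sum.inr_injective (α := 𝒰₀))
    have e3 : mutualInfo N.Q N.U₀ N.X = 0 := probe_mutualInfo_X hP hΓ w₀ w₁
    rw [e3] at e2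
    refine (congrArg₂ (fun x y => (1 - η) * x + (1 - (1 - η)) * y) e1 e2).trans ?_
    ring
  have a4 : (1 - η) * mutualInfo M.Q M.U₀ M.V₂ + (1 - (1 - η)) * mutualInfo N.Q N.U₀ N.V₂
      ≤ mutualInfo M'.Q M'.U₀ M'.V₂ := by
    refine le_of_eq_of_le ?_ (le_mutualInfo_mixPmf M.mem N.mem l0 l1 M'.U₀ M'.V₂ hU₀)
    have e1 := mutualInfo_comp_left M.Q M.U₀ M.V₂ (Sum.inl_injective (β := Bool))
    have e2 := mutualInfo_comp_left N.Q N.U₀ N.V₂ (Sum.inr_injective (α := 𝒰₀))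
    exact (congrArg₂ (fun x y => (1 - η) * x + (1 - (1 - η)) * y) e1 e2).symm
  have a5 : (1 - η) * I₂ ≤ mutualInfo M'.Q M'.U₀ M'.Y₂ := by
    have e := mutualInfo_mixPmf_of_law_eq M.mem N.mem l0 l1 M'.U₀ M'.Y₂ hU₀
      (law_source_eq M N fun p => p.2.2.1)
    have e1 := mutualInfo_comp_left M.Q M.U₀ M.Y₂ (Sum.inl_injective (β := Bool))
    have e2 := (mutualInfo_nonneg N.mem (fun ω => M'.U₀ (.inr ω)) fun ω => M'.Y₂ (.inr ω)).1
    have e3 : mutualInfo M'.Q M'.U₀ M'.Y₂ = (1 - η) * I₂ + _ :=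
      e.trans (congrArg (fun x => (1 - η) * x + _) e1)
    rw [e3]
    nlinarith
  have a6 : (1 - η) * I₁ ≤ condMutualInfo M'.Q M'.U M'.Y₁ M'.Z₁ := by
    have hinj : Function.Injective fun u : 𝒰₀ × 𝒰₁ =>
        ((.inl u.1, .inl u.2) : (𝒰₀ ⊕ Bool) × (𝒰₁ ⊕ Bool)) := fun u u' h => by
      simp only [Prod.mk.injEq, Sum.inl.injEq] at h
      exact Prod.ext h.1 h.2
    have e1 := condMutualInfo_comp M.Q M.U M.Y₁ M.Z₁ hinj Function.injective_id
    have e := le_condMutualInfo_mixPmf M.mem N.mem l0 l1 M'.U M'.Y₁ M'.Z₁ hU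
      (law_source_eq M N fun p => (p.2.1, p.2.2.2)) (law_source_eq M N fun p => p.2.2.2)
    exact le_of_eq_of_le (congrArg (fun x => (1 - η) * x) e1.symm) e
  have p1 : 0 < condMutualInfo N.Q N.U₁ N.B₁ N.U₀ := probe_condMutualInfo_B₁ hP hΓ h₁
  have p2 : 0 ≤ mutualInfo N.Q N.U₀ N.V₂ := (mutualInfo_nonneg N.mem _ _).1
  refine ⟨M', ?_, ?_, ?_, ?_, ?_⟩
  · rw [a1, a2]
    nlinarith [mul_le_mul_of_nonneg_left hc₁ l0.le, mul_pos hη0 p1]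
  · rw [a3]
    nlinarith [mul_le_mul_of_nonneg_left hc₀ l0.le, mul_nonneg hη0.le p2]
  · rintro ⟨v₂, h₂⟩
    have p3 : 0 < mutualInfo N.Q N.U₀ N.V₂ := probe_mutualInfo_V₂ hP hΓ h₂
    rw [a3]
    nlinarith [mul_le_mul_of_nonneg_left hc₀ l0.le, mul_pos hη0 p3]
  · nlinarith [mul_nonneg hη0.le i₂]
  · nlinarith [mul_nonneg hη0.le i₁]

end Strict

end HybridModel

/-! ### Blocks of i.i.d. random variables -/

section Block

variable {Ω α β γ δ : Type*} [Fintype Ω] {n : ℕ}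

/-- The block of copies of the random variable `A`. -/
def block (A : Ω → α) (ω : Fin n → Ω) : Fin n → α := fun i => A (ω i)

lemma law_block (Q : Ω → ℝ) (A : Ω → α) (a : Fin n → α) :
    law (prodPmf Q) (block A) a = ∏ i, law Q A (a i) := law_prodPmf Q A a

lemma law_block₂ (Q : Ω → ℝ) (A : Ω → α) (B : Ω → β) (a : Fin n → α) (b : Fin n → β) :
    law (prodPmf Q) (fun ω : Fin n → Ω => (block A ω, block B ω)) (a, b)
      = ∏ i, law Q (fun ω => (A ω, B ω)) (a i, b i) := by
  rw [← law_prodPmf Q (fun ω => (A ω, B ω)) fun i => (a i, b i)]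
  exact law_congr _ fun ω => by
    simp only [Prod.mk.injEq, funext_iff, forall_and, block]

lemma law_block₃ (Q : Ω → ℝ) (A : Ω → α) (B : Ω → β) (C : Ω → γ) (a : Fin n → α) (b : Fin n → β)
    (c : Fin n → γ) :
    law (prodPmf Q) (fun ω : Fin n → Ω => (block A ω, block B ω, block C ω)) (a, b, c)
      = ∏ i, law Q (fun ω => (A ω, B ω, C ω)) (a i, b i, c i) := by
  rw [← law_prodPmf Q (fun ω => (A ω, B ω, C ω)) fun i => (a i, b i, c i)]
  exact law_congr _ fun ω => by
    simp only [Prod.mk.injEq, funext_iff, forall_and, block]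

lemma ind_not_and_le (p q : Prop) : ind (¬ (p ∧ q)) ≤ ind (¬ p) + ind (¬ q) := by
  by_cases hp : p <;> by_cases hq : q <;> simp [ind, hp, hq]

variable [Fintype α] [Fintype β] [Fintype γ] {Q : Ω → ℝ}

omit [Fintype γ] in
/-- The likelihood ratio for `A` and `B` exceeds `2 ^ (n R)` with high probability. -/
lemma tendsto_ratio (hQ : Q ∈ stdSimplex ℝ Ω) (A : Ω → α) (B : Ω → β) {R : ℝ}
    (hR : R < mutualInfo Q A B) :
    Tendsto (fun n : ℕ => expect (prodPmf Q) fun ω : Fin n → Ω => ind (¬ (2 : ℝ) ^ (n * R) *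
      (law (prodPmf Q) (block A) (block A ω) * law (prodPmf Q) (block B) (block B ω))
      ≤ law (prodPmf Q) (fun ω : Fin n → Ω => (block A ω, block B ω)) (block A ω, block B ω)))
      atTop (𝓝 0) := by
  rw [mutualInfo_eq_expect] at hR
  have h := tendsto_le_likelihood hQ
    (a := fun ω => law Q (fun ω => (A ω, B ω)) (A ω, B ω))
    (b := fun ω => law Q A (A ω) * law Q B (B ω))
    (fun ω h => law_pos hQ.1 (fun ω => (A ω, B ω)) h)
    (fun ω h => mul_pos (law_pos hQ.1 A h) (law_pos hQ.1 B h)) hR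
  simpa only [law_block, law_block₂, Finset.prod_mul_distrib, block] using h

/-- The conditional likelihood ratio for `A` and `B` given `C` exceeds `2 ^ (n R)` with high
probability. -/
lemma tendsto_cond_ratio (hQ : Q ∈ stdSimplex ℝ Ω) (A : Ω → α) (B : Ω → β) (C : Ω → γ) {R : ℝ}
    (hR : R < condMutualInfo Q A B C) :
    Tendsto (fun n : ℕ => expect (prodPmf Q) fun ω : Fin n → Ω => ind (¬ (2 : ℝ) ^ (n * R) *
      (law (prodPmf Q) (fun ω : Fin n → Ω => (block C ω, block A ω)) (block C ω, block A ω) *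
        law (prodPmf Q) (fun ω : Fin n → Ω => (block C ω, block B ω)) (block C ω, block B ω))
      ≤ law (prodPmf Q) (fun ω : Fin n → Ω => (block C ω, block A ω, block B ω))
          (block C ω, block A ω, block B ω) * law (prodPmf Q) (block C) (block C ω)))
      atTop (𝓝 0) := by
  have hR' : R < expect Q fun ω => Real.logb 2
      ((law Q (fun ω => (C ω, A ω, B ω)) (C ω, A ω, B ω) * law Q C (C ω)) /
        (law Q (fun ω => (C ω, A ω)) (C ω, A ω) * law Q (fun ω => (C ω, B ω)) (C ω, B ω))) := by
    rw [condMutualInfo_eq_expect] at hR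
    refine hR.trans_eq (expect_congr fun ω _ => ?_)
    rw [law_congr Q (A := fun ω => (A ω, B ω, C ω)) (B := fun ω => (C ω, A ω, B ω))
        (b := (C ω, A ω, B ω)) fun ω' => by simp only [Prod.mk.injEq]; tauto,
      law_congr Q (A := fun ω => (A ω, C ω)) (B := fun ω => (C ω, A ω))
        (b := (C ω, A ω)) fun ω' => by simp only [Prod.mk.injEq]; tauto,
      law_congr Q (A := fun ω => (B ω, C ω)) (B := fun ω => (C ω, B ω))
        (b := (C ω, B ω)) fun ω' => by simp only [Prod.mk.injEq]; tauto]
  have h := tendsto_le_likelihood hQ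
    (a := fun ω => law Q (fun ω => (C ω, A ω, B ω)) (C ω, A ω, B ω) * law Q C (C ω))
    (b := fun ω => law Q (fun ω => (C ω, A ω)) (C ω, A ω) *
      law Q (fun ω => (C ω, B ω)) (C ω, B ω))
    (fun ω h => mul_pos (law_pos hQ.1 (fun ω => (C ω, A ω, B ω)) h) (law_pos hQ.1 C h))
    (fun ω h => mul_pos (law_pos hQ.1 (fun ω => (C ω, A ω)) h)
      (law_pos hQ.1 (fun ω => (C ω, B ω)) h)) hR'
  simpa only [law_block, law_block₂, law_block₃, Finset.prod_mul_distrib, block] using h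

end Block

/-! ### Rates -/

lemma tendsto_two_rpow {a : ℝ} (ha : a < 0) :
    Tendsto (fun n : ℕ => (2 : ℝ) ^ (n * a)) atTop (𝓝 0) := by
  have h : (fun n : ℕ => (2 : ℝ) ^ (n * a)) = fun n : ℕ => ((2 : ℝ) ^ a) ^ n := by
    ext n
    rw [mul_comm, Real.rpow_mul (by norm_num), Real.rpow_natCast]
  rw [h]
  exact tendsto_pow_atTop_nhds_zero_of_lt_one (by positivity)
    (Real.rpow_lt_one_of_one_lt_of_neg (by norm_num) ha)

/-- The number of messages, minus one, of a code of rate `R` and blocklength `n`. -/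
noncomputable def numMsg (n : ℕ) (R : ℝ) : ℕ := ⌊(2 : ℝ) ^ (n * R)⌋₊

/-- Soft covering needs at least 2^(nR) messages; the extra message compensates for the floor and
keeps the index set nonempty. -/
lemma inv_numMsg_le (n : ℕ) (R : ℝ) :
    (Fintype.card (Fin (numMsg n R + 1)) : ℝ)⁻¹ ≤ (2 : ℝ) ^ (n * -R) := by
  rw [mul_neg, Real.rpow_neg (by norm_num), Fintype.card_fin, Nat.cast_add, Nat.cast_one]
  exact inv_anti₀ (by positivity) (Nat.lt_floor_add_one _).le

/-- Decoding needs an upper bound on the number of messages; the factor 2 absorbs the extra one. -/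
lemma numMsg_le (n : ℕ) {R : ℝ} (hR : 0 ≤ R) :
    (Fintype.card (Fin (numMsg n R + 1)) : ℝ) ≤ 2 * (2 : ℝ) ^ (n * R) := by
  have h1 : (1 : ℝ) ≤ (2 : ℝ) ^ (n * R) :=
    Real.one_le_rpow (by norm_num) (by positivity)
  have h2 : (⌊(2 : ℝ) ^ (n * R)⌋₊ : ℝ) ≤ (2 : ℝ) ^ (n * R) := Nat.floor_le (by positivity)
  rw [Fintype.card_fin, Nat.cast_add, Nat.cast_one, numMsg]
  linarith

/-! ### The single-letter and block kernels of a model -/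

namespace HybridModel

section Kernels

variable {𝒳 𝒮 𝒲 𝒱 Ω 𝒰₀ 𝒰₁ : Type*} [Fintype 𝒳] [Fintype 𝒮] [Fintype 𝒱] [Fintype Ω]
  [Fintype 𝒰₀] [Fintype 𝒰₁] {P : 𝒳 × 𝒮 → ℝ} {Γ : 𝒲 → 𝒱 → ℝ} (M : HybridModel P Γ Ω 𝒰₀ 𝒰₁)

open Classical in
/-- A conditional pmf of `U₁` given `U₀`. -/
noncomputable def p₁ (u : 𝒰₀) (v : 𝒰₁) : ℝ :=
  -- The random codebook needs a pmf for every `u`; at symbols of mass zero any pmf will do.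
  if law M.Q M.U₀ u = 0 then law M.Q M.U₁ v
  else law M.Q (fun ω => (M.U₀ ω, M.U₁ ω)) (u, v) / law M.Q M.U₀ u

/-- The conditional pmf of `X` given `(U₀, U₁)`. -/
noncomputable def px (u : 𝒰₀) (v : 𝒰₁) (x : 𝒳) : ℝ :=
  -- This is zero, hence not normalized, where the pair has no mass. Only its nonnegativity and its
  -- product with the law of the pair matter.
  law M.Q (fun ω => (M.U₀ ω, M.U₁ ω, M.X ω)) (u, v, x) /
    law M.Q (fun ω => (M.U₀ ω, M.U₁ ω)) (u, v)

/-- The conditional pmf of `(S, V)` given `(U₀, U₁, X)`. -/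
noncomputable def outKernel (u : 𝒰₀) (v : 𝒰₁) (x : 𝒳) (o : 𝒮 × 𝒱) : ℝ :=
  P (x, o.1) / (∑ s', P (x, s')) * Γ (M.f u v x) o.2

lemma p₁_mem (u : 𝒰₀) : M.p₁ u ∈ stdSimplex ℝ 𝒰₁ := by
  unfold p₁
  split_ifs with h
  · exact law_mem M.mem M.U₁
  · refine ⟨fun v => div_nonneg (law_nonneg M.mem.1 _ _) (law_nonneg M.mem.1 _ _), ?_⟩
    rw [← Finset.sum_div, sum_law_pair, div_self h]

lemma law_mul_p₁ (u : 𝒰₀) (v : 𝒰₁) :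
    law M.Q M.U₀ u * M.p₁ u v = law M.Q (fun ω => (M.U₀ ω, M.U₁ ω)) (u, v) := by
  unfold p₁
  split_ifs with h
  · rw [h, zero_mul, law_eq_zero_of_imp M.mem.1 (B := M.U₀) (fun ω h => (Prod.mk.inj h).1) h]
  · field_simp

lemma px_nonneg (u : 𝒰₀) (v : 𝒰₁) (x : 𝒳) : 0 ≤ M.px u v x :=
  div_nonneg (law_nonneg M.mem.1 _ _) (law_nonneg M.mem.1 _ _)

lemma law_mul_px (u : 𝒰₀) (v : 𝒰₁) (x : 𝒳) :
    law M.Q (fun ω => (M.U₀ ω, M.U₁ ω)) (u, v) * M.px u v x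
      = law M.Q (fun ω => (M.U₀ ω, M.U₁ ω, M.X ω)) (u, v, x) := by
  unfold px
  by_cases h : law M.Q (fun ω => (M.U₀ ω, M.U₁ ω)) (u, v) = 0
  · rw [h, zero_mul, law_eq_zero_of_imp M.mem.1 (B := fun ω => (M.U₀ ω, M.U₁ ω)) (b := (u, v))
      (fun ω h => by simp only [Prod.mk.injEq] at h ⊢; tauto) h]
  · field_simp

lemma sum_p₁_mul_px (u : 𝒰₀) (x : 𝒳) (hu : law M.Q M.U₀ u ≠ 0) :
    expect (M.p₁ u) (fun v => M.px u v x)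
      = law M.Q (fun ω => (M.U₀ ω, M.X ω)) (u, x) / law M.Q M.U₀ u := by
  rw [eq_div_iff hu, mul_comm, expect, Finset.mul_sum]
  simp only [← mul_assoc, law_mul_p₁, law_mul_px]
  rw [← sum_law_pair M.Q (fun ω => (M.U₀ ω, M.X ω)) M.U₁]
  exact Finset.sum_congr rfl fun v _ => law_congr _ fun ω => by
    simp only [Prod.mk.injEq]; tauto

/-- The joint law of the auxiliary variables and all outputs. -/
lemma law_out (u : 𝒰₀) (v : 𝒰₁) (o : 𝒮 × 𝒱) :
    law M.Q M.U₀ u * M.p₁ u v * ∑ x, M.px u v x * M.outKernel u v x o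
      = law M.Q (fun ω => (M.U₀ ω, M.U₁ ω, M.S ω, M.V ω)) (u, v, o) := by
  rw [law_mul_p₁, Finset.mul_sum,
    ← sum_law_pair M.Q (fun ω => (M.U₀ ω, M.U₁ ω, M.S ω, M.V ω)) M.X]
  refine Finset.sum_congr rfl fun x _ => ?_
  rw [← mul_assoc, law_mul_px, outKernel, ← mul_assoc, ← M.factor]
  exact law_congr _ fun ω => by simp only [Prod.ext_iff]; tauto

variable (n : ℕ)

/-- The conditional pmf of a block of `U₁` given the block of `U₀`. -/
noncomputable def blockP₁ (u : Fin n → 𝒰₀) (v : Fin n → 𝒰₁) : ℝ := ∏ i, M.p₁ (u i) (v i)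

/-- The conditional pmf of a block of `X` given the blocks of `(U₀, U₁)`. -/
noncomputable def blockPx (u : Fin n → 𝒰₀) (v : Fin n → 𝒰₁) (x : Fin n → 𝒳) : ℝ :=
  ∏ i, M.px (u i) (v i) (x i)

/-- The conditional pmf of blocks of outputs given the blocks of `(U₀, U₁, X)`. -/
noncomputable def blockOut (u : Fin n → 𝒰₀) (v : Fin n → 𝒰₁) (x : Fin n → 𝒳)
    (o : (Fin n → 𝒮) × (Fin n → 𝒱)) : ℝ := ∏ i, M.outKernel (u i) (v i) (x i) (o.1 i, o.2 i)

/-- The pmf of a block of `U₀`. -/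
noncomputable def blockP₀ : (Fin n → 𝒰₀) → ℝ := law (prodPmf M.Q) (block M.U₀)

/-- The channel from the auxiliary variables to all outputs. -/
noncomputable def blockW (u : Fin n → 𝒰₀) (v : Fin n → 𝒰₁)
    (o : (Fin n → 𝒮) × (Fin n → 𝒱)) : ℝ := ∑ x, M.blockPx n u v x * M.blockOut n u v x o

lemma blockQ_mem : prodPmf M.Q ∈ stdSimplex ℝ (Fin n → Ω) := prodPmf_mem M.mem

lemma blockP₀_mem : M.blockP₀ n ∈ stdSimplex ℝ (Fin n → 𝒰₀) := law_mem (M.blockQ_mem n) _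

lemma blockP₁_mem (u : Fin n → 𝒰₀) : M.blockP₁ n u ∈ stdSimplex ℝ (Fin n → 𝒰₁) := by
  refine ⟨fun v => Finset.prod_nonneg fun _ _ => (M.p₁_mem _).1 _, ?_⟩
  simp only [blockP₁]
  rw [sum_pi_prod fun i => M.p₁ (u i)]
  exact Finset.prod_eq_one fun i _ => (M.p₁_mem _).2

lemma blockP₀_mul_blockP₁ (u : Fin n → 𝒰₀) (v : Fin n → 𝒰₁) :
    M.blockP₀ n u * M.blockP₁ n u v
      = law (prodPmf M.Q) (fun ω : Fin n → Ω => (block M.U₀ ω, block M.U₁ ω)) (u, v) := by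
  rw [law_block₂, blockP₀, law_block, blockP₁, ← Finset.prod_mul_distrib]
  exact Finset.prod_congr rfl fun i _ => M.law_mul_p₁ _ _

lemma blockPx_nonneg (u : Fin n → 𝒰₀) (v : Fin n → 𝒰₁) (x : Fin n → 𝒳) :
    0 ≤ M.blockPx n u v x := Finset.prod_nonneg fun _ _ => M.px_nonneg _ _ _

lemma law_blockPx (u : Fin n → 𝒰₀) (v : Fin n → 𝒰₁) (x : Fin n → 𝒳) :
    M.blockP₀ n u * M.blockP₁ n u v * M.blockPx n u v x
      = law (prodPmf M.Q) (fun ω : Fin n → Ω => (block M.U₀ ω, block M.U₁ ω, block M.X ω))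
        (u, v, x) := by
  rw [law_block₃, blockP₀_mul_blockP₁, law_block₂, blockPx, ← Finset.prod_mul_distrib]
  exact Finset.prod_congr rfl fun i _ => M.law_mul_px _ _ _

lemma law_blockW (u : Fin n → 𝒰₀) (v : Fin n → 𝒰₁) (o : (Fin n → 𝒮) × (Fin n → 𝒱)) :
    M.blockP₀ n u * M.blockP₁ n u v * M.blockW n u v o
      = law (prodPmf M.Q)
        (fun ω : Fin n → Ω => (block M.U₀ ω, block M.U₁ ω, block M.S ω, block M.V ω))
        (u, v, o) := by
  have e : law (prodPmf M.Q)
      (fun ω : Fin n → Ω => (block M.U₀ ω, block M.U₁ ω, block M.S ω, block M.V ω)) (u, v, o)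
      = ∏ i, law M.Q (fun ω => (M.U₀ ω, M.U₁ ω, M.S ω, M.V ω)) (u i, v i, o.1 i, o.2 i) := by
    rw [← law_prodPmf M.Q (fun ω => (M.U₀ ω, M.U₁ ω, M.S ω, M.V ω))
      fun i => (u i, v i, o.1 i, o.2 i)]
    exact law_congr _ fun ω => by
      simp only [Prod.ext_iff, funext_iff, forall_and, block]
  rw [e, blockP₀, law_block, blockP₁, blockW]
  simp only [blockPx, blockOut, ← Finset.prod_mul_distrib]
  rw [sum_pi_prod fun i x => M.px (u i) (v i) x * M.outKernel (u i) (v i) x (o.1 i, o.2 i),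
    ← Finset.prod_mul_distrib]
  exact Finset.prod_congr rfl fun i _ => M.law_out _ _ _

lemma blockOut_nonneg (hP : ∀ s, 0 ≤ P s) (hΓ : ∀ w, Γ w ∈ stdSimplex ℝ 𝒱) (u : Fin n → 𝒰₀)
    (v : Fin n → 𝒰₁) (x : Fin n → 𝒳) (o : (Fin n → 𝒮) × (Fin n → 𝒱)) :
    0 ≤ M.blockOut n u v x o :=
  Finset.prod_nonneg fun _ _ => mul_nonneg
    (div_nonneg (hP _) (Finset.sum_nonneg fun _ _ => hP _)) ((hΓ _).1 _)

/-- Only an inequality, because the kernel vanishes at source symbols of mass zero. -/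
lemma sum_blockOut_le (hP : ∀ s, 0 ≤ P s) (hΓ : ∀ w, Γ w ∈ stdSimplex ℝ 𝒱) (u : Fin n → 𝒰₀)
    (v : Fin n → 𝒰₁) (x : Fin n → 𝒳) : ∑ o, M.blockOut n u v x o ≤ 1 := by
  have e : ∀ s : Fin n → 𝒮, ∑ y : Fin n → 𝒱, M.blockOut n u v x (s, y)
      = ∏ i, P (x i, s i) / ∑ s', P (x i, s') := by
    intro s
    simp only [blockOut, outKernel, Finset.prod_mul_distrib]
    rw [← Finset.mul_sum, sum_pi_prod fun i => Γ (M.f (u i) (v i) (x i)),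
      Finset.prod_eq_one fun i _ => (hΓ _).2, mul_one]
  rw [Fintype.sum_prod_type]
  simp only [e]
  rw [sum_pi_prod fun i s => P (x i, s) / ∑ s', P (x i, s')]
  refine Finset.prod_le_one (fun i _ => Finset.sum_nonneg fun s _ =>
    div_nonneg (hP _) (Finset.sum_nonneg fun _ _ => hP _)) fun i _ => ?_
  rw [← Finset.sum_div]
  exact div_self_le_one _

lemma blockW_nonneg (hP : ∀ s, 0 ≤ P s) (hΓ : ∀ w, Γ w ∈ stdSimplex ℝ 𝒱) (u : Fin n → 𝒰₀)
    (v : Fin n → 𝒰₁) (o : (Fin n → 𝒮) × (Fin n → 𝒱)) : 0 ≤ M.blockW n u v o :=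
  Finset.sum_nonneg fun _ _ => mul_nonneg (M.blockPx_nonneg n _ _ _)
    (M.blockOut_nonneg n hP hΓ _ _ _ _)

end Kernels

end HybridModel

namespace HybridModel

/-! ### Soft covering of the source block -/

section Covering

variable {𝒳 𝒮 𝒲 𝒱 Ω 𝒰₀ 𝒰₁ : Type*} [Fintype 𝒳] [Fintype 𝒮] [Fintype 𝒱] [Fintype Ω]
  [Fintype 𝒰₀] [Fintype 𝒰₁] {P : 𝒳 × 𝒮 → ℝ} {Γ : 𝒲 → 𝒱 → ℝ} (M : HybridModel P Γ Ω 𝒰₀ 𝒰₁)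

lemma expect_logb_px : expect M.Q (fun ω => Real.logb 2
    (M.px (M.U₀ ω) (M.U₁ ω) (M.X ω) / law M.Q M.X (M.X ω)))
    = mutualInfo M.Q (fun ω => (M.U₀ ω, M.U₁ ω)) M.X := by
  rw [mutualInfo_eq_expect]
  refine expect_congr fun ω _ => ?_
  rw [px, div_div, law_congr M.Q (A := fun ω => ((M.U₀ ω, M.U₁ ω), M.X ω))
    (B := fun ω => (M.U₀ ω, M.U₁ ω, M.X ω)) (b := (M.U₀ ω, M.U₁ ω, M.X ω))
    fun ω' => by simp only [Prod.mk.injEq, and_assoc]]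

lemma expect_logb_px₀ : expect M.Q (fun ω => Real.logb 2
    (expect (M.p₁ (M.U₀ ω)) (fun v => M.px (M.U₀ ω) v (M.X ω)) / law M.Q M.X (M.X ω)))
    = mutualInfo M.Q M.U₀ M.X := by
  rw [mutualInfo_eq_expect]
  refine expect_congr fun ω h => ?_
  rw [M.sum_p₁_mul_px _ _ (law_pos M.mem.1 M.U₀ h).ne', div_div]

lemma expect_blockPx (n : ℕ) (u : Fin n → 𝒰₀) (x : Fin n → 𝒳) :
    expect (M.blockP₁ n u) (fun v => M.blockPx n u v x)
      = ∏ i, expect (M.p₁ (u i)) fun v => M.px (u i) v (x i) := by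
  simp only [expect, blockP₁, blockPx, ← Finset.prod_mul_distrib]
  exact sum_pi_prod fun i v => M.p₁ (u i) v * M.px (u i) v (x i)

lemma expect₂_blockPx (n : ℕ) (x : Fin n → 𝒳) :
    expect₂ (M.blockP₀ n) (M.blockP₁ n) (fun u v => M.blockPx n u v x)
      = law (prodPmf M.Q) (block M.X) x := by
  have h := sum_expect₂_mul (M.law_blockPx n) fun _ _ x' => ind (x = x')
  rw [law_eq_expect]
  simp only [ind_congr (eq_comm (b := x))]
  rw [← h, ← expect₂_sum]
  congr 1; ext u v
  simp only [mul_comm (M.blockPx n u v _)]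
  exact (sum_ind_eq x _).symm

/-- The true source block and the output of the random codebook are close in total variation. -/
lemma tendsto_expect_totalVariation {R₀ R₁ : ℝ} (h₀ : mutualInfo M.Q M.U₀ M.X < R₀)
    (h₁ : mutualInfo M.Q (fun ω => (M.U₀ ω, M.U₁ ω)) M.X < R₀ + R₁) :
    Tendsto (fun n : ℕ => expect (codebookPmf (M.blockP₀ n) (M.blockP₁ n))
      fun c : Codebook (Fin n → 𝒰₀) (Fin n → 𝒰₁) (Fin (numMsg n R₀ + 1))
        (Fin (numMsg n R₁ + 1)) =>
      ∑ x, |law (prodPmf M.Q) (block M.X) x - average c fun u v => M.blockPx n u v x|)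
      atTop (𝓝 0) := by
  -- The likelihood thresholds lie above the informations, so that `G` is typical, and below the
  -- rates, so that the covering bound decays.
  obtain ⟨a, ha, haR⟩ := exists_between h₁
  obtain ⟨b, hb, hbR⟩ := exists_between h₀
  rw [← M.expect_logb_px] at ha
  rw [← M.expect_logb_px₀] at hb
  have posX : ∀ ω, M.Q ω ≠ 0 → 0 < law M.Q M.X (M.X ω) := fun ω h => law_pos M.mem.1 M.X h
  have ta := tendsto_likelihood_le M.mem
    (a := fun ω => M.px (M.U₀ ω) (M.U₁ ω) (M.X ω)) (b := fun ω => law M.Q M.X (M.X ω))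
    (fun ω h => div_pos (law_pos M.mem.1 (fun ω => (M.U₀ ω, M.U₁ ω, M.X ω)) h)
      (law_pos M.mem.1 (fun ω => (M.U₀ ω, M.U₁ ω)) h)) posX ha
  have tb := tendsto_likelihood_le M.mem
    (a := fun ω => expect (M.p₁ (M.U₀ ω)) (fun v => M.px (M.U₀ ω) v (M.X ω)))
    (b := fun ω => law M.Q M.X (M.X ω))
    (fun ω h => by
      rw [M.sum_p₁_mul_px _ _ (law_pos M.mem.1 M.U₀ h).ne']
      exact div_pos (law_pos M.mem.1 (fun ω => (M.U₀ ω, M.X ω)) h) (law_pos M.mem.1 M.U₀ h))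
    posX hb
  have ts : Tendsto (fun n : ℕ => √((2 : ℝ) ^ (n * (a - (R₀ + R₁))) + (2 : ℝ) ^ (n * (b - R₀))))
      atTop (𝓝 0) := by
    have := ((tendsto_two_rpow (sub_neg.2 haR)).add (tendsto_two_rpow (sub_neg.2 hbR))).sqrt
    simpa using this
  have tt := ts.add ((ta.add tb).const_mul 2)
  simp only [add_zero, mul_zero] at tt
  refine squeeze_zero (fun n => expect_nonneg
    (codebookPmf_mem (M.blockP₀_mem n) (M.blockP₁_mem n)).1 fun c =>
      Finset.sum_nonneg fun x _ => abs_nonneg _) (fun n => ?_) tt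
  set G : (Fin n → 𝒰₀) → (Fin n → 𝒰₁) → (Fin n → 𝒳) → Prop := fun u v x =>
    M.blockPx n u v x ≤ (2 : ℝ) ^ (n * a) * law (prodPmf M.Q) (block M.X) x ∧
    expect (M.blockP₁ n u) (fun v => M.blockPx n u v x)
      ≤ (2 : ℝ) ^ (n * b) * law (prodPmf M.Q) (block M.X) x
  have hc := softCovering (ι := Fin (numMsg n R₀ + 1)) (κ := Fin (numMsg n R₁ + 1))
    (M.blockP₀_mem n) (M.blockP₁_mem n) (M.blockPx_nonneg n) (M.expect₂_blockPx n)
    (sum_law (M.blockQ_mem n) _) (A := (2 : ℝ) ^ (n * a)) (B := (2 : ℝ) ^ (n * b))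
    (by positivity) (by positivity) G fun _ _ _ h => h
  refine hc.trans ?_
  rw [sum_expect₂_mul (M.law_blockPx n) fun u v x => ind (¬ G u v x), ← expect_add]
  gcongr
  · have hN := inv_numMsg_le n R₀
    have hK := inv_numMsg_le n R₁
    rw [mul_add]
    gcongr
    · calc _ ≤ (2 : ℝ) ^ (n * -R₀) * ((2 : ℝ) ^ (n * -R₁) * (2 : ℝ) ^ (n * a)) := by gcongr
        _ = _ := by
          rw [← Real.rpow_add (by norm_num), ← Real.rpow_add (by norm_num)]
          congr 1; ring
    · calc _ ≤ (2 : ℝ) ^ (n * -R₀) * (2 : ℝ) ^ (n * b) := by gcongr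
        _ = _ := by
          rw [← Real.rpow_add (by norm_num)]
          congr 1; ring
  · refine expect_mono (M.blockQ_mem n).1 fun ω _ => (ind_not_and_le _ _).trans ?_
    rw [expect_blockPx, law_block]
    exact le_rfl

end Covering

/-! ### Decoding at the two receivers -/

section Receivers

variable {𝒳 𝒴₁ 𝒴₂ 𝒵₁ 𝒲 𝒱₁ 𝒱₂ Ω 𝒰₀ 𝒰₁ : Type*} [Fintype 𝒳] [Fintype 𝒴₁] [Fintype 𝒴₂]
  [Fintype 𝒵₁] [Fintype 𝒱₁] [Fintype 𝒱₂] [Fintype Ω] [Fintype 𝒰₀] [Fintype 𝒰₁]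
  {P : 𝒳 × 𝒴₁ × 𝒴₂ × 𝒵₁ → ℝ} {Γ : 𝒲 → 𝒱₁ × 𝒱₂ → ℝ} (M : HybridModel P Γ Ω 𝒰₀ 𝒰₁)

/-- The part of the output block that Receiver 1 uses for decoding. -/
def obs₁ {n : ℕ} (o : (Fin n → 𝒴₁ × 𝒴₂ × 𝒵₁) × (Fin n → 𝒱₁ × 𝒱₂)) : Fin n → 𝒱₁ × 𝒵₁ :=
  fun i => ((o.2 i).1, (o.1 i).2.2)

/-- The part of the output block that Receiver 2 uses for decoding. -/
def obs₂ {n : ℕ} (o : (Fin n → 𝒴₁ × 𝒴₂ × 𝒵₁) × (Fin n → 𝒱₁ × 𝒱₂)) : Fin n → 𝒱₂ :=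
  fun i => (o.2 i).2

/-- Receiver 1 accepts the codeword `(u, v)` if its likelihood is large enough, both given the
cloud centre and unconditionally. -/
def accept₁ (n : ℕ) (r₁ r₀ : ℝ) (u : Fin n → 𝒰₀) (v : Fin n → 𝒰₁) (b : Fin n → 𝒱₁ × 𝒵₁) : Prop :=
  (2 : ℝ) ^ (n * r₁) *
    (law (prodPmf M.Q) (fun ω : Fin n → Ω => (block M.U₀ ω, block M.U₁ ω)) (u, v) *
      law (prodPmf M.Q) (fun ω : Fin n → Ω => (block M.U₀ ω, block M.B₁ ω)) (u, b))
    ≤ law (prodPmf M.Q) (fun ω : Fin n → Ω => (block M.U₀ ω, block M.U₁ ω, block M.B₁ ω))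
        (u, v, b) * law (prodPmf M.Q) (block M.U₀) u ∧
  (2 : ℝ) ^ (n * r₀) *
    (law (prodPmf M.Q) (fun ω : Fin n → Ω => (block M.U₀ ω, block M.U₁ ω)) (u, v) *
      law (prodPmf M.Q) (block M.B₁) b)
    ≤ law (prodPmf M.Q) (fun ω : Fin n → Ω => ((block M.U₀ ω, block M.U₁ ω), block M.B₁ ω))
        ((u, v), b)

/-- Receiver 2 accepts the cloud centre `u` if its likelihood is large enough. -/
def accept₂ (n : ℕ) (r : ℝ) (u : Fin n → 𝒰₀) (b : Fin n → 𝒱₂) : Prop :=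
  (2 : ℝ) ^ (n * r) * (law (prodPmf M.Q) (block M.U₀) u * law (prodPmf M.Q) (block M.V₂) b)
    ≤ law (prodPmf M.Q) (fun ω : Fin n → Ω => (block M.U₀ ω, block M.V₂ ω)) (u, b)

lemma tendsto_accept₁ {r₁ r₀ : ℝ} (h₁ : r₁ < condMutualInfo M.Q M.U₁ M.B₁ M.U₀)
    (h₀ : r₀ < mutualInfo M.Q M.U M.B₁) :
    Tendsto (fun n : ℕ => expect (prodPmf M.Q) fun ω : Fin n → Ω =>
      ind (¬ M.accept₁ n r₁ r₀ (block M.U₀ ω) (block M.U₁ ω) (block M.B₁ ω))) atTop (𝓝 0) := by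
  have t := (tendsto_cond_ratio M.mem M.U₁ M.B₁ M.U₀ h₁).add (tendsto_ratio M.mem M.U M.B₁ h₀)
  rw [add_zero] at t
  refine squeeze_zero (fun n => expect_nonneg (M.blockQ_mem n).1 fun ω => ind_nonneg _)
    (fun n => ?_) t
  rw [← expect_add]
  refine expect_mono (M.blockQ_mem n).1 fun ω _ => (ind_not_and_le _ _).trans (le_of_eq ?_)
  congr 1
  rw [law_congr (prodPmf M.Q) (A := block M.U) (a := block M.U ω)
      (B := fun ω : Fin n → Ω => (block M.U₀ ω, block M.U₁ ω)) (b := (block M.U₀ ω, block M.U₁ ω))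
      fun ω' => by simp only [Prod.mk.injEq, funext_iff, block, U, forall_and],
    law_congr (prodPmf M.Q) (A := fun ω : Fin n → Ω => (block M.U ω, block M.B₁ ω))
      (a := (block M.U ω, block M.B₁ ω))
      (B := fun ω : Fin n → Ω => ((block M.U₀ ω, block M.U₁ ω), block M.B₁ ω))
      (b := ((block M.U₀ ω, block M.U₁ ω), block M.B₁ ω))
      fun ω' => by simp only [Prod.mk.injEq, funext_iff, block, U, forall_and]]

/-- The average error probability of Receiver 1 vanishes. -/
lemma tendsto_expect_error₁ (hP : ∀ s, 0 ≤ P s) (hΓ : ∀ w, Γ w ∈ stdSimplex ℝ (𝒱₁ × 𝒱₂))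
    {R₀ R₁ r₁ r₀ : ℝ} (hR₀ : 0 ≤ R₀) (hR₁ : 0 ≤ R₁) (hr₁ : R₁ < r₁) (hr₀ : R₀ + R₁ < r₀)
    (h₁ : r₁ < condMutualInfo M.Q M.U₁ M.B₁ M.U₀) (h₀ : r₀ < mutualInfo M.Q M.U M.B₁)
    (T : ∀ n : ℕ, (Fin n → 𝒰₀) → (Fin n → 𝒰₁) →
      (Fin n → 𝒴₁ × 𝒴₂ × 𝒵₁) × (Fin n → 𝒱₁ × 𝒱₂) → Prop)
    (hT : Tendsto (fun n : ℕ => expect (prodPmf M.Q) fun ω : Fin n → Ω =>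
      ind (¬ T n (block M.U₀ ω) (block M.U₁ ω) (block M.S ω, block M.V ω))) atTop (𝓝 0)) :
    Tendsto (fun n : ℕ => expect (codebookPmf (M.blockP₀ n) (M.blockP₁ n))
      fun c : Codebook (Fin n → 𝒰₀) (Fin n → 𝒰₁) (Fin (numMsg n R₀ + 1))
        (Fin (numMsg n R₁ + 1)) => average c fun u v => ∑ o, M.blockW n u v o *
          ind (¬ T n (decodeSatellite c (M.accept₁ n r₁ r₀) (obs₁ o)).1
            (decodeSatellite c (M.accept₁ n r₁ r₀) (obs₁ o)).2 o)) atTop (𝓝 0) := by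
  -- The conditional threshold `r₁` beats the competitors in the true cloud, the joint threshold
  -- `r₀` those in other clouds. The constants 2 and 4 come from rounding one or two numbers of
  -- messages.
  have t := (((M.tendsto_accept₁ h₁ h₀).add hT).add
    ((tendsto_two_rpow (sub_neg.2 hr₁)).const_mul 2)).add
    ((tendsto_two_rpow (sub_neg.2 hr₀)).const_mul 4)
  simp only [add_zero, mul_zero] at t
  refine squeeze_zero (fun n => expect_nonneg
    (codebookPmf_mem (M.blockP₀_mem n) (M.blockP₁_mem n)).1 fun c =>
      average_nonneg c fun u v => Finset.sum_nonneg fun o _ =>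
        mul_nonneg (M.blockW_nonneg n hP hΓ _ _ _) (ind_nonneg _)) (fun n => ?_) t
  refine (expect_error_satellite (M.blockP₀_mem n) (M.blockP₁_mem n) (M.blockQ_mem n).1
    (M.blockW_nonneg n hP hΓ) (M.law_blockW n)
    (fun u v o => M.accept₁ n r₁ r₀ u v (obs₁ o)) (T n)).trans ?_
  have p1 : (0 : ℝ) < (2 : ℝ) ^ (n * r₁) := by positivity
  have p0 : (0 : ℝ) < (2 : ℝ) ^ (n * r₀) := by positivity
  have e1 := expect_accept_satellite_le (M.blockQ_mem n) (U₀ := block M.U₀) (U₁ := block M.U₁)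
    (B := block M.B₁) (M.blockP₀_mul_blockP₁ n) p1 (M.accept₁ n r₁ r₀) fun u v b h => h.1
  have e0 := expect_accept_le (M.blockQ_mem n)
    (A := fun ω : Fin n → Ω => (block M.U₀ ω, block M.U₁ ω)) (B := block M.B₁) p0
    (fun u b => M.accept₁ n r₁ r₀ u.1 u.2 b) fun u b h => h.2
  have e0' : ∀ b, expect (law (prodPmf M.Q)
      (fun ω : Fin n → Ω => (block M.U₀ ω, block M.U₁ ω)))
        (fun u => ind (M.accept₁ n r₁ r₀ u.1 u.2 b))
      = expect₂ (M.blockP₀ n) (M.blockP₁ n) fun u v => ind (M.accept₁ n r₁ r₀ u v b) := by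
    intro b
    simp only [expect₂, expect, Fintype.sum_prod_type, Finset.mul_sum, ← mul_assoc,
      M.blockP₀_mul_blockP₁ n]
  simp only [e0'] at e0
  have i1 : ((2 : ℝ) ^ (n * r₁))⁻¹ = (2 : ℝ) ^ (n * -r₁) := by
    rw [mul_neg, Real.rpow_neg (by norm_num)]
  have i0 : ((2 : ℝ) ^ (n * r₀))⁻¹ = (2 : ℝ) ^ (n * -r₀) := by
    rw [mul_neg, Real.rpow_neg (by norm_num)]
  refine add_le_add (add_le_add le_rfl ?_) ?_
  · calc _ ≤ (2 * (2 : ℝ) ^ (n * R₁)) * ((2 : ℝ) ^ (n * r₁))⁻¹ :=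
          mul_le_mul (numMsg_le n hR₁) e1 (expect_nonneg (M.blockQ_mem n).1 fun ω =>
            expect_nonneg (M.blockP₁_mem n _).1 fun _ => ind_nonneg _) (by positivity)
      _ = _ := by
          rw [i1, mul_assoc, ← Real.rpow_add (by norm_num)]
          congr 2; ring
  · calc _ ≤ ((2 * (2 : ℝ) ^ (n * R₀)) * (2 * (2 : ℝ) ^ (n * R₁))) * ((2 : ℝ) ^ (n * r₀))⁻¹ :=
          mul_le_mul (mul_le_mul (numMsg_le n hR₀) (numMsg_le n hR₁) (by positivity)
            (by positivity)) e0 (expect_nonneg (M.blockQ_mem n).1 fun ω =>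
            expect₂_nonneg (M.blockP₀_mem n) (M.blockP₁_mem n) fun _ _ => ind_nonneg _)
            (by positivity)
      _ = 4 * ((2 : ℝ) ^ (n * R₀) * (2 : ℝ) ^ (n * R₁) * (2 : ℝ) ^ (n * -r₀)) := by
          rw [i0]; ring
      _ = _ := by
          rw [← Real.rpow_add (by norm_num), ← Real.rpow_add (by norm_num)]
          congr 2; ring

/-- The average error probability of Receiver 2 vanishes. -/
lemma tendsto_expect_error₂ (hP : ∀ s, 0 ≤ P s) (hΓ : ∀ w, Γ w ∈ stdSimplex ℝ (𝒱₁ × 𝒱₂))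
    {R₀ R₁ r : ℝ} (hR₀ : 0 ≤ R₀) (hr : R₀ < r) (h : r < mutualInfo M.Q M.U₀ M.V₂)
    (T : ∀ n : ℕ, (Fin n → 𝒰₀) → (Fin n → 𝒴₁ × 𝒴₂ × 𝒵₁) × (Fin n → 𝒱₁ × 𝒱₂) → Prop)
    (hT : Tendsto (fun n : ℕ => expect (prodPmf M.Q) fun ω : Fin n → Ω =>
      ind (¬ T n (block M.U₀ ω) (block M.S ω, block M.V ω))) atTop (𝓝 0)) :
    Tendsto (fun n : ℕ => expect (codebookPmf (M.blockP₀ n) (M.blockP₁ n))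
      fun c : Codebook (Fin n → 𝒰₀) (Fin n → 𝒰₁) (Fin (numMsg n R₀ + 1))
        (Fin (numMsg n R₁ + 1)) => average c fun u v => ∑ o, M.blockW n u v o *
          ind (¬ T n (decodeCloud c (M.accept₂ n r) (obs₂ o)) o)) atTop (𝓝 0) := by
  have t := ((tendsto_ratio M.mem M.U₀ M.V₂ h).add hT).add
    ((tendsto_two_rpow (sub_neg.2 hr)).const_mul 2)
  simp only [add_zero, mul_zero] at t
  refine squeeze_zero (fun n => expect_nonneg
    (codebookPmf_mem (M.blockP₀_mem n) (M.blockP₁_mem n)).1 fun c =>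
      average_nonneg c fun u v => Finset.sum_nonneg fun o _ =>
        mul_nonneg (M.blockW_nonneg n hP hΓ _ _ _) (ind_nonneg _)) (fun n => ?_) t
  refine (expect_error_cloud (M.blockP₀_mem n) (M.blockP₁_mem n) (M.blockQ_mem n).1
    (M.blockW_nonneg n hP hΓ) (M.law_blockW n)
    (fun u o => M.accept₂ n r u (obs₂ o)) (T n)).trans ?_
  have p0 : (0 : ℝ) < (2 : ℝ) ^ (n * r) := by positivity
  have e0 := expect_accept_le (M.blockQ_mem n) (A := block M.U₀) (B := block M.V₂) p0
    (M.accept₂ n r) fun u b h => h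
  have i0 : ((2 : ℝ) ^ (n * r))⁻¹ = (2 : ℝ) ^ (n * -r) := by
    rw [mul_neg, Real.rpow_neg (by norm_num)]
  refine add_le_add le_rfl ?_
  calc _ ≤ (2 * (2 : ℝ) ^ (n * R₀)) * ((2 : ℝ) ^ (n * r))⁻¹ :=
        mul_le_mul (numMsg_le n hR₀) e0 (expect_nonneg (M.blockQ_mem n).1 fun ω =>
          expect_nonneg (M.blockP₀_mem n).1 fun _ => ind_nonneg _) (by positivity)
    _ = _ := by
        rw [i0, mul_assoc, ← Real.rpow_add (by norm_num)]
        congr 2; ring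

end Receivers

end HybridModel

/-! ### Error probabilities of codes -/

section Decision

variable {𝒳 𝒴₁ 𝒴₂ 𝒵₁ 𝒲 𝒱₁ 𝒱₂ : Type*}
  [Fintype 𝒳] [Fintype 𝒴₁] [Fintype 𝒴₂] [Fintype 𝒵₁] [Fintype 𝒲] [Fintype 𝒱₁] [Fintype 𝒱₂]
  {n : ℕ}

lemma sum_pi_pair {α β : Type*} [Fintype α] [Fintype β] (H : (Fin n → α × β) → ℝ) :
    ∑ s, H s = ∑ a : Fin n → α, ∑ b : Fin n → β, H fun i => (a i, b i) := by
  rw [← Fintype.sum_prod_type' fun (a : Fin n → α) (b : Fin n → β) => H fun i => (a i, b i)]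
  exact Fintype.sum_equiv (Equiv.arrowProdEquivProdArrow (Fin n) (fun _ => α) (fun _ => β)) _ _
    fun _ => rfl

lemma decisionProb₁_eq (S : 𝒳 × 𝒴₁ × 𝒴₂ × 𝒵₁ → ℝ) (Γ : 𝒲 → 𝒱₁ × 𝒱₂ → ℝ)
    (c : Code 𝒳 𝒴₁ 𝒴₂ 𝒵₁ 𝒲 𝒱₁ 𝒱₂ n) (h : Fin 2) :
    decisionProb₁ S Γ c h = ∑ x : Fin n → 𝒳, ∑ s : Fin n → 𝒴₁ × 𝒴₂ × 𝒵₁, ∑ w : Fin n → 𝒲,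
      ∑ v : Fin n → 𝒱₁ × 𝒱₂, (∏ i, S (x i, s i)) * c.enc x w * (∏ i, Γ (w i) (v i)) *
        ind (c.dec₁ (fun i => (v i).1) (fun i => (s i).1) (fun i => (s i).2.2) = h) := by
  simp only [sum_pi_pair, decisionProb₁, blockPmf, ind, mul_ite, mul_one, mul_zero]

lemma decisionProb₂_eq (S : 𝒳 × 𝒴₁ × 𝒴₂ × 𝒵₁ → ℝ) (Γ : 𝒲 → 𝒱₁ × 𝒱₂ → ℝ)
    (c : Code 𝒳 𝒴₁ 𝒴₂ 𝒵₁ 𝒲 𝒱₁ 𝒱₂ n) (h : Fin 2) :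
    decisionProb₂ S Γ c h = ∑ x : Fin n → 𝒳, ∑ s : Fin n → 𝒴₁ × 𝒴₂ × 𝒵₁, ∑ w : Fin n → 𝒲,
      ∑ v : Fin n → 𝒱₁ × 𝒱₂, (∏ i, S (x i, s i)) * c.enc x w * (∏ i, Γ (w i) (v i)) *
        ind (c.dec₂ (fun i => (v i).2) (fun i => (s i).2.1) = h) := by
  simp only [sum_pi_pair, decisionProb₂, blockPmf, ind, mul_ite, mul_one, mul_zero]

/-- The marginal pmf of `(X, Z₁)`. -/
noncomputable def margXZ (P : 𝒳 × 𝒴₁ × 𝒴₂ × 𝒵₁ → ℝ) (x : 𝒳) (z : 𝒵₁) : ℝ :=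
  ∑ y₁, ∑ y₂, P (x, y₁, y₂, z)

/-- The marginal pmf of `(Y₁, Z₁)`. -/
noncomputable def margYZ (P : 𝒳 × 𝒴₁ × 𝒴₂ × 𝒵₁ → ℝ) (y₁ : 𝒴₁) (z : 𝒵₁) : ℝ :=
  ∑ x, ∑ y₂, P (x, y₁, y₂, z)

/-- The marginal pmf of `Z₁`. -/
noncomputable def margZ (P : 𝒳 × 𝒴₁ × 𝒴₂ × 𝒵₁ → ℝ) (z : 𝒵₁) : ℝ :=
  ∑ x, ∑ y₁, ∑ y₂, P (x, y₁, y₂, z)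

/-- The marginal pmf of `Y₂`. -/
noncomputable def margY₂ (P : 𝒳 × 𝒴₁ × 𝒴₂ × 𝒵₁ → ℝ) (y₂ : 𝒴₂) : ℝ :=
  ∑ x, ∑ y₁, ∑ z, P (x, y₁, y₂, z)

/-- Under the alternative hypothesis, a bound on the conditional acceptance probability given
everything but `Y₁, Y₂` bounds the acceptance probability. -/
lemma sum_altPmf_le {P : 𝒳 × 𝒴₁ × 𝒴₂ × 𝒵₁ → ℝ} (hP : P ∈ stdSimplex ℝ (𝒳 × 𝒴₁ × 𝒴₂ × 𝒵₁))
    {Γ : 𝒲 → 𝒱₁ × 𝒱₂ → ℝ} (hΓ : ∀ w, Γ w ∈ stdSimplex ℝ (𝒱₁ × 𝒱₂))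
    (c : Code 𝒳 𝒴₁ 𝒴₂ 𝒵₁ 𝒲 𝒱₁ 𝒱₂ n)
    (f : (Fin n → 𝒴₁) → (Fin n → 𝒴₂) → (Fin n → 𝒵₁) → (Fin n → 𝒱₁ × 𝒱₂) → ℝ) {B : ℝ}
    (hf : ∀ z v, ∑ y₁ : Fin n → 𝒴₁, ∑ y₂ : Fin n → 𝒴₂,
      (∏ i, margYZ P (y₁ i) (z i) / margZ P (z i)) * (∏ i, margY₂ P (y₂ i)) * f y₁ y₂ z v ≤ B) :
    ∑ x : Fin n → 𝒳, ∑ s : Fin n → 𝒴₁ × 𝒴₂ × 𝒵₁, ∑ w : Fin n → 𝒲,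
      ∑ v : Fin n → 𝒱₁ × 𝒱₂, (∏ i, altPmf P (x i, s i)) * c.enc x w * (∏ i, Γ (w i) (v i)) *
        f (fun i => (s i).1) (fun i => (s i).2.1) (fun i => (s i).2.2) v ≤ B := by
  have hXZ : ∀ x z, 0 ≤ margXZ P x z := fun x z =>
    Finset.sum_nonneg fun _ _ => Finset.sum_nonneg fun _ _ => hP.1 _
  have halt : ∀ (x : Fin n → 𝒳) (y₁ : Fin n → 𝒴₁) (y₂ : Fin n → 𝒴₂) (z : Fin n → 𝒵₁),
      ∏ i, altPmf P (x i, y₁ i, y₂ i, z i) = (∏ i, margXZ P (x i) (z i)) *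
        ((∏ i, margYZ P (y₁ i) (z i) / margZ P (z i)) * ∏ i, margY₂ P (y₂ i)) := by
    intro x y₁ y₂ z
    rw [← Finset.prod_mul_distrib, ← Finset.prod_mul_distrib]
    exact Finset.prod_congr rfl fun i _ => mul_assoc _ _ _
  -- Together with `e2` this is only a reordering that moves the sums over `y₁` and `y₂` innermost.
  have e1 : ∑ x : Fin n → 𝒳, ∑ s : Fin n → 𝒴₁ × 𝒴₂ × 𝒵₁, ∑ w : Fin n → 𝒲,
      ∑ v : Fin n → 𝒱₁ × 𝒱₂, (∏ i, altPmf P (x i, s i)) * c.enc x w * (∏ i, Γ (w i) (v i)) *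
        f (fun i => (s i).1) (fun i => (s i).2.1) (fun i => (s i).2.2) v
      = ∑ r : (Fin n → 𝒴₁) × (Fin n → 𝒴₂) × (Fin n → 𝒳) × (Fin n → 𝒵₁) × (Fin n → 𝒲) ×
          (Fin n → 𝒱₁ × 𝒱₂),
        (∏ i, altPmf P (r.2.2.1 i, r.1 i, r.2.1 i, r.2.2.2.1 i)) * c.enc r.2.2.1 r.2.2.2.2.1 *
          (∏ i, Γ (r.2.2.2.2.1 i) (r.2.2.2.2.2 i)) * f r.1 r.2.1 r.2.2.2.1 r.2.2.2.2.2 := by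
    simp only [sum_pi_pair (α := 𝒴₁), sum_pi_pair (α := 𝒴₂)]
    simp only [← Fintype.sum_prod_type']
    exact Fintype.sum_equiv
      { toFun := fun r => (r.2.1, r.2.2.1, r.1, r.2.2.2.1, r.2.2.2.2.1, r.2.2.2.2.2)
        invFun := fun r => (r.2.2.1, r.1, r.2.1, r.2.2.2.1, r.2.2.2.2.1, r.2.2.2.2.2)
        left_inv := fun _ => rfl
        right_inv := fun _ => rfl } _ _ fun _ => rfl
  have e2 : ∑ r : (Fin n → 𝒴₁) × (Fin n → 𝒴₂) × (Fin n → 𝒳) × (Fin n → 𝒵₁) × (Fin n → 𝒲) ×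
          (Fin n → 𝒱₁ × 𝒱₂),
        (∏ i, altPmf P (r.2.2.1 i, r.1 i, r.2.1 i, r.2.2.2.1 i)) * c.enc r.2.2.1 r.2.2.2.2.1 *
          (∏ i, Γ (r.2.2.2.2.1 i) (r.2.2.2.2.2 i)) * f r.1 r.2.1 r.2.2.2.1 r.2.2.2.2.2
      = ∑ x : Fin n → 𝒳, ∑ z : Fin n → 𝒵₁, ∑ w : Fin n → 𝒲, ∑ v : Fin n → 𝒱₁ × 𝒱₂,
        ((∏ i, margXZ P (x i) (z i)) * c.enc x w * ∏ i, Γ (w i) (v i)) *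
        ∑ y₁ : Fin n → 𝒴₁, ∑ y₂ : Fin n → 𝒴₂,
          (∏ i, margYZ P (y₁ i) (z i) / margZ P (z i)) * (∏ i, margY₂ P (y₂ i)) *
            f y₁ y₂ z v := by
    simp only [Finset.mul_sum]
    simp only [← Fintype.sum_prod_type']
    refine Fintype.sum_equiv
      { toFun := fun r => (r.2.2.1, r.2.2.2.1, r.2.2.2.2.1, r.2.2.2.2.2, r.1, r.2.1)
        invFun := fun r => (r.2.2.2.2.1, r.2.2.2.2.2, r.1, r.2.1, r.2.2.1, r.2.2.2.1)
        left_inv := fun _ => rfl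
        right_inv := fun _ => rfl } _ _ fun r => ?_
    simp only [halt, Equiv.coe_fn_mk]
    ring
  rw [e1, e2]
  -- The remaining weights of source, channel input and channel output sum to one, so a pointwise
  -- bound `B` survives averaging.
  calc _ ≤ ∑ x : Fin n → 𝒳, ∑ z : Fin n → 𝒵₁, ∑ w : Fin n → 𝒲, ∑ v : Fin n → 𝒱₁ × 𝒱₂,
        ((∏ i, margXZ P (x i) (z i)) * c.enc x w * ∏ i, Γ (w i) (v i)) * B := by
        refine Finset.sum_le_sum fun x _ => Finset.sum_le_sum fun z _ =>
          Finset.sum_le_sum fun w _ => Finset.sum_le_sum fun v _ =>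
          mul_le_mul_of_nonneg_left (hf z v) ?_
        exact mul_nonneg (mul_nonneg (Finset.prod_nonneg fun _ _ => hXZ _ _) ((c.enc_mem x).1 w))
          (Finset.prod_nonneg fun _ _ => (hΓ _).1 _)
    _ = (∑ x : Fin n → 𝒳, ∑ z : Fin n → 𝒵₁, ∏ i, margXZ P (x i) (z i)) * B := by
        simp only [Finset.sum_mul]
        refine Finset.sum_congr rfl fun x _ => Finset.sum_congr rfl fun z _ => ?_
        have : ∀ w : Fin n → 𝒲, ∑ v : Fin n → 𝒱₁ × 𝒱₂,
            ((∏ i, margXZ P (x i) (z i)) * c.enc x w * ∏ i, Γ (w i) (v i)) * B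
            = (∏ i, margXZ P (x i) (z i)) * B * c.enc x w := by
          intro w
          rw [← Finset.sum_mul, ← Finset.mul_sum, sum_pi_prod fun i => Γ (w i),
            Finset.prod_eq_one fun i _ => (hΓ _).2]
          ring
        simp only [this]
        rw [← Finset.mul_sum, (c.enc_mem x).2, mul_one]
    _ = B := by
        have h1 : ∑ x : Fin n → 𝒳, ∑ z : Fin n → 𝒵₁, ∏ i, margXZ P (x i) (z i)
            = ∏ _i : Fin n, ∑ p : 𝒳 × 𝒵₁, margXZ P p.1 p.2 := by
          rw [← sum_pi_prod fun _ (p : 𝒳 × 𝒵₁) => margXZ P p.1 p.2, sum_pi_pair]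
        have h2 : ∑ p : 𝒳 × 𝒵₁, margXZ P p.1 p.2 = 1 := by
          rw [← hP.2]
          simp only [Fintype.sum_prod_type, margXZ]
          refine Finset.sum_congr rfl fun x _ => ?_
          rw [Finset.sum_comm]
          exact Finset.sum_congr rfl fun y _ => Finset.sum_comm
        rw [h1, h2, Finset.prod_const_one, one_mul]

lemma margYZ_nonneg {P : 𝒳 × 𝒴₁ × 𝒴₂ × 𝒵₁ → ℝ} (hP : ∀ s, 0 ≤ P s) (y : 𝒴₁) (z : 𝒵₁) :
    0 ≤ margYZ P y z := Finset.sum_nonneg fun _ _ => Finset.sum_nonneg fun _ _ => hP _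

lemma margZ_nonneg {P : 𝒳 × 𝒴₁ × 𝒴₂ × 𝒵₁ → ℝ} (hP : ∀ s, 0 ≤ P s) (z : 𝒵₁) :
    0 ≤ margZ P z := Finset.sum_nonneg fun _ _ => Finset.sum_nonneg fun _ _ =>
  Finset.sum_nonneg fun _ _ => hP _

lemma margY₂_nonneg {P : 𝒳 × 𝒴₁ × 𝒴₂ × 𝒵₁ → ℝ} (hP : ∀ s, 0 ≤ P s) (y : 𝒴₂) :
    0 ≤ margY₂ P y := Finset.sum_nonneg fun _ _ => Finset.sum_nonneg fun _ _ =>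
  Finset.sum_nonneg fun _ _ => hP _

/-- The conditional law of Y₁ sums to one only where Z₁ has mass, and to zero elsewhere. -/
lemma sum_prod_margYZ_le {P : 𝒳 × 𝒴₁ × 𝒴₂ × 𝒵₁ → ℝ} (hP : ∀ s, 0 ≤ P s) (z : Fin n → 𝒵₁) :
    ∑ y : Fin n → 𝒴₁, ∏ i, margYZ P (y i) (z i) / margZ P (z i) ≤ 1 := by
  rw [sum_pi_prod fun i y => margYZ P y (z i) / margZ P (z i)]
  refine Finset.prod_le_one (fun i _ => Finset.sum_nonneg fun y _ =>
    div_nonneg (margYZ_nonneg hP _ _) (margZ_nonneg hP _)) fun i _ => ?_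
  rw [← Finset.sum_div]
  have : ∑ y, margYZ P y (z i) = margZ P (z i) := Finset.sum_comm
  rw [this]
  exact div_self_le_one _

lemma sum_prod_margY₂ {P : 𝒳 × 𝒴₁ × 𝒴₂ × 𝒵₁ → ℝ}
    (hP : P ∈ stdSimplex ℝ (𝒳 × 𝒴₁ × 𝒴₂ × 𝒵₁)) :
    ∑ y : Fin n → 𝒴₂, ∏ i, margY₂ P (y i) = 1 := by
  rw [sum_pi_prod fun _ => margY₂ P]
  refine Finset.prod_eq_one fun i _ => ?_
  rw [← hP.2]
  simp only [margY₂, Fintype.sum_prod_type]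
  rw [Finset.sum_comm]
  refine Finset.sum_congr rfl fun x _ => ?_
  rw [Finset.sum_comm]

/-- Under the alternative, Y₁ is independent of the channel output given Z₁. So it suffices to bound
the acceptance probability with the channel output frozen, whatever the code. -/
lemma decisionProb₁_altPmf_le {P : 𝒳 × 𝒴₁ × 𝒴₂ × 𝒵₁ → ℝ}
    (hP : P ∈ stdSimplex ℝ (𝒳 × 𝒴₁ × 𝒴₂ × 𝒵₁))
    {Γ : 𝒲 → 𝒱₁ × 𝒱₂ → ℝ} (hΓ : ∀ w, Γ w ∈ stdSimplex ℝ (𝒱₁ × 𝒱₂))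
    (c : Code 𝒳 𝒴₁ 𝒴₂ 𝒵₁ 𝒲 𝒱₁ 𝒱₂ n) {B : ℝ}
    (hB : ∀ z v₁, ∑ y₁ : Fin n → 𝒴₁, (∏ i, margYZ P (y₁ i) (z i) / margZ P (z i)) *
      ind (c.dec₁ v₁ y₁ z = 0) ≤ B) :
    decisionProb₁ (altPmf P) Γ c 0 ≤ B := by
  rw [decisionProb₁_eq]
  refine sum_altPmf_le hP hΓ c
    (fun y₁ _ z v => ind (c.dec₁ (fun i => (v i).1) y₁ z = 0)) fun z v => ?_
  refine le_of_eq_of_le (Finset.sum_congr rfl fun y₁ _ => ?_) (hB z fun i => (v i).1)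
  simp only [mul_right_comm _ (∏ i, margY₂ P _)]
  rw [← Finset.mul_sum, sum_prod_margY₂ hP, mul_one]

lemma decisionProb₂_altPmf_le {P : 𝒳 × 𝒴₁ × 𝒴₂ × 𝒵₁ → ℝ}
    (hP : P ∈ stdSimplex ℝ (𝒳 × 𝒴₁ × 𝒴₂ × 𝒵₁))
    {Γ : 𝒲 → 𝒱₁ × 𝒱₂ → ℝ} (hΓ : ∀ w, Γ w ∈ stdSimplex ℝ (𝒱₁ × 𝒱₂))
    (c : Code 𝒳 𝒴₁ 𝒴₂ 𝒵₁ 𝒲 𝒱₁ 𝒱₂ n) {B : ℝ}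
    (hB : ∀ v₂, ∑ y₂ : Fin n → 𝒴₂, (∏ i, margY₂ P (y₂ i)) * ind (c.dec₂ v₂ y₂ = 0) ≤ B) :
    decisionProb₂ (altPmf P) Γ c 0 ≤ B := by
  rw [decisionProb₂_eq]
  refine sum_altPmf_le hP hΓ c
    (fun _ y₂ _ v => ind (c.dec₂ (fun i => (v i).2) y₂ = 0)) fun z v => ?_
  have h1 := hB fun i => (v i).2
  have h0 : 0 ≤ ∑ y₂ : Fin n → 𝒴₂, (∏ i, margY₂ P (y₂ i)) *
      ind (c.dec₂ (fun i => (v i).2) y₂ = 0) := Finset.sum_nonneg fun _ _ =>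
    mul_nonneg (Finset.prod_nonneg fun _ _ => margY₂_nonneg hP.1 _) (ind_nonneg _)
  simp only [mul_assoc, ← Finset.mul_sum]
  rw [← Finset.sum_mul]
  exact (mul_le_of_le_one_left h0 (sum_prod_margYZ_le hP.1 z)).trans h1

lemma decisionProb₁_altPmf_le_one {P : 𝒳 × 𝒴₁ × 𝒴₂ × 𝒵₁ → ℝ}
    (hP : P ∈ stdSimplex ℝ (𝒳 × 𝒴₁ × 𝒴₂ × 𝒵₁))
    {Γ : 𝒲 → 𝒱₁ × 𝒱₂ → ℝ} (hΓ : ∀ w, Γ w ∈ stdSimplex ℝ (𝒱₁ × 𝒱₂))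
    (c : Code 𝒳 𝒴₁ 𝒴₂ 𝒵₁ 𝒲 𝒱₁ 𝒱₂ n) : decisionProb₁ (altPmf P) Γ c 0 ≤ 1 :=
  decisionProb₁_altPmf_le hP hΓ c fun z _ =>
    (Finset.sum_le_sum fun _ _ => mul_le_of_le_one_right (Finset.prod_nonneg fun _ _ =>
      div_nonneg (margYZ_nonneg hP.1 _ _) (margZ_nonneg hP.1 _)) (ind_le_one _)).trans
      (sum_prod_margYZ_le hP.1 z)

lemma decisionProb₂_altPmf_le_one {P : 𝒳 × 𝒴₁ × 𝒴₂ × 𝒵₁ → ℝ}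
    (hP : P ∈ stdSimplex ℝ (𝒳 × 𝒴₁ × 𝒴₂ × 𝒵₁))
    {Γ : 𝒲 → 𝒱₁ × 𝒱₂ → ℝ} (hΓ : ∀ w, Γ w ∈ stdSimplex ℝ (𝒱₁ × 𝒱₂))
    (c : Code 𝒳 𝒴₁ 𝒴₂ 𝒵₁ 𝒲 𝒱₁ 𝒱₂ n) : decisionProb₂ (altPmf P) Γ c 0 ≤ 1 :=
  decisionProb₂_altPmf_le hP hΓ c fun _ =>
    (Finset.sum_le_sum fun _ _ => mul_le_of_le_one_right (Finset.prod_nonneg fun _ _ =>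
      margY₂_nonneg hP.1 _) (ind_le_one _)).trans (sum_prod_margY₂ hP).le

lemma altPmf_nonneg {P : 𝒳 × 𝒴₁ × 𝒴₂ × 𝒵₁ → ℝ} (hP : ∀ s, 0 ≤ P s) (s : 𝒳 × 𝒴₁ × 𝒴₂ × 𝒵₁) :
    0 ≤ altPmf P s :=
  mul_nonneg (mul_nonneg (Finset.sum_nonneg fun _ _ => Finset.sum_nonneg fun _ _ => hP _)
    (div_nonneg (margYZ_nonneg hP _ _) (margZ_nonneg hP _))) (margY₂_nonneg hP _)

lemma decisionProb₁_nonneg {S : 𝒳 × 𝒴₁ × 𝒴₂ × 𝒵₁ → ℝ} (hS : ∀ s, 0 ≤ S s)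
    {Γ : 𝒲 → 𝒱₁ × 𝒱₂ → ℝ} (hΓ : ∀ w, Γ w ∈ stdSimplex ℝ (𝒱₁ × 𝒱₂))
    (c : Code 𝒳 𝒴₁ 𝒴₂ 𝒵₁ 𝒲 𝒱₁ 𝒱₂ n) (h : Fin 2) : 0 ≤ decisionProb₁ S Γ c h := by
  rw [decisionProb₁_eq]
  exact Finset.sum_nonneg fun x _ => Finset.sum_nonneg fun s _ => Finset.sum_nonneg fun w _ =>
    Finset.sum_nonneg fun v _ => mul_nonneg (mul_nonneg (mul_nonneg
      (Finset.prod_nonneg fun _ _ => hS _) ((c.enc_mem x).1 w))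
      (Finset.prod_nonneg fun _ _ => (hΓ _).1 _)) (ind_nonneg _)

lemma decisionProb₂_nonneg {S : 𝒳 × 𝒴₁ × 𝒴₂ × 𝒵₁ → ℝ} (hS : ∀ s, 0 ≤ S s)
    {Γ : 𝒲 → 𝒱₁ × 𝒱₂ → ℝ} (hΓ : ∀ w, Γ w ∈ stdSimplex ℝ (𝒱₁ × 𝒱₂))
    (c : Code 𝒳 𝒴₁ 𝒴₂ 𝒵₁ 𝒲 𝒱₁ 𝒱₂ n) (h : Fin 2) : 0 ≤ decisionProb₂ S Γ c h := by
  rw [decisionProb₂_eq]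
  exact Finset.sum_nonneg fun x _ => Finset.sum_nonneg fun s _ => Finset.sum_nonneg fun w _ =>
    Finset.sum_nonneg fun v _ => mul_nonneg (mul_nonneg (mul_nonneg
      (Finset.prod_nonneg fun _ _ => hS _) ((c.enc_mem x).1 w))
      (Finset.prod_nonneg fun _ _ => (hΓ _).1 _)) (ind_nonneg _)

/-- Error probabilities that decay like `2 ^ (-n t)` have exponent at least `max t 0`. -/
lemma le_exponent {β : ℕ → ℝ} {t : ℝ} (h : ∀ᶠ n : ℕ in atTop,
    0 ≤ β n ∧ β n ≤ 1 ∧ β n ≤ (2 : ℝ) ^ (n * -t)) : ((max t 0 : ℝ) : EReal) ≤ exponent β := by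
  rw [exponent, EReal.le_neg, ← EReal.coe_neg]
  refine Filter.limsup_le_of_le (by isBoundedDefault) ?_
  filter_upwards [h, eventually_gt_atTop 0] with n hn hn0
  have hn' : (0 : ℝ) < n := Nat.cast_pos.2 hn0
  unfold log₂
  split_ifs with h0
  · rw [EReal.coe_mul_bot_of_pos (by positivity)]
    exact bot_le
  · have hpos : 0 < β n := hn.1.lt_of_ne' h0
    rw [← EReal.coe_mul, EReal.coe_le_coe_iff]
    have h1 : Real.logb 2 (β n) ≤ n * -t := by
      rw [Real.logb_le_iff_le_rpow (by norm_num) hpos]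
      exact hn.2.2
    have h2 : Real.logb 2 (β n) ≤ 0 := Real.logb_nonpos (by norm_num) hn.1 hn.2.1
    rw [one_div, ← div_eq_inv_mul, div_le_iff₀ hn']
    rcases le_total t 0 with ht | ht
    · rw [max_eq_right ht]; linarith
    · rw [max_eq_left ht]; linarith

end Decision

/-! ### Likelihood-ratio tests -/

section Tests

variable {Ω α β γ : Type*} [Fintype Ω] {Q : Ω → ℝ}

/-- The likelihood-ratio test for the joint law of `A` and `B` against the product law. -/
def RatioTest (Q : Ω → ℝ) (A : Ω → α) (B : Ω → β) (r : ℝ) (a : α) (b : β) : Prop :=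
  -- Positivity rejects symbols of mass zero, for which the inequality reads 0 ≤ 0 and everything
  -- would be accepted.
  0 < law Q A a ∧ r * (law Q A a * law Q B b) ≤ law Q (fun ω => (A ω, B ω)) (a, b)

/-- The likelihood-ratio test for the joint law of `A` and `B` given `C` against conditional
independence. -/
def CondRatioTest (Q : Ω → ℝ) (A : Ω → α) (B : Ω → β) (C : Ω → γ) (r : ℝ) (a : α) (b : β) (c : γ) :
    Prop :=
  0 < law Q (fun ω => (C ω, A ω)) (c, a) ∧
  r * (law Q (fun ω => (C ω, A ω)) (c, a) * law Q (fun ω => (C ω, B ω)) (c, b))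
    ≤ law Q (fun ω => (C ω, A ω, B ω)) (c, a, b) * law Q C c

variable [Fintype β]

/-- Change of measure: acceptance means P(b) ≤ r⁻¹ P(b|a), and a conditional law sums to at most
one. The bound is uniform in `a`, so it applies to whatever codeword is decoded. -/
lemma sum_ratioTest_le (hQ : Q ∈ stdSimplex ℝ Ω) (A : Ω → α) (B : Ω → β) {r : ℝ} (hr : 0 < r)
    (a : α) : ∑ b, law Q B b * ind (RatioTest Q A B r a b) ≤ r⁻¹ := by
  have key : ∀ b, law Q B b * ind (RatioTest Q A B r a b)
      ≤ r⁻¹ * (law Q (fun ω => (A ω, B ω)) (a, b) / law Q A a) := by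
    intro b
    by_cases h : RatioTest Q A B r a b
    · rw [ind_of h, mul_one, ← div_eq_inv_mul, div_div, le_div_iff₀ (mul_pos h.1 hr)]
      linarith [h.2]
    · rw [ind_of_not h, mul_zero]
      exact mul_nonneg (inv_nonneg.2 hr.le) (div_nonneg (law_nonneg hQ.1 _ _)
        (law_nonneg hQ.1 _ _))
  refine (Finset.sum_le_sum fun b _ => key b).trans ?_
  rw [← Finset.mul_sum, ← Finset.sum_div, sum_law_pair]
  exact mul_le_of_le_one_right (inv_nonneg.2 hr.le) (div_self_le_one _)

/-- The same change of measure, with P(b|c) ≤ r⁻¹ P(b|a,c) on acceptance. -/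
lemma sum_condRatioTest_le (hQ : Q ∈ stdSimplex ℝ Ω) (A : Ω → α) (B : Ω → β) (C : Ω → γ) {r : ℝ}
    (hr : 0 < r) (a : α) (c : γ) :
    ∑ b, law Q (fun ω => (C ω, B ω)) (c, b) / law Q C c * ind (CondRatioTest Q A B C r a b c)
      ≤ r⁻¹ := by
  have key : ∀ b, law Q (fun ω => (C ω, B ω)) (c, b) / law Q C c *
        ind (CondRatioTest Q A B C r a b c)
      ≤ r⁻¹ * (law Q (fun ω => ((C ω, A ω), B ω)) ((c, a), b) /
        law Q (fun ω => (C ω, A ω)) (c, a)) := by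
    intro b
    by_cases h : CondRatioTest Q A B C r a b c
    · have hC : 0 < law Q C c := h.1.trans_le
        (law_le_of_imp hQ.1 fun ω h => (Prod.mk.inj h).1)
      rw [ind_of h, mul_one, ← div_eq_inv_mul, div_div, le_div_iff₀ (mul_pos h.1 hr),
        div_mul_eq_mul_div, div_le_iff₀ hC,
        law_congr Q (A := fun ω => ((C ω, A ω), B ω)) (B := fun ω => (C ω, A ω, B ω))
          (b := (c, a, b)) fun ω => by simp only [Prod.mk.injEq, and_assoc]]
      linarith [h.2]
    · rw [ind_of_not h, mul_zero]
      exact mul_nonneg (inv_nonneg.2 hr.le) (div_nonneg (law_nonneg hQ.1 _ _)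
        (law_nonneg hQ.1 _ _))
  refine (Finset.sum_le_sum fun b _ => key b).trans ?_
  rw [← Finset.mul_sum, ← Finset.sum_div, sum_law_pair]
  exact mul_le_of_le_one_right (inv_nonneg.2 hr.le) (div_self_le_one _)

variable [Fintype α] [Fintype γ]

lemma tendsto_ratioTest (hQ : Q ∈ stdSimplex ℝ Ω) (A : Ω → α) (B : Ω → β) {R : ℝ}
    (hR : R < mutualInfo Q A B) :
    Tendsto (fun n : ℕ => expect (prodPmf Q) fun ω : Fin n → Ω =>
      ind (¬ RatioTest (prodPmf Q) (block A) (block B) ((2 : ℝ) ^ (n * R)) (block A ω)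
        (block B ω))) atTop (𝓝 0) := by
  refine (tendsto_ratio hQ A B hR).congr fun n => expect_congr fun ω h => ind_congr ?_
  have := law_pos (prodPmf_mem hQ).1 (block A) h
  simp only [RatioTest, this, true_and]

lemma tendsto_condRatioTest (hQ : Q ∈ stdSimplex ℝ Ω) (A : Ω → α) (B : Ω → β) (C : Ω → γ) {R : ℝ}
    (hR : R < condMutualInfo Q A B C) :
    Tendsto (fun n : ℕ => expect (prodPmf Q) fun ω : Fin n → Ω =>
      ind (¬ CondRatioTest (prodPmf Q) (block A) (block B) (block C) ((2 : ℝ) ^ (n * R))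
        (block A ω) (block B ω) (block C ω))) atTop (𝓝 0) := by
  refine (tendsto_cond_ratio hQ A B C hR).congr fun n => expect_congr fun ω h => ind_congr ?_
  have := law_pos (prodPmf_mem hQ).1 (fun ω : Fin n → Ω => (block C ω, block A ω)) h
  simp only [CondRatioTest, this, true_and]

end Tests

/-! ### The hybrid code -/

lemma ite_eq_one_iff_not (p : Prop) {_ : Decidable p} : (if p then (0 : Fin 2) else 1) = 1 ↔ ¬ p := by
  split_ifs with h <;> simp [h]

namespace HybridModel

section HybridCode

variable {𝒳 𝒴₁ 𝒴₂ 𝒵₁ 𝒲 𝒱₁ 𝒱₂ Ω 𝒰₀ 𝒰₁ ι κ : Type*} [Fintype 𝒳] [Fintype 𝒴₁] [Fintype 𝒴₂]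
  [Fintype 𝒵₁] [Fintype 𝒲] [Fintype 𝒱₁] [Fintype 𝒱₂] [Fintype Ω] [Fintype 𝒰₀] [Fintype 𝒰₁]
  [Fintype ι] [Fintype κ] [Nonempty ι] [Nonempty κ]
  {P : 𝒳 × 𝒴₁ × 𝒴₂ × 𝒵₁ → ℝ} {Γ : 𝒲 → 𝒱₁ × 𝒱₂ → ℝ} (M : HybridModel P Γ Ω 𝒰₀ 𝒰₁) {n : ℕ}

open Classical in
/-- The likelihood encoder, followed by the symbolwise map `f`; each receiver decodes the codeword
or the cloud centre and then applies a test. -/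
noncomputable def code (c : Codebook (Fin n → 𝒰₀) (Fin n → 𝒰₁) ι κ)
    (G₁ : (Fin n → 𝒰₀) → (Fin n → 𝒰₁) → (Fin n → 𝒱₁ × 𝒵₁) → Prop)
    (T₁ : (Fin n → 𝒰₀) → (Fin n → 𝒰₁) → (Fin n → 𝒴₁) → (Fin n → 𝒵₁) → Prop)
    (G₂ : (Fin n → 𝒰₀) → (Fin n → 𝒱₂) → Prop)
    (T₂ : (Fin n → 𝒰₀) → (Fin n → 𝒴₂) → Prop) :
    Code 𝒳 𝒴₁ 𝒴₂ 𝒵₁ 𝒲 𝒱₁ 𝒱₂ n where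
  enc x w := ∑ m, likelihood (M.blockPx n) c x m *
    ind ((fun i => M.f ((c m.1).1 i) ((c m.1).2 m.2 i) (x i)) = w)
  enc_mem x := by
    have hL := likelihood_mem (M.blockPx_nonneg n) c x
    refine ⟨fun w => Finset.sum_nonneg fun m _ => mul_nonneg (hL.1 m) (ind_nonneg _), ?_⟩
    rw [Finset.sum_comm, ← hL.2]
    refine Finset.sum_congr rfl fun m _ => ?_
    rw [← Finset.mul_sum]
    have := sum_ind_eq (fun i => M.f ((c m.1).1 i) ((c m.1).2 m.2 i) (x i)) fun _ => (1 : ℝ)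
    simp only [mul_one] at this
    rw [this, mul_one]
  dec₁ v₁ y₁ z₁ := if T₁ (decodeSatellite c G₁ fun i => (v₁ i, z₁ i)).1
    (decodeSatellite c G₁ fun i => (v₁ i, z₁ i)).2 y₁ z₁ then 0 else 1
  dec₂ v₂ y₂ := if T₂ (decodeCloud c G₂ v₂) y₂ then 0 else 1

/-- With the likelihood encoder, the probability of an event under the null hypothesis exceeds the
one for a uniformly distributed codeword by at most the soft-covering distance. -/
lemma sum_enc_le (hP : ∀ s, 0 ≤ P s) (hΓ : ∀ w, Γ w ∈ stdSimplex ℝ (𝒱₁ × 𝒱₂))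
    (c : Codebook (Fin n → 𝒰₀) (Fin n → 𝒰₁) ι κ)
    (e : (Fin n → 𝒴₁ × 𝒴₂ × 𝒵₁) × (Fin n → 𝒱₁ × 𝒱₂) → ℝ) (he : ∀ o, 0 ≤ e o)
    (he1 : ∀ o, e o ≤ 1) :
    ∑ x : Fin n → 𝒳, ∑ s : Fin n → 𝒴₁ × 𝒴₂ × 𝒵₁, ∑ w : Fin n → 𝒲, ∑ v : Fin n → 𝒱₁ × 𝒱₂,
      (∏ i, P (x i, s i)) * (∑ m, likelihood (M.blockPx n) c x m *
        ind ((fun i => M.f ((c m.1).1 i) ((c m.1).2 m.2 i) (x i)) = w)) *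
        (∏ i, Γ (w i) (v i)) * e (s, v)
    ≤ ∑ x, |law (prodPmf M.Q) (block M.X) x - average c fun u v => M.blockPx n u v x|
      + average c fun u v => ∑ o, M.blockW n u v o * e o := by
  have h := likelihood_error_le (M.blockPx_nonneg n) (pX := law (prodPmf M.Q) (block M.X)) c
    (e := fun u v x => ∑ o, M.blockOut n u v x o * e o)
    (fun u v x => Finset.sum_nonneg fun o _ =>
      mul_nonneg (M.blockOut_nonneg n hP hΓ u v x o) (he o))
    (fun u v x => (Finset.sum_le_sum fun o _ => mul_le_of_le_one_right
      (M.blockOut_nonneg n hP hΓ u v x o) (he1 o)).trans (M.sum_blockOut_le n hP hΓ u v x))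
  refine (le_of_eq ?_).trans (h.trans_eq ?_)
  · refine Finset.sum_congr rfl fun x _ => ?_
    -- Given the codeword and the source block, the true outputs follow the same kernel as in the
    -- ideal experiment; where X has no mass both sides are zero.
    have h1 : ∀ (s : Fin n → 𝒴₁ × 𝒴₂ × 𝒵₁) (u : Fin n → 𝒰₀) (v : Fin n → 𝒰₁)
        (v' : Fin n → 𝒱₁ × 𝒱₂),
        (∏ i, P (x i, s i)) * ∏ i, Γ (M.f (u i) (v i) (x i)) (v' i)
        = law (prodPmf M.Q) (block M.X) x * M.blockOut n u v x (s, v') := by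
      intro s u v v'
      rw [law_block, blockOut, ← Finset.prod_mul_distrib, ← Finset.prod_mul_distrib]
      refine Finset.prod_congr rfl fun i _ => ?_
      rw [M.law_X, outKernel]
      by_cases h0 : ∑ s', P (x i, s') = 0
      · rw [h0, (Finset.sum_eq_zero_iff_of_nonneg fun s _ => hP _).1 h0 (s i)
          (Finset.mem_univ _)]
        simp
      · field_simp
    have h2 : ∀ (m : ι × κ) (s : Fin n → 𝒴₁ × 𝒴₂ × 𝒵₁),
        ∑ w : Fin n → 𝒲, ∑ v : Fin n → 𝒱₁ × 𝒱₂, (∏ i, P (x i, s i)) *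
          (likelihood (M.blockPx n) c x m *
            ind ((fun i => M.f ((c m.1).1 i) ((c m.1).2 m.2 i) (x i)) = w)) *
          (∏ i, Γ (w i) (v i)) * e (s, v)
        = law (prodPmf M.Q) (block M.X) x * (likelihood (M.blockPx n) c x m *
          ∑ v : Fin n → 𝒱₁ × 𝒱₂, M.blockOut n (c m.1).1 ((c m.1).2 m.2) x (s, v) * e (s, v)) := by
      intro m s
      have := sum_ind_eq (fun i => M.f ((c m.1).1 i) ((c m.1).2 m.2 i) (x i))
        fun w => ∑ v : Fin n → 𝒱₁ × 𝒱₂, likelihood (M.blockPx n) c x m *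
          ((∏ i, P (x i, s i)) * (∏ i, Γ (w i) (v i)) * e (s, v))
      simp only [h1] at this
      rw [Finset.mul_sum, Finset.mul_sum]
      refine Eq.trans ?_ (this.trans ?_)
      · refine Finset.sum_congr rfl fun w _ => ?_
        rw [Finset.mul_sum]
        exact Finset.sum_congr rfl fun v _ => by ring
      · exact Finset.sum_congr rfl fun v _ => by ring
    simp only [Finset.mul_sum (s := (Finset.univ : Finset (ι × κ))),
      Finset.sum_mul (s := (Finset.univ : Finset (ι × κ)))]
    rw [Finset.sum_congr rfl fun s _ => Finset.sum_congr rfl fun w _ => Finset.sum_comm,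
      Finset.sum_congr rfl fun s _ => Finset.sum_comm, Finset.sum_comm]
    refine Finset.sum_congr rfl fun m _ => ?_
    simp only [h2, Fintype.sum_prod_type, ← Finset.mul_sum]
  · congr 1
    congr 1; ext u v
    simp only [blockW, Finset.sum_mul, Finset.mul_sum, mul_assoc]
    exact Finset.sum_comm

lemma decisionProb₁_code_le (hP : ∀ s, 0 ≤ P s) (hΓ : ∀ w, Γ w ∈ stdSimplex ℝ (𝒱₁ × 𝒱₂))
    (c : Codebook (Fin n → 𝒰₀) (Fin n → 𝒰₁) ι κ) (G₁ T₁ G₂ T₂) :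
    decisionProb₁ P Γ (M.code c G₁ T₁ G₂ T₂) 1
      ≤ ∑ x, |law (prodPmf M.Q) (block M.X) x - average c fun u v => M.blockPx n u v x|
        + average c fun u v => ∑ o, M.blockW n u v o *
          ind (¬ T₁ (decodeSatellite c G₁ (obs₁ o)).1 (decodeSatellite c G₁ (obs₁ o)).2
            (fun i => (o.1 i).1) fun i => (o.1 i).2.2) := by
  rw [decisionProb₁_eq]
  refine le_of_eq_of_le ?_ (M.sum_enc_le hP hΓ c _ (fun _ => ind_nonneg _) fun _ => ind_le_one _)
  refine Finset.sum_congr rfl fun x _ => Finset.sum_congr rfl fun s _ =>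
    Finset.sum_congr rfl fun w _ => Finset.sum_congr rfl fun v _ => ?_
  congr 1
  exact ind_congr (ite_eq_one_iff_not _)

lemma decisionProb₂_code_le (hP : ∀ s, 0 ≤ P s) (hΓ : ∀ w, Γ w ∈ stdSimplex ℝ (𝒱₁ × 𝒱₂))
    (c : Codebook (Fin n → 𝒰₀) (Fin n → 𝒰₁) ι κ) (G₁ T₁ G₂ T₂) :
    decisionProb₂ P Γ (M.code c G₁ T₁ G₂ T₂) 1
      ≤ ∑ x, |law (prodPmf M.Q) (block M.X) x - average c fun u v => M.blockPx n u v x|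
        + average c fun u v => ∑ o, M.blockW n u v o *
          ind (¬ T₂ (decodeCloud c G₂ (obs₂ o)) fun i => (o.1 i).2.1) := by
  rw [decisionProb₂_eq]
  refine le_of_eq_of_le ?_ (M.sum_enc_le hP hΓ c _ (fun _ => ind_nonneg _) fun _ => ind_le_one _)
  refine Finset.sum_congr rfl fun x _ => Finset.sum_congr rfl fun s _ =>
    Finset.sum_congr rfl fun w _ => Finset.sum_congr rfl fun v _ => ?_
  congr 1
  exact ind_congr (ite_eq_one_iff_not _)

lemma law_Y₁Z₁ (y : 𝒴₁) (z : 𝒵₁) : law M.Q (fun ω => (M.Z₁ ω, M.Y₁ ω)) (z, y) = margYZ P y z := by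
  rw [← sum_law_pair M.Q _ fun ω => (M.X ω, M.Y₂ ω), Fintype.sum_prod_type]
  refine Finset.sum_congr rfl fun x _ => Finset.sum_congr rfl fun y₂ _ => ?_
  rw [← M.source]
  exact law_congr _ fun ω => by simp only [Z₁, Y₁, Y₂, Prod.ext_iff]; tauto

lemma law_Z₁ (z : 𝒵₁) : law M.Q M.Z₁ z = margZ P z := by
  rw [← sum_law_pair M.Q _ M.Y₁]
  simp only [law_Y₁Z₁]
  exact Finset.sum_comm

lemma law_Y₂ (y : 𝒴₂) : law M.Q M.Y₂ y = margY₂ P y := by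
  rw [← sum_law_pair M.Q _ fun ω => (M.X ω, M.Y₁ ω, M.Z₁ ω), Fintype.sum_prod_type]
  refine Finset.sum_congr rfl fun x _ => ?_
  rw [Fintype.sum_prod_type]
  refine Finset.sum_congr rfl fun y₁ _ => Finset.sum_congr rfl fun z _ => ?_
  rw [← M.source]
  exact law_congr _ fun ω => by simp only [Z₁, Y₁, Y₂, Prod.ext_iff]; tauto

/-- With the channel output and Z₁ frozen, the decoded codeword is fixed, and the test bound holds
for every codeword. Neither codebook nor decoding rule matters. -/
lemma decisionProb₁_altPmf_code_le (hP : P ∈ stdSimplex ℝ (𝒳 × 𝒴₁ × 𝒴₂ × 𝒵₁))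
    (hΓ : ∀ w, Γ w ∈ stdSimplex ℝ (𝒱₁ × 𝒱₂))
    (c : Codebook (Fin n → 𝒰₀) (Fin n → 𝒰₁) ι κ) (G₁ G₂ T₂) {r : ℝ} (hr : 0 < r) :
    decisionProb₁ (altPmf P) Γ (M.code c G₁ (fun u v => CondRatioTest (prodPmf M.Q) (block M.U)
      (block M.Y₁) (block M.Z₁) r fun i => (u i, v i)) G₂ T₂) 0 ≤ r⁻¹ := by
  refine decisionProb₁_altPmf_le hP hΓ _ fun z v₁ => ?_
  refine le_of_eq_of_le (Finset.sum_congr rfl fun y₁ _ => ?_)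
    (sum_condRatioTest_le (M.blockQ_mem n) (block M.U) (block M.Y₁) (block M.Z₁) hr
      (fun i => ((decodeSatellite c G₁ fun i => (v₁ i, z i)).1 i,
        (decodeSatellite c G₁ fun i => (v₁ i, z i)).2 i)) z)
  rw [law_block₂, law_block, ← Finset.prod_div_distrib]
  simp only [law_Y₁Z₁, law_Z₁]
  congr 1
  refine ind_congr ?_
  simp only [code]
  split_ifs with h <;> simp [h]

/-- The test need only be at least as strict as the ratio test, which admits one guarded by a
condition known to hold. -/
lemma decisionProb₂_altPmf_code_le (hP : P ∈ stdSimplex ℝ (𝒳 × 𝒴₁ × 𝒴₂ × 𝒵₁))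
    (hΓ : ∀ w, Γ w ∈ stdSimplex ℝ (𝒱₁ × 𝒱₂))
    (c : Codebook (Fin n → 𝒰₀) (Fin n → 𝒰₁) ι κ) (G₁ T₁ G₂) {T₂ : (Fin n → 𝒰₀) → (Fin n → 𝒴₂) → Prop}
    {r : ℝ} (hr : 0 < r)
    (hT : ∀ u y, T₂ u y → RatioTest (prodPmf M.Q) (block M.U₀) (block M.Y₂) r u y) :
    decisionProb₂ (altPmf P) Γ (M.code c G₁ T₁ G₂ T₂) 0 ≤ r⁻¹ := by
  refine decisionProb₂_altPmf_le hP hΓ _ fun v₂ => ?_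
  refine (Finset.sum_le_sum fun y₂ _ => ?_).trans
    (sum_ratioTest_le (M.blockQ_mem n) (block M.U₀) (block M.Y₂) hr (decodeCloud c G₂ v₂))
  rw [law_block]
  simp only [law_Y₂]
  refine mul_le_mul_of_nonneg_left (ind_mono fun h => hT _ _ ?_)
    (Finset.prod_nonneg fun _ _ => margY₂_nonneg hP.1 _)
  by_contra h'
  simp [code, h'] at h

/-- Achievability for a model that satisfies the decodability constraints strictly. Receiver 2 need
not decode if its exponent is not positive. -/
lemma isAchievable (hP : P ∈ stdSimplex ℝ (𝒳 × 𝒴₁ × 𝒴₂ × 𝒵₁))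
    (hΓ : ∀ w, Γ w ∈ stdSimplex ℝ (𝒱₁ × 𝒱₂)) (hdeg : IsDegraded Γ)
    (hc₁ : condMutualInfo M.Q M.U₁ M.X M.U₀ < condMutualInfo M.Q M.U₁ M.B₁ M.U₀)
    (hc₀ : mutualInfo M.Q M.U₀ M.X ≤ mutualInfo M.Q M.U₀ M.V₂) {t₁ t₂ : ℝ}
    (ht₁ : t₁ < condMutualInfo M.Q M.U M.Y₁ M.Z₁)
    (ht₂ : 0 < t₂ → mutualInfo M.Q M.U₀ M.X < mutualInfo M.Q M.U₀ M.V₂ ∧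
      t₂ < mutualInfo M.Q M.U₀ M.Y₂) {ε : ℝ} (hε : 0 < ε) :
    IsAchievable P Γ ε (max t₁ 0) (max t₂ 0) := by
  have hV : mutualInfo M.Q M.U₀ M.V₂ ≤ mutualInfo M.Q M.U₀ M.B₁ :=
    mutualInfo_le_of_markov M.mem (M.isMarkov_degraded hΓ hdeg)
  have hB := M.mutualInfo_U M.B₁
  have hX := M.mutualInfo_U M.X
  have n₀ := (mutualInfo_nonneg M.mem M.U₀ M.X).1
  have n₁ := (condMutualInfo_nonneg M.mem M.U₁ M.X M.U₀).1
  -- A quarter of the slack. Each rate lies one `η` above its source information, and each decoding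
  -- threshold one more above its rate or sum of rates. The joint threshold uses three, so
  -- strictness survives. Slack at Receiver 2 is needed only if it decodes.
  obtain ⟨η, hη, hη₁, hη₂⟩ : ∃ η > 0, 4 * η ≤ condMutualInfo M.Q M.U₁ M.B₁ M.U₀
      - condMutualInfo M.Q M.U₁ M.X M.U₀ ∧
      (0 < t₂ → 4 * η ≤ mutualInfo M.Q M.U₀ M.V₂ - mutualInfo M.Q M.U₀ M.X) := by
    by_cases h : 0 < t₂
    · refine ⟨min (condMutualInfo M.Q M.U₁ M.B₁ M.U₀ - condMutualInfo M.Q M.U₁ M.X M.U₀)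
        (mutualInfo M.Q M.U₀ M.V₂ - mutualInfo M.Q M.U₀ M.X) / 4,
        div_pos (lt_min (sub_pos.2 hc₁) (sub_pos.2 (ht₂ h).1)) (by norm_num), ?_, fun _ => ?_⟩
      · linarith [min_le_left (condMutualInfo M.Q M.U₁ M.B₁ M.U₀
          - condMutualInfo M.Q M.U₁ M.X M.U₀)
          (mutualInfo M.Q M.U₀ M.V₂ - mutualInfo M.Q M.U₀ M.X)]
      · linarith [min_le_right (condMutualInfo M.Q M.U₁ M.B₁ M.U₀
          - condMutualInfo M.Q M.U₁ M.X M.U₀)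
          (mutualInfo M.Q M.U₀ M.V₂ - mutualInfo M.Q M.U₀ M.X)]
    · exact ⟨(condMutualInfo M.Q M.U₁ M.B₁ M.U₀ - condMutualInfo M.Q M.U₁ M.X M.U₀) / 4,
        by linarith, by linarith, fun h' => absurd h' h⟩
  set R₀ := mutualInfo M.Q M.U₀ M.X + η with hR₀
  set R₁ := condMutualInfo M.Q M.U₁ M.X M.U₀ + η with hR₁
  set r := R₀ + η with hr
  set T₁ : ∀ n : ℕ, (Fin n → 𝒰₀) → (Fin n → 𝒰₁) → (Fin n → 𝒴₁) → (Fin n → 𝒵₁) → Prop :=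
    fun n u v => CondRatioTest (prodPmf M.Q) (block M.U) (block M.Y₁) (block M.Z₁)
      ((2 : ℝ) ^ (n * t₁)) fun i => (u i, v i) with hT₁
  -- Vacuous when `t₂ ≤ 0`: Receiver 2 then always decides for the null hypothesis.
  set T₂ : ∀ n : ℕ, (Fin n → 𝒰₀) → (Fin n → 𝒴₂) → Prop :=
    fun n u y => 0 < t₂ → RatioTest (prodPmf M.Q) (block M.U₀) (block M.Y₂)
      ((2 : ℝ) ^ (n * t₂)) u y with hT₂
  have lim₀ := M.tendsto_expect_totalVariation (R₀ := R₀) (R₁ := R₁) (by linarith)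
    (lt_of_eq_of_lt hX (by linarith))
  have lim₁ := M.tendsto_expect_error₁ hP.1 hΓ (R₀ := R₀) (R₁ := R₁) (r₁ := R₁ + η)
    (r₀ := R₀ + R₁ + η) (by linarith) (by linarith) (by linarith) (by linarith) (by linarith)
    (by rw [hB]; linarith)
    (fun n u v o => T₁ n u v (fun i => (o.1 i).1) fun i => (o.1 i).2.2)
    (tendsto_condRatioTest M.mem M.U M.Y₁ M.Z₁ ht₁)
  have lim₂ : Tendsto (fun n : ℕ => expect (codebookPmf (M.blockP₀ n) (M.blockP₁ n))
      fun c : Codebook (Fin n → 𝒰₀) (Fin n → 𝒰₁) (Fin (numMsg n R₀ + 1))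
        (Fin (numMsg n R₁ + 1)) => average c fun u v => ∑ o, M.blockW n u v o *
          ind (¬ T₂ n (decodeCloud c (M.accept₂ n r) (obs₂ o)) fun i => (o.1 i).2.1))
      atTop (𝓝 0) := by
    by_cases h : 0 < t₂
    · refine M.tendsto_expect_error₂ hP.1 hΓ (by linarith) (by linarith)
        (by linarith [hη₂ h]) (fun n u o => T₂ n u fun i => (o.1 i).2.1) ?_
      refine (tendsto_ratioTest M.mem M.U₀ M.Y₂ (ht₂ h).2).congr fun n =>
        expect_congr fun ω _ => ind_congr (not_congr ?_)
      exact ⟨fun h' _ => h', fun h' => h' h⟩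
    · have : ∀ n (u : Fin n → 𝒰₀) (y : Fin n → 𝒴₂), ind (¬ T₂ n u y) = 0 := fun n u y =>
        ind_of_not fun hn => hn fun h' => absurd h' h
      simp only [this, mul_zero, Finset.sum_const_zero, average, expect]
      exact tendsto_const_nhds
  have lim := (lim₀.add lim₁).add lim₂
  simp only [← expect_add, add_zero] at lim
  -- The covering distance and both decoding errors are added before a codebook is chosen, so that
  -- one codebook serves both receivers.
  choose c hc using fun n : ℕ => exists_le_expect
    (codebookPmf_mem (ι := Fin (numMsg n R₀ + 1)) (κ := Fin (numMsg n R₁ + 1))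
      (M.blockP₀_mem n) (M.blockP₁_mem n)) fun c =>
    ∑ x, |law (prodPmf M.Q) (block M.X) x - average c fun u v => M.blockPx n u v x|
    + (average c fun u v => ∑ o, M.blockW n u v o *
      ind (¬ T₁ n (decodeSatellite c (M.accept₁ n (R₁ + η) (R₀ + R₁ + η)) (obs₁ o)).1
        (decodeSatellite c (M.accept₁ n (R₁ + η) (R₀ + R₁ + η)) (obs₁ o)).2
        (fun i => (o.1 i).1) fun i => (o.1 i).2.2))
    + average c fun u v => ∑ o, M.blockW n u v o *
      ind (¬ T₂ n (decodeCloud c (M.accept₂ n r) (obs₂ o)) fun i => (o.1 i).2.1)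
  have av : ∀ (n : ℕ) (e : (Fin n → 𝒴₁ × 𝒴₂ × 𝒵₁) × (Fin n → 𝒱₁ × 𝒱₂) → ℝ), (∀ o, 0 ≤ e o) →
      0 ≤ average (c n) fun u v => ∑ o, M.blockW n u v o * e o := fun n e he =>
    average_nonneg _ fun u v => Finset.sum_nonneg fun o _ =>
      mul_nonneg (M.blockW_nonneg n hP.1 hΓ _ _ _) (he o)
  have inv : ∀ (n : ℕ) (t : ℝ), ((2 : ℝ) ^ (n * t))⁻¹ = (2 : ℝ) ^ (n * -t) := fun n t => by
    rw [mul_neg, Real.rpow_neg (by norm_num)]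
  refine ⟨fun n => M.code (c n) (M.accept₁ n (R₁ + η) (R₀ + R₁ + η)) (T₁ n) (M.accept₂ n r) (T₂ n),
    ?_, le_exponent ?_, le_exponent ?_⟩
  · filter_upwards [lim.eventually_le_const hε] with n hn
    have h0 := (hc n).trans hn
    constructor
    · refine (M.decisionProb₁_code_le hP.1 hΓ _ _ _ _ _).trans (le_trans ?_ h0)
      exact le_add_of_nonneg_right (av n _ fun _ => ind_nonneg _)
    · refine (M.decisionProb₂_code_le hP.1 hΓ _ _ _ _ _).trans (le_trans ?_ h0)
      exact add_le_add_left (le_add_of_nonneg_right (av n _ fun _ => ind_nonneg _)) _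
  · refine Eventually.of_forall fun n => ⟨decisionProb₁_nonneg (altPmf_nonneg hP.1) hΓ _ _,
      decisionProb₁_altPmf_le_one hP hΓ _, ?_⟩
    rw [← inv]
    exact M.decisionProb₁_altPmf_code_le hP hΓ _ _ _ _ (by positivity)
  · refine Eventually.of_forall fun n => ⟨decisionProb₂_nonneg (altPmf_nonneg hP.1) hΓ _ _,
      decisionProb₂_altPmf_le_one hP hΓ _, ?_⟩
    by_cases h : 0 < t₂
    · rw [← inv]
      exact M.decisionProb₂_altPmf_code_le hP hΓ _ _ _ _ (by positivity) fun u y h' => h' h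
    · refine (decisionProb₂_altPmf_le_one hP hΓ _).trans
        (Real.one_le_rpow (by norm_num) (mul_nonneg (by positivity) (by linarith)))

end HybridCode

end HybridModel

/-! ### From models to the exponents region -/

section Region

variable {𝒳 𝒴₁ 𝒴₂ 𝒵₁ 𝒲 𝒱₁ 𝒱₂ : Type*}
  [Fintype 𝒳] [Fintype 𝒴₁] [Fintype 𝒴₂] [Fintype 𝒵₁] [Fintype 𝒲] [Fintype 𝒱₁] [Fintype 𝒱₂]
  {P : 𝒳 × 𝒴₁ × 𝒴₂ × 𝒵₁ → ℝ} {Γ : 𝒲 → 𝒱₁ × 𝒱₂ → ℝ}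

omit [Fintype 𝒳] [Fintype 𝒲] [Fintype 𝒱₁] [Fintype 𝒱₂] in
/-- The Markov chains of the hybrid region determine the joint law. -/
lemma law_of_isMarkov {Ω 𝒰₀ 𝒰₁ : Type*} [Fintype Ω] {Q : Ω → ℝ} (hQ : Q ∈ stdSimplex ℝ Ω)
    {U₀ : Ω → 𝒰₀} {U₁ : Ω → 𝒰₁} {X : Ω → 𝒳} {Y₁ : Ω → 𝒴₁} {Y₂ : Ω → 𝒴₂} {Z₁ : Ω → 𝒵₁} {W : Ω → 𝒲}
    {V₁ : Ω → 𝒱₁} {V₂ : Ω → 𝒱₂} {f : 𝒰₀ → 𝒰₁ → 𝒳 → 𝒲}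
    (hsrc : ∀ s, law Q (fun ω => (X ω, Y₁ ω, Y₂ ω, Z₁ ω)) s = P s)
    (hch : ∀ w v, law Q (fun ω => (W ω, (V₁ ω, V₂ ω))) (w, v) = law Q W w * Γ w v)
    (hU : IsMarkov Q (fun ω => (U₀ ω, U₁ ω)) X (fun ω => (Z₁ ω, Y₁ ω, Y₂ ω)))
    (hV : IsMarkov Q (fun ω => ((Y₁ ω, Y₂ ω, Z₁ ω), (U₀ ω, U₁ ω, X ω))) W
      (fun ω => (V₁ ω, V₂ ω)))
    (hW : ∀ ω, W ω = f (U₀ ω) (U₁ ω) (X ω)) (u₀ : 𝒰₀) (u₁ : 𝒰₁) (x : 𝒳) (s : 𝒴₁ × 𝒴₂ × 𝒵₁)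
    (v : 𝒱₁ × 𝒱₂) :
    law Q (fun ω => ((U₀ ω, U₁ ω, X ω, (Y₁ ω, Y₂ ω, Z₁ ω)), (V₁ ω, V₂ ω))) ((u₀, u₁, x, s), v)
      = law Q (fun ω => (U₀ ω, U₁ ω, X ω)) (u₀, u₁, x) * (P (x, s) / ∑ s', P (x, s')) *
        Γ (f u₀ u₁ x) v := by
  have hX : law Q X x = ∑ s', P (x, s') := by
    rw [← sum_law_pair Q X fun ω => (Y₁ ω, Y₂ ω, Z₁ ω)]
    exact Finset.sum_congr rfl fun s' _ => hsrc (x, s')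
  set B := law Q (fun ω => ((Y₁ ω, Y₂ ω, Z₁ ω), (U₀ ω, U₁ ω, X ω))) (s, u₀, u₁, x) with hB
  have h1 : law Q (fun ω => ((U₀ ω, U₁ ω, X ω, (Y₁ ω, Y₂ ω, Z₁ ω)), (V₁ ω, V₂ ω)))
      ((u₀, u₁, x, s), v) = B * Γ (f u₀ u₁ x) v := by
    have h := hV (s, u₀, u₁, x) (f u₀ u₁ x) v
    rw [hch, ← mul_assoc, mul_right_comm] at h
    have e1 : law Q (fun ω => (((Y₁ ω, Y₂ ω, Z₁ ω), (U₀ ω, U₁ ω, X ω)), W ω, (V₁ ω, V₂ ω)))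
        ((s, u₀, u₁, x), f u₀ u₁ x, v)
        = law Q (fun ω => ((U₀ ω, U₁ ω, X ω, (Y₁ ω, Y₂ ω, Z₁ ω)), (V₁ ω, V₂ ω)))
          ((u₀, u₁, x, s), v) := by
      refine law_congr _ fun ω => ?_
      simp only [Prod.mk.injEq, hW]
      refine ⟨fun h => ?_, fun h => ?_⟩
      · tauto
      · obtain ⟨⟨rfl, rfl, rfl, rfl⟩, rfl⟩ := h
        simp
    have e2 : law Q (fun ω => (((Y₁ ω, Y₂ ω, Z₁ ω), (U₀ ω, U₁ ω, X ω)), W ω))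
        ((s, u₀, u₁, x), f u₀ u₁ x) = B := by
      refine law_congr _ fun ω => ?_
      simp only [Prod.mk.injEq, hW]
      refine ⟨fun h => ?_, fun h => ?_⟩
      · tauto
      · obtain ⟨rfl, rfl, rfl, rfl⟩ := h
        simp
    rw [e1, e2] at h
    -- The mass of the channel input can be cancelled only if positive; otherwise both sides vanish.
    by_cases hw : law Q W (f u₀ u₁ x) = 0
    · have hB0 : B = 0 := law_eq_zero_of_imp hQ.1 (B := W) (b := f u₀ u₁ x) (fun ω h => by
        simp only [Prod.mk.injEq] at h
        rw [hW, h.2.1, h.2.2.1, h.2.2.2]) hw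
      rw [hB0, zero_mul]
      exact law_eq_zero_of_imp hQ.1 (B := W) (b := f u₀ u₁ x) (fun ω h => by
        simp only [Prod.mk.injEq] at h
        rw [hW, h.1.1, h.1.2.1, h.1.2.2.1]) hw
    · exact mul_right_cancel₀ hw h
  have h2 : B = law Q (fun ω => (U₀ ω, U₁ ω, X ω)) (u₀, u₁, x) *
      (P (x, s) / ∑ s', P (x, s')) := by
    rw [← hX]
    by_cases hx : law Q X x = 0
    · rw [hx, div_zero, mul_zero]
      exact law_eq_zero_of_imp hQ.1 (B := X) (b := x) (fun ω h => by
        simp only [Prod.mk.injEq] at h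
        exact h.2.2.2) hx
    · rw [mul_div_assoc', eq_div_iff hx, ← hsrc]
      have h := hU (u₀, u₁) x (s.2.2, s.1, s.2.1)
      convert h using 2
      · exact law_congr _ fun ω => by simp only [Prod.ext_iff]; tauto
      · exact law_congr _ fun ω => by simp only [Prod.ext_iff]; tauto
      · exact law_congr _ fun ω => by simp only [Prod.ext_iff]; tauto
  rw [h1, h2]

omit [Fintype 𝒲] in
/-- If the channel input of a degraded channel does not affect the output of Receiver 1, it does not
affect the one of Receiver 2 either. -/
lemma IsDegraded.sum_eq (hdeg : IsDegraded Γ) {w w' : 𝒲}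
    (h : ∀ v₁, ∑ v₂, Γ w (v₁, v₂) = ∑ v₂, Γ w' (v₁, v₂)) (v₂ : 𝒱₂) :
    ∑ v₁, Γ w (v₁, v₂) = ∑ v₁, Γ w' (v₁, v₂) := by
  obtain ⟨D, _, hD⟩ := hdeg
  refine Finset.sum_congr rfl fun v₁ _ => ?_
  rw [hD, h, ← hD]

/-- The pair of zero exponents is achieved by always deciding for the null hypothesis. -/
lemma isAchievable_zero [Nonempty 𝒲] (hP : P ∈ stdSimplex ℝ (𝒳 × 𝒴₁ × 𝒴₂ × 𝒵₁))
    (hΓ : ∀ w, Γ w ∈ stdSimplex ℝ (𝒱₁ × 𝒱₂)) {ε : ℝ} (hε : 0 < ε) :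
    IsAchievable P Γ ε 0 0 := by
  classical
  refine ⟨fun n =>
    { enc := fun _ => Pi.single (Classical.arbitrary _) 1
      enc_mem := fun _ => single_mem_stdSimplex ℝ _
      dec₁ := fun _ _ _ => 0
      dec₂ := fun _ _ => 0 }, Eventually.of_forall fun n => ?_, ?_, ?_⟩
  · simp only [decisionProb₁, decisionProb₂]
    simpa using hε.le
  · have := le_exponent (t := 0) (Eventually.of_forall fun n =>
      ⟨decisionProb₁_nonneg (altPmf_nonneg hP.1) hΓ
        ({ enc := fun _ => Pi.single (Classical.arbitrary _) 1
           enc_mem := fun _ => single_mem_stdSimplex ℝ _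
           dec₁ := fun _ _ _ => 0
           dec₂ := fun _ _ => 0 } : Code 𝒳 𝒴₁ 𝒴₂ 𝒵₁ 𝒲 𝒱₁ 𝒱₂ n) 0,
      decisionProb₁_altPmf_le_one hP hΓ _,
      (decisionProb₁_altPmf_le_one hP hΓ _).trans (by simp)⟩)
    simpa only [max_self] using this
  · have := le_exponent (t := 0) (Eventually.of_forall fun n =>
      ⟨decisionProb₂_nonneg (altPmf_nonneg hP.1) hΓ
        ({ enc := fun _ => Pi.single (Classical.arbitrary _) 1
           enc_mem := fun _ => single_mem_stdSimplex ℝ _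
           dec₁ := fun _ _ _ => 0
           dec₂ := fun _ _ => 0 } : Code 𝒳 𝒴₁ 𝒴₂ 𝒵₁ 𝒲 𝒱₁ 𝒱₂ n) 0,
      decisionProb₂_altPmf_le_one hP hΓ _,
      (decisionProb₂_altPmf_le_one hP hΓ _).trans (by simp)⟩)
    simpa only [max_self] using this

lemma abs_sub_max_lt {a δ : ℝ} (ha : 0 ≤ a) (hδ : 0 < δ) : |a - max (a - δ / 2) 0| < δ := by
  rw [abs_lt]
  rcases max_cases (a - δ / 2) 0 with h | h <;> constructor <;> linarith

/-- Either two inputs can be told apart at Receiver 1, and the constraints can be made strict at an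
arbitrarily small loss that the closure absorbs; or the channel is useless to both receivers, and
the constraints leave no positive exponent. -/
lemma HybridModel.mem_exponentsRegion {Ω 𝒰₀ 𝒰₁ : Type*} [Fintype Ω] [Fintype 𝒰₀] [Fintype 𝒰₁]
    (M : HybridModel P Γ Ω 𝒰₀ 𝒰₁) (hP : P ∈ stdSimplex ℝ (𝒳 × 𝒴₁ × 𝒴₂ × 𝒵₁))
    (hΓ : ∀ w, Γ w ∈ stdSimplex ℝ (𝒱₁ × 𝒱₂)) (hdeg : IsDegraded Γ)
    (hc₁ : condMutualInfo M.Q M.U₁ M.X M.U₀ ≤ condMutualInfo M.Q M.U₁ M.B₁ M.U₀)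
    (hc₀ : mutualInfo M.Q M.U₀ M.X ≤ mutualInfo M.Q M.U₀ M.V₂) {θ₁ θ₂ : ℝ} (h₁ : 0 ≤ θ₁)
    (h₂ : 0 ≤ θ₂) (hθ₁ : θ₁ ≤ condMutualInfo M.Q M.U M.Y₁ M.Z₁)
    (hθ₂ : θ₂ ≤ mutualInfo M.Q M.U₀ M.Y₂) : (θ₁, θ₂) ∈ exponentsRegion P Γ := by
  have hYX := M.mutualInfo_U₀_X_le hΓ
  by_cases hconst : ∀ w w' v₁, ∑ v₂, Γ w (v₁, v₂) = ∑ v₂, Γ w' (v₁, v₂)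
  · have hV := M.mutualInfo_V₂_eq_zero hΓ fun w w' => hdeg.sum_eq (hconst w w')
    have hB := M.mutualInfo_B₁_eq hΓ hconst
    have hY := M.condMutualInfo_Y₁_le hΓ
    have hVB : mutualInfo M.Q M.U₀ M.V₂ ≤ mutualInfo M.Q M.U₀ M.B₁ :=
      mutualInfo_le_of_markov M.mem (M.isMarkov_degraded hΓ hdeg)
    rw [M.mutualInfo_U M.X] at hY
    rw [M.mutualInfo_U M.B₁] at hB
    -- The constraints and degradedness give I(U;X) ≤ I(U;V₁,Z₁), which is at most I(U;Z₁) for a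
    -- useless channel, so Y₁ adds nothing to Z₁. Likewise I(U₀;Y₂) ≤ I(U₀;X) ≤ I(U₀;V₂) = 0.
    obtain rfl : θ₁ = 0 := le_antisymm (by linarith) h₁
    obtain rfl : θ₂ = 0 := le_antisymm (by linarith) h₂
    have : Nonempty Ω := by
      by_contra hΩ
      rw [not_nonempty_iff] at hΩ
      simpa using M.mem.2
    have : Nonempty 𝒲 := this.map fun ω => M.f (M.U₀ ω) (M.U₁ ω) (M.X ω)
    exact subset_closure ⟨le_rfl, le_rfl, fun ε hε => isAchievable_zero hP hΓ hε.1⟩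
  · obtain ⟨w₀, w₁, ⟨v₁, hv₁⟩, hv₂⟩ : ∃ w₀ w₁,
        (∃ v₁, ∑ v₂, Γ w₀ (v₁, v₂) ≠ ∑ v₂, Γ w₁ (v₁, v₂)) ∧
        (0 < θ₂ → ∃ v₂, ∑ v₁, Γ w₀ (v₁, v₂) ≠ ∑ v₁, Γ w₁ (v₁, v₂)) := by
      -- If θ₂ is positive, some two inputs differ at Receiver 2, since otherwise I(U₀;V₂) = 0. By
      -- degradedness the same pair differs at Receiver 1, so one pair probes both channels.
      by_cases hpos : 0 < θ₂
      · have hne : ¬ ∀ w w' v₂, ∑ v₁, Γ w (v₁, v₂) = ∑ v₁, Γ w' (v₁, v₂) := fun h => by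
          have := M.mutualInfo_V₂_eq_zero hΓ h
          linarith
        push Not at hne
        obtain ⟨w₀, w₁, v₂, hv⟩ := hne
        refine ⟨w₀, w₁, ?_, fun _ => ⟨v₂, hv⟩⟩
        by_contra! h
        exact hv (hdeg.sum_eq h v₂)
      · push Not at hconst
        obtain ⟨w₀, w₁, v₁, hv⟩ := hconst
        exact ⟨w₀, w₁, ⟨v₁, hv⟩, fun h => absurd h hpos⟩
    refine Metric.mem_closure_iff.2 fun δ hδ => ?_
    obtain ⟨M', hs₁, hs₀, hs₀', ht₁, ht₂⟩ := M.exists_strict hP hΓ w₀ w₁ hc₁ hc₀ hv₁ (half_pos hδ)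
    refine ⟨(max (θ₁ - δ / 2) 0, max (θ₂ - δ / 2) 0), ⟨le_max_right _ _, le_max_right _ _,
      fun ε hε => M'.isAchievable hP hΓ hdeg hs₁ hs₀ (by linarith)
        (fun h => ⟨hs₀' (hv₂ (by linarith)), by linarith⟩) hε.1⟩, ?_⟩
    rw [Prod.dist_eq, max_lt_iff, Real.dist_eq, Real.dist_eq]
    exact ⟨abs_sub_max_lt h₁ hδ, abs_sub_max_lt h₂ hδ⟩

end Region

end HybridTesting

theorem theorem4 {𝒳 𝒴₁ 𝒴₂ 𝒵₁ 𝒲 𝒱₁ 𝒱₂ : Type*}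
    [Fintype 𝒳] [Fintype 𝒴₁] [Fintype 𝒴₂] [Fintype 𝒵₁] [Fintype 𝒲] [Fintype 𝒱₁] [Fintype 𝒱₂]
    (P : 𝒳 × 𝒴₁ × 𝒴₂ × 𝒵₁ → ℝ) (hP : P ∈ stdSimplex ℝ (𝒳 × 𝒴₁ × 𝒴₂ × 𝒵₁))
    (Γ : 𝒲 → 𝒱₁ × 𝒱₂ → ℝ) (hΓ : ∀ w, Γ w ∈ stdSimplex ℝ (𝒱₁ × 𝒱₂))
    (hdeg : HybridTesting.IsDegraded Γ) :
    HybridTesting.hybridRegion P Γ ⊆ HybridTesting.exponentsRegion P Γ := by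
  rintro ⟨θ₁, θ₂⟩ ⟨h₁, h₂, Ω, 𝒰₀, 𝒰₁, _, _, _, Q, U₀, U₁, X, Y₁, Y₂, Z₁, W, V₁, V₂, f, hQ, hsrc, hch,
    hU, hV, hW, hc₁, hc₀, hθ₁, hθ₂⟩
  exact HybridTesting.HybridModel.mem_exponentsRegion
    { Q := Q, U₀ := U₀, U₁ := U₁, X := X, S := fun ω => (Y₁ ω, Y₂ ω, Z₁ ω)
      V := fun ω => (V₁ ω, V₂ ω), f := f, mem := hQ, source := fun x s => hsrc (x, s)
      factor := HybridTesting.law_of_isMarkov hQ hsrc hch hU hV.2 hW }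
    hP hΓ hdeg hc₁ hc₀ h₁ h₂ hθ₁ hθ₂
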